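/- Let $\mathsf{RCA}_0^\omega$ be Kohlenbach's base theory of higher-order reverse mathematics: classical many-sorted predicate logic in the language of all finite types (numbers have type $0$; variables of every finite type; constants $0$, $S$, the combinators $\Pi,\Sigma$ and the recursor $R_0$ for numbers; equality of numbers is primitive and equality of higher types is defined extensionally), with the successor axioms, the defining equations of the constants, the axiom of extensionality, induction for quantifier-free formulas, and the choice schema $\mathsf{QF\text{-}AC}^{1,0}$: $(\forall f^1)(\exists n^0)A(f,n)\to(\exists \Phi^2)(\forall f^1)A(f,\Phi(f))$ for quantifier-free $A$. Let $\mathsf{WKL}$ be weak König's lemma: every infinite binary tree has an infinite path. Real numbers are coded by sequences of rationals $(q_n)$ with $|q_n-q_{n+i}|<2^{-n}$ for all $n,i$, and functions on reals are functionals of type $1\to 1$ that respect equality of reals. A function $\Psi:[0,1]\to\mathbb{R}$ is \emph{continuous almost everywhere} if it is continuous at every point of $[0,1]\setminus E$ for some set $E\subseteq[0,1]$ such that $E$ is the complement of the union of a sequence of open intervals with rational end points and $E$ has measure zero, i.e. for every $\varepsilon>0$ there is a sequence of open intervals with rational end points that covers $E$ and has total length below $\varepsilon$. \textbf{Theorem.}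 The system $\mathsf{RCA}_0^\omega+\mathsf{WKL}$ proves $\mathsf{WHBU}_{\mathrm{ae}}$, the following statement: for every $\Psi:[0,1]\to\mathbb{R}^+$ that is continuous almost everywhere and every real $\varepsilon>0$, there are pairwise distinct $y_0,\dots,y_k\in[0,1]$ with $$1-\varepsilon<\sum_{i\le k}|J_{y_i}^\Psi|,$$ where $I_y^\Psi=(y-\Psi(y),y+\Psi(y))$, $J_{y_i}^\Psi=I_{y_i}^\Psi\setminus\bigcup_{j<i}I_{y_j}^\Psi$, and $|J|$ is the length of the finite union of intervals $J$. -/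

import Mathlib

/-! # Arithmetic in all finite types: language, deductions, `RCA₀^ω`, `WKL` and `WHBU_ae` -/

namespace HOArith

/-! ## Types, terms, formulas -/

/-- The finite types: `0`, and `σ → τ` for finite types `σ` and `τ`. -/
inductive Ty : Type
  | nat : Ty
  | arr : Ty → Ty → Ty

infixr:60 " ⇒ₜ " => Ty.arr

/-- Type `1`: functions from numbers to numbers. -/
abbrev Ty.one : Ty := Ty.nat ⇒ₜ Ty.nat

/-- Type `2`: functionals mapping type `1` objects to numbers. -/
abbrev Ty.two : Ty := Ty.one ⇒ₜ Ty.nat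

open Ty (nat one two)

/-- `Var Γ τ`: the (de Bruijn) variables of type `τ` in the context `Γ`. -/
inductive Var : List Ty → Ty → Type
  | zero {Γ : List Ty} {σ : Ty} : Var (σ :: Γ) σ
  | succ {Γ : List Ty} {σ τ : Ty} : Var Γ τ → Var (σ :: Γ) τ

/-- Terms of type `τ` in the context `Γ`: variables, zero, successor, the combinators `Π` (`K`) and
`Σ` (`S`), the recursor `R₀` for numbers, and application. -/
inductive Tm (Γ : List Ty) : Ty → Type
  | var {τ : Ty} : Var Γ τ → Tm Γ τ
  | zero : Tm Γ nat
  | succ : Tm Γ (nat ⇒ₜ nat)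
  | K (σ τ : Ty) : Tm Γ (σ ⇒ₜ τ ⇒ₜ σ)
  | S (ρ σ τ : Ty) : Tm Γ ((ρ ⇒ₜ σ ⇒ₜ τ) ⇒ₜ (ρ ⇒ₜ σ) ⇒ₜ ρ ⇒ₜ τ)
  | R : Tm Γ (nat ⇒ₜ nat ⇒ₜ (nat ⇒ₜ nat ⇒ₜ nat) ⇒ₜ nat)
  | app {σ τ : Ty} : Tm Γ (σ ⇒ₜ τ) → Tm Γ σ → Tm Γ τ

infixl:90 " ⬝ₜ " => Tm.app

/-- Formulas in the context `Γ`. The only primitive predicate is equality of numbers; the other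
connectives and the existential quantifier are defined classically from `⊥`, `→`, `∀`. -/
inductive Fm : List Ty → Type
  | eq {Γ : List Ty} : Tm Γ nat → Tm Γ nat → Fm Γ
  | bot {Γ : List Ty} : Fm Γ
  | imp {Γ : List Ty} : Fm Γ → Fm Γ → Fm Γ
  | all {Γ : List Ty} (σ : Ty) : Fm (σ :: Γ) → Fm Γ

/-- Sentences: formulas without free variables. -/
abbrev Sentence : Type := Fm []

/-! ## Substitution -/

/-- Substitutions from the context `Γ` to the context `Δ`. -/
abbrev Sub (Γ Δ : List Ty) : Type := ∀ τ : Ty, Var Γ τ → Tm Δ τ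

/-- Simultaneous substitution in a term. -/
def Tm.subst {Γ Δ : List Ty} (s : Sub Γ Δ) : {τ : Ty} → Tm Γ τ → Tm Δ τ
  | _, .var v => s _ v
  | _, .zero => .zero
  | _, .succ => .succ
  | _, .K σ τ => .K σ τ
  | _, .S ρ σ τ => .S ρ σ τ
  | _, .R => .R
  | _, .app f a => .app (f.subst s) (a.subst s)

/-- Weakening substitution: add an unused variable to the context. -/
def Sub.wk {Γ : List Ty} {σ : Ty} : Sub Γ (σ :: Γ) := fun _ v => .var v.succ

/-- A term, read in a context with one more variable. -/
def Tm.wk {Γ : List Ty} {σ τ : Ty} (t : Tm Γ τ) : Tm (σ :: Γ) τ := t.subst Sub.wk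

/-- Extend a substitution by a term for the variable `0`. -/
def Sub.cons {Γ Δ : List Ty} {σ : Ty} (t : Tm Δ σ) (s : Sub Γ Δ) : Sub (σ :: Γ) Δ
  | _, .zero => t
  | _, .succ v => s _ v

/-- Move a substitution under a quantifier. -/
def Sub.lift {Γ Δ : List Ty} {σ : Ty} (s : Sub Γ Δ) : Sub (σ :: Γ) (σ :: Δ) :=
  Sub.cons (.var .zero) (fun _ v => (s _ v).wk)

/-- Simultaneous (capture-avoiding) substitution in a formula. -/
def Fm.subst : {Γ Δ : List Ty} → Sub Γ Δ → Fm Γ → Fm Δ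
  | _, _, s, .eq a b => .eq (a.subst s) (b.subst s)
  | _, _, _, .bot => .bot
  | _, _, s, .imp φ ψ => .imp (φ.subst s) (ψ.subst s)
  | _, _, s, .all σ φ => .all σ (φ.subst s.lift)

/-- A formula, read in a context with one more variable. -/
def Fm.wk {Γ : List Ty} {σ : Ty} (φ : Fm Γ) : Fm (σ :: Γ) := φ.subst Sub.wk

/-- `φ[t]`: substitute `t` for the variable `0`. -/
def Fm.inst {Γ : List Ty} {σ : Ty} (φ : Fm (σ :: Γ)) (t : Tm Γ σ) : Fm Γ :=
  φ.subst (Sub.cons t (fun _ v => .var v))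

/-- The substitution from the empty context. -/
def Sub.empty {Γ : List Ty} : Sub [] Γ := fun _ v => nomatch v

/-- A sentence, read in an arbitrary context. -/
def Fm.inCtx (φ : Sentence) (Γ : List Ty) : Fm Γ := φ.subst (Sub.empty (Γ := Γ))

/-! ## Deductions -/

/-- Natural deduction for classical many-sorted predicate logic: `Derives T Δ φ` says that `φ`
is derivable from axioms in `T` under the assumptions `Δ`; the variables in the context `Γ` may
occur free. -/
inductive Derives (T : Set Sentence) : {Γ : List Ty} → List (Fm Γ) → Fm Γ → Prop
  | ax {Γ : List Ty} {Δ : List (Fm Γ)} {φ : Sentence} : φ ∈ T → Derives T Δ (φ.inCtx Γ)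
  | hyp {Γ : List Ty} {Δ : List (Fm Γ)} {φ : Fm Γ} : φ ∈ Δ → Derives T Δ φ
  | impI {Γ : List Ty} {Δ : List (Fm Γ)} {φ ψ : Fm Γ} :
      Derives T (φ :: Δ) ψ → Derives T Δ (.imp φ ψ)
  | impE {Γ : List Ty} {Δ : List (Fm Γ)} {φ ψ : Fm Γ} :
      Derives T Δ (.imp φ ψ) → Derives T Δ φ → Derives T Δ ψ
  | raa {Γ : List Ty} {Δ : List (Fm Γ)} {φ : Fm Γ} :
      Derives T (.imp φ .bot :: Δ) .bot → Derives T Δ φ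
  | allI {Γ : List Ty} {Δ : List (Fm Γ)} {σ : Ty} {φ : Fm (σ :: Γ)} :
      Derives T (Δ.map Fm.wk) φ → Derives T Δ (.all σ φ)
  | allE {Γ : List Ty} {Δ : List (Fm Γ)} {σ : Ty} {φ : Fm (σ :: Γ)} (t : Tm Γ σ) :
      Derives T Δ (.all σ φ) → Derives T Δ (φ.inst t)

/-- The system with axioms `T` proves the sentence `φ`. -/
def Proves (T : Set Sentence) (φ : Sentence) : Prop := Derives T (Γ := []) [] φ

/-! ## Defined connectives; quantifiers with a named variable -/

infixr:25 " →ₒ " => Fm.imp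
infix:50 " =ₒ " => Fm.eq

/-- Negation. -/
def Fm.not {Γ : List Ty} (φ : Fm Γ) : Fm Γ := φ →ₒ .bot

/-- Conjunction. -/
def Fm.and {Γ : List Ty} (φ ψ : Fm Γ) : Fm Γ := Fm.not (φ →ₒ Fm.not ψ)

/-- Disjunction. -/
def Fm.or {Γ : List Ty} (φ ψ : Fm Γ) : Fm Γ := Fm.not φ →ₒ ψ

/-- Existential quantification of the variable `0`. -/
def Fm.ex {Γ : List Ty} (σ : Ty) (φ : Fm (σ :: Γ)) : Fm Γ := Fm.not (.all σ (Fm.not φ))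

prefix:max "¬ₒ" => Fm.not
infixr:35 " ∧ₒ " => Fm.and
infixr:30 " ∨ₒ " => Fm.or

/-- `forallₒ σ fun x => φ x` is `∀ x^σ, φ x`. Terms from outside the quantifier are moved under it
with `Tm.wk`; the contexts in the types leave no freedom in the number of weakenings. -/
def forallₒ {Γ : List Ty} (σ : Ty) (φ : Tm (σ :: Γ) σ → Fm (σ :: Γ)) : Fm Γ :=
  .all σ (φ (.var .zero))

/-- `existsₒ σ fun x => φ x` is `∃ x^σ, φ x`. -/
def existsₒ {Γ : List Ty} (σ : Ty) (φ : Tm (σ :: Γ) σ → Fm (σ :: Γ)) : Fm Γ :=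
  .ex σ (φ (.var .zero))

/-- Extensional equality at any type: `s x₁ … xₖ = t x₁ … xₖ` for all `x₁, …, xₖ`. -/
def eqAt {Γ : List Ty} : (τ : Ty) → Tm Γ τ → Tm Γ τ → Fm Γ
  | .nat, s, t => s =ₒ t
  | .arr σ τ, s, t => forallₒ σ fun x => eqAt τ (s.wk ⬝ₜ x) (t.wk ⬝ₜ x)

/-- Universal closure. -/
def Fm.closure : {Γ : List Ty} → Fm Γ → Sentence
  | [], φ => φ
  | _ :: _, φ => Fm.closure (.all _ φ)

/-- Quantifier-free formulas. -/
def Fm.IsQF : {Γ : List Ty} → Fm Γ → Prop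
  | _, .eq _ _ => True
  | _, .bot => True
  | _, .imp φ ψ => φ.IsQF ∧ ψ.IsQF
  | _, .all _ _ => False

/-! ## The system `RCA₀^ω` -/

/-- Quantifier-free induction for `A(n)`, where `n` is the variable `0`:
`A(0) ∧ ∀ n (A(n) → A(n + 1)) → ∀ n A(n)`. -/
def inductionAx {Γ : List Ty} (A : Fm (nat :: Γ)) : Fm Γ :=
  A.inst .zero ∧ₒ
    (.all nat (A →ₒ A.subst (Sub.cons (.succ ⬝ₜ .var .zero) Sub.wk))) →ₒ
  .all nat A

/-- Choice `QF-AC^{1,0}` for `A(f, n)`, where `n` is the variable `0` and `f` the variable `1`: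
`∀ f^1 ∃ n^0 A(f, n) → ∃ Φ^2 ∀ f^1 A(f, Φ f)`. -/
def choiceAx {Γ : List Ty} (A : Fm (nat :: one :: Γ)) : Fm Γ :=
  (.all one (.ex nat A)) →ₒ
  .ex two (.all one (A.subst
    (Sub.cons (.var (.succ .zero) ⬝ₜ .var .zero)
      (Sub.cons (.var .zero) (fun _ v => .var v.succ.succ)))))

/-- Kohlenbach's base theory `RCA₀^ω`, that is `E-PRA^ω + QF-AC^{1,0}`. -/
inductive RCA₀ω : Set Sentence
  | eq_refl : RCA₀ω (forallₒ nat fun x => x =ₒ x)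
  | eq_eucl : RCA₀ω (forallₒ nat fun x => forallₒ nat fun y => forallₒ nat fun z =>
      x.wk.wk =ₒ y.wk →ₒ x.wk.wk =ₒ z →ₒ y.wk =ₒ z)
  | ext (σ τ : Ty) : RCA₀ω (forallₒ (σ ⇒ₜ τ) fun f => forallₒ σ fun x => forallₒ σ fun y =>
      eqAt σ x.wk y →ₒ eqAt τ (f.wk.wk ⬝ₜ x.wk) (f.wk.wk ⬝ₜ y))
  | succ_ne_zero : RCA₀ω (forallₒ nat fun x => ¬ₒ(.succ ⬝ₜ x =ₒ .zero))
  | succ_inj : RCA₀ω (forallₒ nat fun x => forallₒ nat fun y =>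
      .succ ⬝ₜ x.wk =ₒ .succ ⬝ₜ y →ₒ x.wk =ₒ y)
  | K_eq (σ τ : Ty) : RCA₀ω (forallₒ σ fun x => forallₒ τ fun y =>
      eqAt σ (.K σ τ ⬝ₜ x.wk ⬝ₜ y) x.wk)
  | S_eq (ρ σ τ : Ty) : RCA₀ω (forallₒ (ρ ⇒ₜ σ ⇒ₜ τ) fun f => forallₒ (ρ ⇒ₜ σ) fun g =>
      forallₒ ρ fun x =>
        eqAt τ (.S ρ σ τ ⬝ₜ f.wk.wk ⬝ₜ g.wk ⬝ₜ x) (f.wk.wk ⬝ₜ x ⬝ₜ (g.wk ⬝ₜ x)))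
  | R_zero : RCA₀ω (forallₒ nat fun y => forallₒ (nat ⇒ₜ nat ⇒ₜ nat) fun z =>
      .R ⬝ₜ .zero ⬝ₜ y.wk ⬝ₜ z =ₒ y.wk)
  | R_succ : RCA₀ω (forallₒ nat fun n => forallₒ nat fun y => forallₒ (nat ⇒ₜ nat ⇒ₜ nat) fun z =>
      .R ⬝ₜ (.succ ⬝ₜ n.wk.wk) ⬝ₜ y.wk ⬝ₜ z =ₒ z ⬝ₜ (.R ⬝ₜ n.wk.wk ⬝ₜ y.wk ⬝ₜ z) ⬝ₜ n.wk.wk)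
  | induction {Γ : List Ty} (A : Fm (nat :: Γ)) : A.IsQF → RCA₀ω (inductionAx A).closure
  | choice {Γ : List Ty} (A : Fm (nat :: one :: Γ)) : A.IsQF → RCA₀ω (choiceAx A).closure

/-! ## Lambda abstraction and primitive recursive functions -/

/-- Lambda abstraction of the variable `0`, through the combinators. -/
def lam {Γ : List Ty} {σ : Ty} : {τ : Ty} → Tm (σ :: Γ) τ → Tm Γ (σ ⇒ₜ τ)
  | _, .var .zero => .S σ (σ ⇒ₜ σ) σ ⬝ₜ .K σ (σ ⇒ₜ σ) ⬝ₜ .K σ σ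
  | τ, .var (.succ v) => .K τ σ ⬝ₜ .var v
  | _, .zero => .K _ σ ⬝ₜ .zero
  | _, .succ => .K _ σ ⬝ₜ .succ
  | _, .K ρ τ => .K _ σ ⬝ₜ .K ρ τ
  | _, .S ρ τ υ => .K _ σ ⬝ₜ .S ρ τ υ
  | _, .R => .K _ σ ⬝ₜ .R
  | _, .app f a => .S _ _ _ ⬝ₜ lam f ⬝ₜ lam a

/-- `lamₒ σ fun x => t x` is the term `λ x^σ. t x`. -/
def lamₒ {Γ : List Ty} (σ : Ty) {τ : Ty} (t : Tm (σ :: Γ) σ → Tm (σ :: Γ) τ) : Tm Γ (σ ⇒ₜ τ) :=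
  lam (t (.var .zero))

section Numbers
variable {Γ : List Ty}

/-- The successor of a number. -/
def suc (s : Tm Γ nat) : Tm Γ nat := .succ ⬝ₜ s

/-- The number `1`. -/
def num1 : Tm Γ nat := suc .zero

/-- The number `2`. -/
def num2 : Tm Γ nat := suc num1

/-- Primitive recursion: `u(0) = y`, `u(i + 1) = z (u(i)) i`; the value is `u(n)`. -/
def recₒ (n y : Tm Γ nat) (z : Tm Γ (nat ⇒ₜ nat ⇒ₜ nat)) : Tm Γ nat := .R ⬝ₜ n ⬝ₜ y ⬝ₜ z

/-- Predecessor, with `0` at `0`. -/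
def pred (s : Tm Γ nat) : Tm Γ nat := recₒ s .zero (lamₒ nat fun _ => lamₒ nat fun i => i)

/-- Addition. -/
def add (s t : Tm Γ nat) : Tm Γ nat := recₒ t s (lamₒ nat fun u => lamₒ nat fun _ => suc u.wk)

/-- Multiplication. -/
def mul (s t : Tm Γ nat) : Tm Γ nat :=
  recₒ t .zero (lamₒ nat fun u => lamₒ nat fun _ => add u.wk s.wk.wk)

/-- Truncated subtraction. -/
def monus (s t : Tm Γ nat) : Tm Γ nat := recₒ t s (lamₒ nat fun u => lamₒ nat fun _ => pred u.wk)

/-- Powers of `2`. -/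
def pow2 (s : Tm Γ nat) : Tm Γ nat :=
  recₒ s num1 (lamₒ nat fun u => lamₒ nat fun _ => add u.wk u.wk)

/-- `s ≤ t` for numbers. -/
def le (s t : Tm Γ nat) : Fm Γ := monus s t =ₒ .zero

/-- `s < t` for numbers. -/
def lt (s t : Tm Γ nat) : Fm Γ := le (suc s) t

/-- Triangular numbers `0 + 1 + … + s`. -/
def tri (s : Tm Γ nat) : Tm Γ nat :=
  recₒ s .zero (lamₒ nat fun u => lamₒ nat fun i => add u.wk (suc i))

/-- Cantor's pairing of numbers. -/
def pair (s t : Tm Γ nat) : Tm Γ nat := add (tri (add s t)) t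

/-- The largest `w` with `tri w ≤ s`: it grows by `1` (that is `1 ∸ (tri (w + 1) ∸ (i + 1))`) at
the step from `i` to `i + 1` exactly if `tri (w + 1) ≤ i + 1`. -/
def diag (s : Tm Γ nat) : Tm Γ nat :=
  recₒ s .zero (lamₒ nat fun w => lamₒ nat fun i =>
    add w.wk (monus num1 (monus (tri (suc w.wk)) (suc i))))

/-- Second component of a coded pair. -/
def snd (s : Tm Γ nat) : Tm Γ nat := monus s (tri (diag s))

/-- First component of a coded pair. -/
def fst (s : Tm Γ nat) : Tm Γ nat := monus (diag s) (snd s)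

end Numbers

/-! ## Weak König's lemma

The number `0` codes the empty binary sequence, and if `n` codes `σ`, then `2n + 1` and `2n + 2`
code the extensions of `σ` by the digits `0` and `1`. Every number codes exactly one sequence; `n`
codes a sequence of length `k` if and only if `2^k ≤ n + 1 < 2^(k+1)`. -/

section Trees
variable {Γ : List Ty}

/-- The code of the extension of the sequence with code `s` by the digit `d`. -/
def snoc (s d : Tm Γ nat) : Tm Γ nat := suc (add (add s s) d)

/-- The code of `⟨b(0), …, b(k - 1)⟩`. -/
def initSeg (b : Tm Γ one) (k : Tm Γ nat) : Tm Γ nat :=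
  recₒ k .zero (lamₒ nat fun u => lamₒ nat fun i => snoc u.wk (b.wk.wk ⬝ₜ i))

/-- `s` codes a binary sequence of length `k`. -/
def hasLength (s k : Tm Γ nat) : Fm Γ := le (pow2 k) (suc s) ∧ₒ lt (suc s) (pow2 (suc k))

/-- `b` takes only the values `0` and `1`. -/
def isBinary (b : Tm Γ one) : Fm Γ := forallₒ nat fun i => le (b.wk ⬝ₜ i) num1

/-- The set `{σ : t(σ) = 0}` of binary sequences is a tree, i.e. closed under initial segments. -/
def isTree (t : Tm Γ one) : Fm Γ := forallₒ nat fun s =>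
  ((t.wk ⬝ₜ snoc s .zero =ₒ .zero) ∨ₒ (t.wk ⬝ₜ snoc s num1 =ₒ .zero)) →ₒ t.wk ⬝ₜ s =ₒ .zero

/-- Weak König's lemma: a binary tree with sequences of every length has an infinite path. -/
def WKL : Sentence := forallₒ one fun t =>
  isTree t →ₒ
  (forallₒ nat fun k => existsₒ nat fun s => hasLength s k.wk ∧ₒ t.wk.wk ⬝ₜ s =ₒ .zero) →ₒ
  existsₒ one fun b => isBinary b ∧ₒ
    forallₒ nat fun k => t.wk.wk ⬝ₜ initSeg b.wk k =ₒ .zero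

end Trees

/-! ## Rational numbers -/

/-- An expression for the rational number `(pos - neg) / den`. -/
structure RatTm (Γ : List Ty) : Type where
  pos : Tm Γ nat
  neg : Tm Γ nat
  den : Tm Γ nat

section Rationals
variable {Γ : List Ty}

/-- The rational number with code `c`. Every number codes a rational number, namely
`⟨⟨p, m⟩, d⟩` codes `(p - m) / (d + 1)`. -/
def dec (c : Tm Γ nat) : RatTm Γ := ⟨fst (fst c), snd (fst c), suc (snd c)⟩

/-- A code of a rational number. -/
def enc (q : RatTm Γ) : Tm Γ nat := pair (pair q.pos q.neg) (pred q.den)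

def RatTm.ofNat (s : Tm Γ nat) : RatTm Γ := ⟨s, .zero, num1⟩

def RatTm.add (q r : RatTm Γ) : RatTm Γ :=
  ⟨HOArith.add (mul q.pos r.den) (mul r.pos q.den),
   HOArith.add (mul q.neg r.den) (mul r.neg q.den), mul q.den r.den⟩

def RatTm.opp (q : RatTm Γ) : RatTm Γ := ⟨q.neg, q.pos, q.den⟩

def RatTm.sub (q r : RatTm Γ) : RatTm Γ := q.add r.opp

/-- `q < r`. -/
def RatTm.lt (q r : RatTm Γ) : Fm Γ :=
  HOArith.lt (HOArith.add (mul q.pos r.den) (mul r.neg q.den))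
    (HOArith.add (mul r.pos q.den) (mul q.neg r.den))

/-- `q ≤ r`. -/
def RatTm.le (q r : RatTm Γ) : Fm Γ :=
  HOArith.le (HOArith.add (mul q.pos r.den) (mul r.neg q.den))
    (HOArith.add (mul r.pos q.den) (mul q.neg r.den))

/-- `2^(-n)`. -/
def RatTm.halfPow (n : Tm Γ nat) : RatTm Γ := ⟨num1, .zero, pow2 n⟩

/-- `2^(-n+1)`. -/
def RatTm.twoHalfPow (n : Tm Γ nat) : RatTm Γ := ⟨num2, .zero, pow2 n⟩

/-- The code of `∑_{i < n} (b_i - a_i)` for sequences `a`, `b` of codes of rational numbers. -/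
def sumDiff (a b : Tm Γ one) (n : Tm Γ nat) : Tm Γ nat :=
  recₒ n (enc (.ofNat .zero)) (lamₒ nat fun u => lamₒ nat fun i =>
    enc ((dec u.wk).add ((dec (b.wk.wk ⬝ₜ i)).sub (dec (a.wk.wk ⬝ₜ i)))))

/-- The code of `∑_{i < n} a_i` for a sequence `a` of codes of rational numbers. -/
def sumRat (a : Tm Γ one) (n : Tm Γ nat) : Tm Γ nat :=
  recₒ n (enc (.ofNat .zero)) (lamₒ nat fun u => lamₒ nat fun i =>
    enc ((dec u.wk).add (dec (a.wk.wk ⬝ₜ i))))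

end Rationals

/-! ## Real numbers: fast-converging sequences of (codes of) rational numbers -/

section Reals
variable {Γ : List Ty}

/-- The `n`-th approximation of `x`. -/
def approx (x : Tm Γ one) (n : Tm Γ nat) : RatTm Γ := dec (x ⬝ₜ n)

/-- `x ∈ ℝ`: for all `n` and `i`, `|x_n - x_{n+i}| < 2^(-n)`. -/
def isReal (x : Tm Γ one) : Fm Γ := forallₒ nat fun n => forallₒ nat fun i =>
  ((approx x.wk.wk n.wk).sub (approx x.wk.wk (add n.wk i))).lt (.halfPow n.wk) ∧ₒ
  ((approx x.wk.wk (add n.wk i)).sub (approx x.wk.wk n.wk)).lt (.halfPow n.wk)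

/-- Equality of reals: for all `n`, `|x_n - y_n| ≤ 2^(-n+1)`. -/
def realEq (x y : Tm Γ one) : Fm Γ := forallₒ nat fun n =>
  ((approx x.wk n).sub (approx y.wk n)).le (.twoHalfPow n) ∧ₒ
  ((approx y.wk n).sub (approx x.wk n)).le (.twoHalfPow n)

/-- `x < y` for reals: there is `n` with `y_n - x_n > 2^(-n+1)`. -/
def realLt (x y : Tm Γ one) : Fm Γ := existsₒ nat fun n =>
  (RatTm.twoHalfPow n).lt ((approx y.wk n).sub (approx x.wk n))

/-- `x ≤ y` for reals. -/
def realLe (x y : Tm Γ one) : Fm Γ := ¬ₒ(realLt y x)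

/-- A rational number as a real number. -/
def ofRat (q : RatTm Γ) : Tm Γ one := .K nat nat ⬝ₜ enc q

/-- Addition of reals: `(x + y)_n = x_{n+1} + y_{n+1}`. -/
def realAdd (x y : Tm Γ one) : Tm Γ one := lamₒ nat fun n =>
  enc ((approx x.wk (suc n)).add (approx y.wk (suc n)))

/-- Subtraction of reals: `(x - y)_n = x_{n+1} - y_{n+1}`. -/
def realSub (x y : Tm Γ one) : Tm Γ one := lamₒ nat fun n =>
  enc ((approx x.wk (suc n)).sub (approx y.wk (suc n)))

def real0 : Tm Γ one := ofRat (.ofNat .zero)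

def real1 : Tm Γ one := ofRat (.ofNat num1)

/-- `x` is a real number in the unit interval `[0,1]`. -/
def inUnit (x : Tm Γ one) : Fm Γ := isReal x ∧ₒ realLe real0 x ∧ₒ realLe x real1

/-- `|x - y| < r` for reals. -/
def distLt (x y r : Tm Γ one) : Fm Γ := realLt (realSub x y) r ∧ₒ realLt (realSub y x) r

/-- The real `x` lies in the basic open interval `(a_n, b_n)`, where `a` and `b` are sequences of
codes of rational numbers. -/
def inBasic (a b : Tm Γ one) (n : Tm Γ nat) (x : Tm Γ one) : Fm Γ :=
  realLt (ofRat (dec (a ⬝ₜ n))) x ∧ₒ realLt x (ofRat (dec (b ⬝ₜ n)))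

/-- `x ∈ ⋃_n (a_n, b_n)`. -/
def inOpen (a b x : Tm Γ one) : Fm Γ := existsₒ nat fun n => inBasic a.wk b.wk n x.wk

/-- `x` belongs to the RM-closed set with code `a`, `b`, the complement of `⋃_n (a_n, b_n)`. -/
def inClosed (a b x : Tm Γ one) : Fm Γ := isReal x ∧ₒ ¬ₒ(inOpen a b x)

/-- The RM-closed set with code `a`, `b` has measure zero: for every real `ε > 0` it is covered by
a sequence of basic open intervals `(c_n, d_n)` of total length below `ε`. -/
def closedNull (a b : Tm Γ one) : Fm Γ := forallₒ one fun ε =>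
  isReal ε →ₒ realLt real0 ε →ₒ
  existsₒ one fun c => existsₒ one fun d =>
    (forallₒ nat fun n => (dec (c.wk.wk ⬝ₜ n)).lt (dec (d.wk ⬝ₜ n))) ∧ₒ
    (forallₒ one fun x =>
      inClosed a.wk.wk.wk.wk b.wk.wk.wk.wk x →ₒ inOpen c.wk.wk d.wk x) ∧ₒ
    (forallₒ nat fun n => realLt (ofRat (dec (sumDiff c.wk.wk d.wk n))) ε.wk.wk.wk)

/-! ## The covering principle -/

/-- `Ψ : [0,1] → ℝ⁺`: on real numbers in `[0,1]`, the values of `Ψ` are positive real numbers, and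
`Ψ` maps equal reals to equal reals. -/
def isPosFun (Ψ : Tm Γ (one ⇒ₜ one)) : Fm Γ :=
  (forallₒ one fun x => inUnit x →ₒ isReal (Ψ.wk ⬝ₜ x) ∧ₒ realLt real0 (Ψ.wk ⬝ₜ x)) ∧ₒ
  (forallₒ one fun x => forallₒ one fun y =>
    inUnit x.wk →ₒ inUnit y →ₒ realEq x.wk y →ₒ realEq (Ψ.wk.wk ⬝ₜ x.wk) (Ψ.wk.wk ⬝ₜ y))

/-- `Ψ : [0,1] → ℝ` is continuous at `x`. -/
def contAt (Ψ : Tm Γ (one ⇒ₜ one)) (x : Tm Γ one) : Fm Γ :=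
  forallₒ nat fun k => existsₒ nat fun m => forallₒ one fun y =>
    inUnit y →ₒ distLt x.wk.wk.wk y (ofRat (.halfPow m.wk)) →ₒ
      distLt (Ψ.wk.wk.wk ⬝ₜ x.wk.wk.wk) (Ψ.wk.wk.wk ⬝ₜ y) (ofRat (.halfPow k.wk.wk))

/-- `Ψ : [0,1] → ℝ` is continuous almost everywhere: it is continuous outside of an RM-closed set
`E ⊆ [0,1]` of measure zero. -/
def contAE (Ψ : Tm Γ (one ⇒ₜ one)) : Fm Γ :=
  existsₒ one fun a => existsₒ one fun b =>
    (forallₒ one fun x => inClosed a.wk.wk b.wk x →ₒ inUnit x) ∧ₒ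
    closedNull a.wk b ∧ₒ
    (forallₒ one fun x =>
      inUnit x →ₒ ¬ₒ(inClosed a.wk.wk b.wk x) →ₒ contAt Ψ.wk.wk.wk x)

/-- `x ∈ I_y^Ψ`, the open interval `(y - Ψ(y), y + Ψ(y))`. -/
def inI (Ψ : Tm Γ (one ⇒ₜ one)) (y x : Tm Γ one) : Fm Γ :=
  realLt (realSub y (Ψ ⬝ₜ y)) x ∧ₒ realLt x (realAdd y (Ψ ⬝ₜ y))

/-- `x ∈ J_{y_i}^Ψ`, the set `I_{y_i}^Ψ` without the `I_{y_j}^Ψ` for `j < i`. -/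
def inJ (Ψ : Tm Γ (one ⇒ₜ one)) (y : Tm Γ (nat ⇒ₜ one)) (i : Tm Γ nat) (x : Tm Γ one) : Fm Γ :=
  inI Ψ (y ⬝ₜ i) x ∧ₒ
  forallₒ nat fun j => lt j i.wk →ₒ ¬ₒ(inI Ψ.wk (y.wk ⬝ₜ j) x.wk)

/-- `q < |J_{y_i}^Ψ|` for a rational number with code `q`: there are finitely many pairwise disjoint
intervals with rational end points `c_0 < d_0, …, c_{n-1} < d_{n-1}` that are contained in
`J_{y_i}^Ψ` and have total length greater than `q`. -/
def ltLengthJ (Ψ : Tm Γ (one ⇒ₜ one)) (y : Tm Γ (nat ⇒ₜ one)) (i q : Tm Γ nat) : Fm Γ :=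
  existsₒ nat fun n => existsₒ one fun c => existsₒ one fun d =>
    (forallₒ nat fun m => lt m n.wk.wk.wk →ₒ
      (dec (c.wk.wk ⬝ₜ m)).lt (dec (d.wk ⬝ₜ m)) ∧ₒ
      (forallₒ nat fun l => lt l m.wk →ₒ
        (dec (d.wk.wk ⬝ₜ l)).le (dec (c.wk.wk.wk ⬝ₜ m.wk)) ∨ₒ
        (dec (d.wk.wk ⬝ₜ m.wk)).le (dec (c.wk.wk.wk ⬝ₜ l))) ∧ₒ
      (forallₒ one fun x => isReal x →ₒ inBasic c.wk.wk.wk d.wk.wk m.wk x →ₒ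
        inJ Ψ.wk.wk.wk.wk.wk y.wk.wk.wk.wk.wk i.wk.wk.wk.wk.wk x)) ∧ₒ
    (dec q.wk.wk.wk).lt (dec (sumDiff c.wk d n.wk.wk))

/-- `r < ∑_{i ≤ k} |J_{y_i}^Ψ|` for a real number `r`: there are rational numbers `q_i < |J_{y_i}^Ψ|`
with `r < ∑_{i ≤ k} q_i`. -/
def ltSumLengthJ (Ψ : Tm Γ (one ⇒ₜ one)) (y : Tm Γ (nat ⇒ₜ one)) (k : Tm Γ nat) (r : Tm Γ one) :
    Fm Γ :=
  existsₒ one fun q =>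
    (forallₒ nat fun i => le i k.wk.wk →ₒ ltLengthJ Ψ.wk.wk y.wk.wk i (q.wk ⬝ₜ i)) ∧ₒ
    realLt r.wk (ofRat (dec (sumRat q (suc k.wk))))

end Reals

/-- `WHBU_ae`: for every `Ψ : [0,1] → ℝ⁺` that is continuous almost everywhere and every real
`ε > 0`, there are pairwise distinct `y_0, …, y_k ∈ [0,1]` with `1 - ε < ∑_{i ≤ k} |J_{y_i}^Ψ|`. -/
def WHBUae : Sentence :=
  forallₒ (one ⇒ₜ one) fun Ψ => isPosFun Ψ →ₒ contAE Ψ →ₒ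
  forallₒ one fun ε => isReal ε →ₒ realLt real0 ε →ₒ
  existsₒ nat fun k => existsₒ (nat ⇒ₜ one) fun y =>
    (forallₒ nat fun i => le i k.wk.wk →ₒ inUnit (y.wk ⬝ₜ i)) ∧ₒ
    (forallₒ nat fun i => le i k.wk.wk →ₒ forallₒ nat fun j => lt j i.wk →ₒ
      ¬ₒ(realEq (y.wk.wk ⬝ₜ i.wk) (y.wk.wk ⬝ₜ j))) ∧ₒ
    ltSumLengthJ Ψ.wk.wk.wk y k.wk (realSub real1 ε.wk.wk)

end HOArith

/-!
The proof is semantic. By the completeness theorem for the many-sorted calculus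
(`proves_of_forall_models`), it suffices to verify the covering principle in every structure that
satisfies `RCA₀^ω` and weak König's lemma; dividing by extensional equality, in every `Model`. Such
a model may be nonstandard, so every induction has to be an instance of quantifier-free induction,
and every finite sum has to be an object of the model. This is controlled by the notions of
definable function (`Rep`, `RepQ`) and decidable predicate (`DecP`): they are closed under primitive
recursion and bounded quantification, and satisfy induction (`DecP.induct`). The numbers of a model
form an ordered semiring `M.N`, the rational numbers it codes form the ordered field `M.Q`.

In a model, let `Ψ` be continuous almost everywhere, let `ε > 0`, and cover the exceptional set by
intervals `(c_n, d_n)` of small total length. Call a dyadic cell of level `q` good if it lies well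
inside the interval `I_y` of its left end point `y`, as seen from the `q`-th approximation of `Ψ y`,
or inside `(c_n, d_n)` for some `n < q`. This is a decidable property. By weak König's lemma, there
is a level `p` all of whose cells lie in good cells of level at most `p` (`exists_good_level`):
otherwise some point `x` of the unit interval lies in a sequence of shrinking cells that are not
good; but if `x` lies in some `(c_n, d_n)`, small cells around `x` are good by the second clause,
and if `Ψ` is continuous at `x`, they are good by the first one, since `Ψ` is bounded below near
`x`.

The points `y_i` are the dyadic points of level `p`. It remains to estimate the measure of the
sets `J_{y_i}` inside the model. Let `h` be the length of the cells of a much finer level. For each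
`i`, all but at most eight of these cells are clearly inside or clearly outside of `I_{y_i}`
(`count_cellBdry_le`). So the cells that are near some `I_{y_i}` number at most the sum over `i` of
eight plus the number of cells in `J_{y_i}` (`count_cellMeets_le`). Every other cell lies in some
`(c_n, d_n)` (`meets_or_covered`), and these are few (`count_cellCovered_le`). As the number of
points `y_i` does not depend on `h`, the total length of the cells inside the sets `J_{y_i}` is
greater than `1 - ε`.
-/

namespace HOArith
open Ty (nat one)

/-! ### Substitution and weakening -/

theorem Tm.subst_subst {Γ Δ Θ : List Ty} (s : Sub Γ Δ) (r : Sub Δ Θ) {τ : Ty} (t : Tm Γ τ) :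
    (t.subst s).subst r = t.subst fun τ v => (s τ v).subst r := by
  induction t <;> simp_all [Tm.subst]

theorem Tm.subst_var {Γ : List Ty} {τ : Ty} (t : Tm Γ τ) :
    t.subst (fun _ v => .var v) = t := by
  induction t <;> simp_all [Tm.subst]

theorem Sub.lift_comp {Γ Δ Θ : List Ty} {σ : Ty} (s : Sub Γ Δ) (r : Sub Δ Θ) :
    (fun τ v => ((s.lift (σ := σ)) τ v).subst (r.lift (σ := σ))) =
      Sub.lift (σ := σ) (fun τ v => (s τ v).subst r) := by
  funext τ v
  cases v with
  | zero => rfl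
  | succ v =>
    simp only [Sub.lift, Sub.cons, Tm.wk, Tm.subst_subst]
    rfl

theorem Sub.lift_var {Γ : List Ty} {σ : Ty} :
    Sub.lift (σ := σ) (fun _ v => .var v : Sub Γ Γ) = fun _ v => .var v := by
  funext τ v
  cases v <;> rfl

theorem Fm.subst_subst {Γ Δ Θ : List Ty} (s : Sub Γ Δ) (r : Sub Δ Θ) (φ : Fm Γ) :
    (φ.subst s).subst r = φ.subst fun τ v => (s τ v).subst r := by
  induction φ generalizing Δ Θ with
  | eq a b => simp [Fm.subst, Tm.subst_subst]
  | bot => rfl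
  | imp φ ψ ih₁ ih₂ => simp [Fm.subst, ih₁, ih₂]
  | all σ φ ih => simp only [Fm.subst, ih, Sub.lift_comp]

theorem Fm.subst_var {Γ : List Ty} (φ : Fm Γ) : φ.subst (fun _ v => .var v) = φ := by
  induction φ with
  | eq a b => simp [Fm.subst, Tm.subst_var]
  | bot => rfl
  | imp φ ψ ih₁ ih₂ => simp [Fm.subst, ih₁, ih₂]
  | all σ φ ih => simp only [Fm.subst, Sub.lift_var, ih]

theorem Fm.wk_subst_lift {Γ Δ : List Ty} {σ : Ty} (s : Sub Γ Δ) (φ : Fm Γ) :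
    (φ.wk (σ := σ)).subst s.lift = (φ.subst s).wk := by
  simp only [Fm.wk, Fm.subst_subst]
  rfl

theorem Fm.subst_lift_subst_cons {Γ Δ Θ : List Ty} {σ : Ty} (φ : Fm (σ :: Γ)) (s : Sub Γ Δ)
    (r : Sub Δ Θ) (t : Tm Θ σ) :
    (φ.subst s.lift).subst (Sub.cons t r) =
      φ.subst (Sub.cons t fun τ v => (s τ v).subst r) := by
  rw [Fm.subst_subst]
  congr 1
  funext τ v
  cases v with
  | zero => rfl
  | succ v =>
    simp only [Sub.lift, Sub.cons, Tm.wk, Tm.subst_subst]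
    rfl

theorem Fm.inst_subst {Γ Δ : List Ty} {σ : Ty} (φ : Fm (σ :: Γ)) (t : Tm Γ σ) (s : Sub Γ Δ) :
    (φ.inst t).subst s = (φ.subst s.lift).inst (t.subst s) := by
  rw [Fm.inst, Fm.inst, Fm.subst_lift_subst_cons, Fm.subst_subst]
  congr 1
  funext τ v
  cases v with
  | zero => rfl
  | succ v => simp only [Sub.cons, Tm.subst_var]; rfl

theorem Fm.inCtx_subst {Γ Δ : List Ty} (φ : Sentence) (s : Sub Γ Δ) :
    (φ.inCtx Γ).subst s = φ.inCtx Δ := by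
  rw [Fm.inCtx, Fm.inCtx, Fm.subst_subst]
  congr 1
  funext τ v
  nomatch v

/-! ### Admissible rules -/

theorem Derives.mono {T : Set Sentence} {Γ : List Ty} {Δ Δ' : List (Fm Γ)} {φ : Fm Γ}
    (h : Derives T Δ φ) (hs : Δ ⊆ Δ') : Derives T Δ' φ := by
  induction h with
  | ax h => exact .ax h
  | hyp h => exact .hyp (hs h)
  | impI _ ih => exact .impI (ih (List.cons_subset_cons _ hs))
  | impE _ _ ih₁ ih₂ => exact .impE (ih₁ hs) (ih₂ hs)
  | raa _ ih => exact .raa (ih (List.cons_subset_cons _ hs))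
  | allI _ ih => exact .allI (ih (List.map_subset _ hs))
  | allE t _ ih => exact .allE t (ih hs)

theorem Derives.subst {T : Set Sentence} {Γ : List Ty} {Δ : List (Fm Γ)} {φ : Fm Γ}
    (h : Derives T Δ φ) {Θ : List Ty} (s : Sub Γ Θ) :
    Derives T (Δ.map (Fm.subst s)) (φ.subst s) := by
  induction h generalizing Θ with
  | ax h => rw [Fm.inCtx_subst]; exact .ax h
  | hyp h => exact .hyp (List.mem_map_of_mem h)
  | impI _ ih => exact .impI (ih s)
  | impE _ _ ih₁ ih₂ => exact .impE (ih₁ s) (ih₂ s)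
  | raa _ ih => exact .raa (ih s)
  | @allI Γ Δ σ φ _ ih =>
    refine .allI ?_
    have := ih (s.lift (σ := σ))
    simpa only [List.map_map, Function.comp_def, Fm.wk_subst_lift] using this
  | allE t _ ih => rw [Fm.inst_subst]; exact .allE _ (ih s)

theorem Derives.exFalso {T : Set Sentence} {Γ : List Ty} {Δ : List (Fm Γ)} {φ : Fm Γ}
    (h : Derives T Δ .bot) : Derives T Δ φ :=
  .raa (h.mono (List.subset_cons_self _ _))

theorem Derives.cut {T : Set Sentence} {Γ : List Ty} {Δ : List (Fm Γ)} {φ ψ : Fm Γ}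
    (h : Derives T (φ :: Δ) ψ) (h' : Derives T Δ φ) : Derives T Δ ψ := .impE (.impI h) h'

/-! ### Countability of the language -/

/-- A numerical code of a type. -/
def Ty.code : Ty → ℕ
  | .nat => 0
  | .arr σ τ => Nat.pair σ.code τ.code + 1

theorem Ty.code_injective : Function.Injective Ty.code := by
  intro σ
  induction σ with
  | nat => intro τ h; cases τ <;> simp_all [Ty.code]
  | arr σ₁ σ₂ ih₁ ih₂ =>
    intro τ h
    cases τ with
    | nat => simp [Ty.code] at h
    | arr τ₁ τ₂ =>
      simp only [Ty.code, Nat.add_right_cancel_iff, Nat.pair_eq_pair] at h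
      rw [ih₁ h.1, ih₂ h.2]

instance : Countable Ty := Ty.code_injective.countable

instance instCountableSigmaVar (Γ : List Ty) : Countable (Σ τ, Var Γ τ) := by
  induction Γ with
  | nil =>
    have : IsEmpty (Σ τ, Var [] τ) := ⟨fun v => nomatch v.2⟩
    infer_instance
  | cons σ Γ ih =>
    refine Set.countable_univ_iff.mp (Set.Countable.mono
      (s₂ := {⟨σ, .zero⟩} ∪
        Set.range fun v : Σ τ, Var Γ τ => (⟨v.1, v.2.succ⟩ : Σ τ, Var (σ :: Γ) τ))
      ?_ ((Set.countable_singleton _).union (Set.countable_range _)))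
    rintro ⟨τ, v⟩ -
    cases v with
    | zero => exact .inl rfl
    | succ v => exact .inr ⟨⟨_, v⟩, rfl⟩

/-- The terms built from variables and constants by at most `n` nested applications. -/
def Tm.upTo (Γ : List Ty) : ℕ → Set (Σ τ, Tm Γ τ)
  | 0 => (Set.range fun v : Σ τ, Var Γ τ => ⟨v.1, .var v.2⟩) ∪
      ({⟨_, .zero⟩, ⟨_, .succ⟩, ⟨_, .R⟩} ∪
      ((Set.range fun p : Ty × Ty => ⟨_, .K p.1 p.2⟩) ∪
      Set.range fun p : Ty × Ty × Ty => ⟨_, .S p.1 p.2.1 p.2.2⟩))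
  | n + 1 => Tm.upTo Γ n ∪ ⋃ p : Ty × Ty, Set.image2 (fun f a => ⟨p.2, .app f a⟩)
      (Sigma.mk (p.1 ⇒ₜ p.2) ⁻¹' Tm.upTo Γ n) (Sigma.mk p.1 ⁻¹' Tm.upTo Γ n)

theorem Tm.upTo_countable (Γ : List Ty) (n : ℕ) : (Tm.upTo Γ n).Countable := by
  induction n with
  | zero =>
    exact (Set.countable_range _).union ((by simp : Set.Countable _).union
      ((Set.countable_range _).union (Set.countable_range _)))
  | succ n ih =>
    exact ih.union (Set.countable_iUnion fun p =>
      (ih.preimage sigma_mk_injective).image2 (ih.preimage sigma_mk_injective) _)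

theorem Tm.upTo_mono (Γ : List Ty) : Monotone (Tm.upTo Γ) :=
  monotone_nat_of_le_succ fun _ => Set.subset_union_left

theorem Tm.exists_upTo {Γ : List Ty} {τ : Ty} (t : Tm Γ τ) : ∃ n, ⟨τ, t⟩ ∈ Tm.upTo Γ n := by
  induction t with
  | var v => exact ⟨0, .inl ⟨⟨_, v⟩, rfl⟩⟩
  | zero => exact ⟨0, .inr (.inl (by simp))⟩
  | succ => exact ⟨0, .inr (.inl (by simp))⟩
  | R => exact ⟨0, .inr (.inl (by simp))⟩
  | K σ τ => exact ⟨0, .inr (.inr (.inl ⟨(σ, τ), rfl⟩))⟩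
  | S ρ σ τ => exact ⟨0, .inr (.inr (.inr ⟨(ρ, σ, τ), rfl⟩))⟩
  | app f a ih₁ ih₂ =>
    obtain ⟨n, hn⟩ := ih₁
    obtain ⟨m, hm⟩ := ih₂
    exact ⟨max n m + 1, .inr (Set.mem_iUnion.2 ⟨(_, _), f, Tm.upTo_mono Γ (le_max_left _ _) hn, a,
      Tm.upTo_mono Γ (le_max_right _ _) hm, rfl⟩)⟩

instance instCountableTm (Γ : List Ty) (τ : Ty) : Countable (Tm Γ τ) := by
  have : Countable (Σ τ, Tm Γ τ) := Set.countable_univ_iff.mp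
    ((Set.countable_iUnion (Tm.upTo_countable Γ)).mono
      fun t _ => Set.mem_iUnion.2 (Tm.exists_upTo t.2))
  exact (sigma_mk_injective (i := τ)).countable

/-- The formulas built from equations and `⊥` by at most `n` nested connectives and quantifiers. -/
def Fm.upTo : ℕ → (Γ : List Ty) → Set (Fm Γ)
  | 0, Γ => {.bot} ∪ Set.range fun p : Tm Γ nat × Tm Γ nat => .eq p.1 p.2
  | n + 1, Γ => Fm.upTo n Γ ∪ (Set.image2 .imp (Fm.upTo n Γ) (Fm.upTo n Γ) ∪
      ⋃ σ, Fm.all σ '' Fm.upTo n (σ :: Γ))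

theorem Fm.upTo_countable (n : ℕ) (Γ : List Ty) : (Fm.upTo n Γ).Countable := by
  induction n generalizing Γ with
  | zero => exact (Set.countable_singleton _).union (Set.countable_range _)
  | succ n ih =>
    exact (ih Γ).union
      (((ih Γ).image2 (ih Γ) _).union (Set.countable_iUnion fun σ => (ih _).image _))

theorem Fm.upTo_mono (Γ : List Ty) : Monotone fun n => Fm.upTo n Γ :=
  monotone_nat_of_le_succ fun _ => Set.subset_union_left

theorem Fm.exists_upTo {Γ : List Ty} (φ : Fm Γ) : ∃ n, φ ∈ Fm.upTo n Γ := by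
  induction φ with
  | eq a b => exact ⟨0, .inr ⟨(a, b), rfl⟩⟩
  | bot => exact ⟨0, .inl rfl⟩
  | imp φ ψ ih₁ ih₂ =>
    obtain ⟨n, hn⟩ := ih₁
    obtain ⟨m, hm⟩ := ih₂
    exact ⟨max n m + 1, .inr (.inl ⟨φ, Fm.upTo_mono _ (le_max_left _ _) hn, ψ,
      Fm.upTo_mono _ (le_max_right _ _) hm, rfl⟩)⟩
  | all σ φ ih =>
    obtain ⟨n, hn⟩ := ih
    exact ⟨n + 1, .inr (.inr (Set.mem_iUnion.2 ⟨σ, φ, hn, rfl⟩))⟩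

instance instCountableFm (Γ : List Ty) : Countable (Fm Γ) :=
  Set.countable_univ_iff.mp ((Set.countable_iUnion fun n => Fm.upTo_countable n Γ).mono
    fun φ _ => Set.mem_iUnion.2 (Fm.exists_upTo φ))

/-! ### Structures and satisfaction -/

/-- A structure for the language of all finite types: arbitrary carriers, and an arbitrary relation
interpreting equality of numbers. -/
structure Str where
  D : Ty → Type
  app {σ τ : Ty} : D (σ ⇒ₜ τ) → D σ → D τ
  zero : D nat
  succ : D (nat ⇒ₜ nat)
  K (σ τ : Ty) : D (σ ⇒ₜ τ ⇒ₜ σ)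
  S (ρ σ τ : Ty) : D ((ρ ⇒ₜ σ ⇒ₜ τ) ⇒ₜ (ρ ⇒ₜ σ) ⇒ₜ ρ ⇒ₜ τ)
  R : D (nat ⇒ₜ nat ⇒ₜ (nat ⇒ₜ nat ⇒ₜ nat) ⇒ₜ nat)
  E : D nat → D nat → Prop

namespace Str
variable (M : Str)

/-- Assignments of values to the variables of a context. -/
abbrev Env (Γ : List Ty) : Type := ∀ τ : Ty, Var Γ τ → M.D τ

variable {M}

/-- The empty assignment. -/
def nil : M.Env [] := fun _ v => nomatch v

/-- Extend an assignment by a value for the variable `0`. -/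
def cons {Γ : List Ty} {σ : Ty} (x : M.D σ) (e : M.Env Γ) : M.Env (σ :: Γ)
  | _, .zero => x
  | _, .succ v => e _ v

/-- The value of a term. -/
def eval {Γ : List Ty} (e : M.Env Γ) : {τ : Ty} → Tm Γ τ → M.D τ
  | _, .var v => e _ v
  | _, .zero => M.zero
  | _, .succ => M.succ
  | _, .K σ τ => M.K σ τ
  | _, .S ρ σ τ => M.S ρ σ τ
  | _, .R => M.R
  | _, .app f a => M.app (eval e f) (eval e a)

/-- Satisfaction of a formula under an assignment. -/
def Sat : {Γ : List Ty} → Fm Γ → M.Env Γ → Prop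
  | _, .eq a b, e => M.E (eval e a) (eval e b)
  | _, .bot, _ => False
  | _, .imp φ ψ, e => Sat φ e → Sat ψ e
  | _, .all σ φ, e => ∀ x : M.D σ, Sat φ (cons x e)

theorem eval_subst {Γ Δ : List Ty} (s : Sub Γ Δ) (e : M.Env Δ) {τ : Ty} (t : Tm Γ τ) :
    eval e (t.subst s) = eval (fun τ v => eval e (s τ v)) t := by
  induction t <;> simp_all [Tm.subst, eval]

@[simp] theorem eval_wk {Γ : List Ty} {σ τ : Ty} (x : M.D σ) (e : M.Env Γ) (t : Tm Γ τ) :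
    eval (cons x e) (t.wk) = eval e t := by
  rw [Tm.wk, eval_subst]; rfl

theorem cons_eval {Γ Δ : List Ty} {σ : Ty} (t : Tm Δ σ) (s : Sub Γ Δ) (e : M.Env Δ) :
    (fun τ v => eval e (Sub.cons t s τ v)) = cons (eval e t) (fun τ v => eval e (s τ v)) := by
  funext τ v
  cases v <;> rfl

theorem sat_subst {Γ Δ : List Ty} (s : Sub Γ Δ) (e : M.Env Δ) (φ : Fm Γ) :
    Sat (φ.subst s) e ↔ Sat φ (fun τ v => eval e (s τ v)) := by
  induction φ generalizing Δ with
  | eq a b => simp only [Fm.subst, Sat, eval_subst]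
  | bot => rfl
  | imp φ ψ ih₁ ih₂ => simp only [Fm.subst, Sat, ih₁, ih₂]
  | all σ φ ih =>
    refine forall_congr' fun x => ?_
    rw [ih, Sub.lift, cons_eval]
    simp only [eval_wk]
    rfl

theorem env_nil (e e' : M.Env []) : e = e' := by
  funext τ v
  nomatch v

end Str

/-! ### The completeness theorem -/

/-- A closed term of every type. -/
def Tm.default {Γ : List Ty} : (τ : Ty) → Tm Γ τ
  | .nat => .zero
  | .arr σ τ => .K τ σ ⬝ₜ Tm.default τ

section Henkin
variable {T : Set Sentence} {Γ : List Ty} {Δ : List (Fm Γ)}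

/-- A new variable does not make assumptions inconsistent, because all types are inhabited. -/
theorem Derives.of_wk_bot {σ : Ty} (h : Derives T (Δ.map (Fm.wk (σ := σ))) .bot) :
    Derives T Δ .bot :=
  .allE (Tm.default σ) (.allI h)

theorem consistent_not {φ : Fm Γ} (h : ¬ Derives T Δ .bot) (h' : Derives T (φ :: Δ) .bot) :
    ¬ Derives T (¬ₒφ :: Δ) .bot :=
  fun h'' => h (h'.cut (.raa h''))

/-- One step of Henkin's construction: a consistent set of assumptions can be made to decide `ψ`,
with a new variable as a counterexample if `ψ` is a refuted universal formula. -/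
theorem exists_henkin_step (σ : Ty) (h : ¬ Derives T Δ .bot) (ψ : Fm Γ) :
    ∃ Δ' : List (Fm (σ :: Γ)), ¬ Derives T Δ' .bot ∧ Δ.map Fm.wk ⊆ Δ' ∧
      (ψ.wk ∈ Δ' ∨ Fm.wk (¬ₒψ) ∈ Δ' ∧ ∀ χ, ψ = .all σ χ → ¬ₒχ ∈ Δ') := by
  by_cases h' : Derives T (ψ :: Δ) .bot
  · have h₁ := consistent_not h h'
    by_cases hχ : ∃ χ, ψ = .all σ χ
    · obtain ⟨χ, rfl⟩ := hχ
      refine ⟨¬ₒχ :: (¬ₒ(.all σ χ) :: Δ).map Fm.wk, fun hd => ?_, ?_, .inr ⟨by simp, ?_⟩⟩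
      · exact h₁ (.impE (.hyp (by simp [Fm.not])) (.allI (.raa hd)))
      · intro x hx
        exact List.mem_cons_of_mem _ (List.mem_cons_of_mem _ hx)
      · intro χ' e
        cases e
        simp
    · exact ⟨(¬ₒψ :: Δ).map Fm.wk, fun hd => h₁ hd.of_wk_bot, fun x hx =>
        List.mem_cons_of_mem _ hx, .inr ⟨by simp, fun χ e => (hχ ⟨χ, e⟩).elim⟩⟩
  · exact ⟨(ψ :: Δ).map Fm.wk, fun hd => h' hd.of_wk_bot, fun x hx => List.mem_cons_of_mem _ hx,
      .inl (by simp)⟩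

end Henkin

/-- The context of the first `n` Henkin variables, whose types are listed by `ty`. These variables
play the role of the constants of Henkin's construction. -/
def ctx (ty : ℕ → Ty) : ℕ → List Ty
  | 0 => []
  | n + 1 => ty n :: ctx ty n

/-- Weakening from the first `m` to the first `n` Henkin variables. -/
def up {ty : ℕ → Ty} {m n : ℕ} (h : m ≤ n) : Sub (ctx ty m) (ctx ty n) :=
  Nat.leRec (motive := fun n _ => Sub (ctx ty m) (ctx ty n)) (fun _ v => .var v)
    (fun _ _ s τ v => (s τ v).wk) h

section Chain
variable {ty : ℕ → Ty}

theorem up_self (m : ℕ) : up (ty := ty) (le_refl m) = fun _ v => .var v :=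
  Nat.leRec_self _ _

theorem up_succ {m n : ℕ} (h : m ≤ n) (h' : m ≤ n + 1) :
    up (ty := ty) h' = fun τ v => (up h τ v).wk :=
  Nat.leRec_succ (motive := fun n _ => Sub (ctx ty m) (ctx ty n)) _ _ h

theorem up_trans {m n k : ℕ} (h : m ≤ n) (h' : n ≤ k) :
    (fun τ v => (up (ty := ty) h τ v).subst (up h')) = up (h.trans h') := by
  induction k, h' using Nat.le_induction with
  | base => simp only [up_self, Tm.subst_var]
  | succ k h' ih =>
    rw [up_succ h', up_succ (h.trans h'), ← ih]
    simp only [Tm.wk, Tm.subst_subst]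
    rfl

theorem Tm.subst_up {m n k : ℕ} (h : m ≤ n) (h' : n ≤ k) {τ : Ty} (t : Tm (ctx ty m) τ) :
    (t.subst (up h)).subst (up h') = t.subst (up (h.trans h')) := by
  rw [Tm.subst_subst, up_trans]

theorem Fm.subst_up {m n k : ℕ} (h : m ≤ n) (h' : n ≤ k) (φ : Fm (ctx ty m)) :
    (φ.subst (up h)).subst (up h') = φ.subst (up (h.trans h')) := by
  rw [Fm.subst_subst, up_trans]

variable {T : Set Sentence}

/-- The requirement treated at stage `n` of Henkin's construction. -/
def IsStep (E : ∀ n, Fm (ctx ty n)) (n : ℕ) (Δ : List (Fm (ctx ty n)))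
    (Δ' : List (Fm (ctx ty (n + 1)))) : Prop :=
  Δ.map Fm.wk ⊆ Δ' ∧ ((E n).wk ∈ Δ' ∨ Fm.wk (¬ₒ(E n)) ∈ Δ' ∧ ∀ χ, E n = .all (ty n) χ → ¬ₒχ ∈ Δ')

/-- Henkin's construction: a consistent sentence is the first of a chain of consistent finite sets
of assumptions, the `n`-th of them about the first `n` Henkin variables. -/
theorem exists_chain (E : ∀ n, Fm (ctx ty n)) (φ : Sentence) (h : ¬ Derives T [φ] .bot) :
    ∃ Δ : ∀ n, List (Fm (ctx ty n)), Δ 0 = [φ] ∧ (∀ n, ¬ Derives T (Δ n) .bot) ∧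
      ∀ n, IsStep E n (Δ n) (Δ (n + 1)) := by
  choose f hf₁ hf₂ using fun (n : ℕ) (Δ : {Δ : List (Fm (ctx ty n)) // ¬ Derives T Δ .bot}) =>
    exists_henkin_step (ty n) Δ.2 (E n)
  let c : ∀ n, {Δ : List (Fm (ctx ty n)) // ¬ Derives T Δ .bot} := fun n =>
    Nat.rec ⟨[φ], h⟩ (fun n Δ => ⟨f n Δ, hf₁ n Δ⟩) n
  exact ⟨fun n => (c n).1, rfl, fun n => (c n).2, fun n => hf₂ n (c n)⟩

/-- There are enumerations of types and of formulas such that every formula in the first `m` Henkin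
variables is treated at a stage where a variable of any prescribed type is new. -/
theorem exists_enumeration : ∃ (ty : ℕ → Ty) (E : ∀ n, Fm (ctx ty n)),
    ∀ (m : ℕ) (φ : Fm (ctx ty m)) (σ : Ty), ∃ (n : ℕ) (h : m ≤ n), ty n = σ ∧
      E n = φ.subst (up h) := by
  have : Nonempty Ty := ⟨nat⟩
  obtain ⟨f, hf⟩ := exists_surjective_nat Ty
  let ty : ℕ → Ty := fun n => f n.unpair.1
  have : Nonempty (Σ m, Fm (ctx ty m)) := ⟨⟨0, .bot⟩⟩
  obtain ⟨g, hg⟩ := exists_surjective_nat (Σ m, Fm (ctx ty m))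
  classical
  refine ⟨ty, fun n => if h : (g n.unpair.2.unpair.1).1 ≤ n then
    (g n.unpair.2.unpair.1).2.subst (up h) else .bot, fun m φ σ => ?_⟩
  obtain ⟨a, rfl⟩ := hf σ
  obtain ⟨b, hb⟩ := hg ⟨m, φ⟩
  have h : m ≤ Nat.pair a (Nat.pair b m) :=
    (Nat.right_le_pair b m).trans (Nat.right_le_pair a _)
  have key : ∀ x : Σ m, Fm (ctx ty m), x = ⟨m, φ⟩ → ∀ n (h : m ≤ n),
      (if h : x.1 ≤ n then x.2.subst (up h) else .bot) = φ.subst (up h) := by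
    rintro _ rfl n h
    exact dif_pos h
  exact ⟨Nat.pair a (Nat.pair b m), h, by simp [ty], key _ (by simpa using hb) _ h⟩

end Chain

section Generic
variable {T : Set Sentence} {ty : ℕ → Ty} {E : ∀ n, Fm (ctx ty n)} {Δ : ∀ n, List (Fm (ctx ty n))}

theorem Derives.up (hstep : ∀ n, IsStep E n (Δ n) (Δ (n + 1))) {m n : ℕ} (h : m ≤ n)
    {φ : Fm (ctx ty m)} (hd : Derives T (Δ m) φ) : Derives T (Δ n) (φ.subst (up h)) := by
  induction n, h using Nat.le_induction with
  | base => rwa [up_self, Fm.subst_var]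
  | succ n h ih =>
    have := (ih.subst (Sub.wk (σ := ty n))).mono (hstep n).1
    rw [Fm.subst_subst] at this
    rw [up_succ h]
    exact this

/-- The theory in Henkin variables generated by a chain of assumptions. -/
def Gen (T : Set Sentence) (Δ : ∀ n, List (Fm (ctx ty n))) (m : ℕ) (φ : Fm (ctx ty m)) : Prop :=
  ∃ (n : ℕ) (h : m ≤ n), Derives T (Δ n) (φ.subst (up h))

theorem Gen.of_derives {m : ℕ} {φ : Fm (ctx ty m)} (h : Derives T (Δ m) φ) : Gen T Δ m φ :=
  ⟨m, le_rfl, by rwa [up_self, Fm.subst_var]⟩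

theorem gen_up (hstep : ∀ n, IsStep E n (Δ n) (Δ (n + 1))) {m n : ℕ} (h : m ≤ n)
    {φ : Fm (ctx ty m)} : Gen T Δ n (φ.subst (up h)) ↔ Gen T Δ m φ := by
  constructor
  · rintro ⟨k, hk, hd⟩
    exact ⟨k, h.trans hk, by rwa [Fm.subst_up] at hd⟩
  · rintro ⟨k, hk, hd⟩
    refine ⟨max n k, le_max_left _ _, ?_⟩
    rw [Fm.subst_up]
    have := hd.up hstep (le_max_right n k)
    rwa [Fm.subst_up] at this

theorem Gen.mp (hstep : ∀ n, IsStep E n (Δ n) (Δ (n + 1))) {m : ℕ} {φ ψ : Fm (ctx ty m)}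
    (h₁ : Gen T Δ m (φ →ₒ ψ)) (h₂ : Gen T Δ m φ) : Gen T Δ m ψ := by
  obtain ⟨n, hn, h₁⟩ := h₁
  obtain ⟨k, hk, h₂⟩ := h₂
  have hm : m ≤ max n k := hn.trans (le_max_left _ _)
  refine ⟨max n k, hm, .impE (φ := φ.subst (HOArith.up hm)) ?_ ?_⟩
  · have := h₁.up hstep (le_max_left n k)
    rwa [Fm.subst_up] at this
  · have := h₂.up hstep (le_max_right n k)
    rwa [Fm.subst_up] at this

theorem not_gen_bot (hcon : ∀ n, ¬ Derives T (Δ n) .bot) (m : ℕ) : ¬ Gen T Δ m .bot :=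
  fun ⟨n, _, h⟩ => hcon n h

theorem gen_or_gen_not (hstep : ∀ n, IsStep E n (Δ n) (Δ (n + 1)))
    (hE : ∀ (m : ℕ) (φ : Fm (ctx ty m)) (σ : Ty), ∃ (n : ℕ) (h : m ≤ n), ty n = σ ∧
      E n = φ.subst (up h)) {m : ℕ} (φ : Fm (ctx ty m)) : Gen T Δ m φ ∨ Gen T Δ m (¬ₒφ) := by
  obtain ⟨n, h, -, hn⟩ := hE m φ nat
  have hwk (ψ : Fm (ctx ty m)) : (ψ.subst (up h)).wk = ψ.subst (up (h.trans n.le_succ)) := by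
    rw [Fm.wk, Fm.subst_subst, up_succ h]; rfl
  rcases (hstep n).2 with h' | ⟨h', -⟩
  · rw [hn, hwk] at h'
    exact .inl ⟨n + 1, _, .hyp h'⟩
  · rw [hn] at h'
    exact .inr ⟨n + 1, h.trans n.le_succ, .hyp (hwk (¬ₒφ) ▸ h')⟩

theorem gen_imp (hstep : ∀ n, IsStep E n (Δ n) (Δ (n + 1)))
    (hE : ∀ (m : ℕ) (φ : Fm (ctx ty m)) (σ : Ty), ∃ (n : ℕ) (h : m ≤ n), ty n = σ ∧
      E n = φ.subst (up h)) {m : ℕ} (φ ψ : Fm (ctx ty m)) :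
    Gen T Δ m (φ →ₒ ψ) ↔ (Gen T Δ m φ → Gen T Δ m ψ) := by
  refine ⟨fun h => h.mp hstep, fun h => ?_⟩
  rcases gen_or_gen_not (T := T) hstep hE φ with h' | ⟨n, hn, h'⟩
  · obtain ⟨n, hn, h'⟩ := h h'
    exact ⟨n, hn, .impI (h'.mono (List.subset_cons_self _ _))⟩
  · exact ⟨n, hn, .impI (Derives.exFalso (.impE (h'.mono (List.subset_cons_self _ _))
      (.hyp (by simp))))⟩

/-- Refuted universal formulas have counterexamples. -/
theorem gen_all (hstep : ∀ n, IsStep E n (Δ n) (Δ (n + 1))) (hcon : ∀ n, ¬ Derives T (Δ n) .bot)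
    (hE : ∀ (m : ℕ) (φ : Fm (ctx ty m)) (σ : Ty), ∃ (n : ℕ) (h : m ≤ n), ty n = σ ∧
      E n = φ.subst (up h)) {m : ℕ} {σ : Ty} (φ : Fm (σ :: ctx ty m)) :
    Gen T Δ m (.all σ φ) ↔
      ∀ (n : ℕ) (h : m ≤ n) (t : Tm (ctx ty n) σ), Gen T Δ n (φ.subst (Sub.cons t (up h))) := by
  constructor
  · intro hg n h t
    obtain ⟨k, hk, hd⟩ := (gen_up hstep h).2 hg
    refine ⟨k, hk, ?_⟩
    have := Derives.allE (t.subst (up hk)) hd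
    rw [← Fm.inst_subst, Fm.inst, Fm.subst_lift_subst_cons] at this
    simpa only [Tm.subst_var] using this
  · intro h
    by_contra hn
    obtain ⟨n, hmn, rfl, hE⟩ := hE m (.all σ φ) σ
    have hwk (ψ : Fm (ctx ty m)) : (ψ.subst (up hmn)).wk = ψ.subst (up (hmn.trans n.le_succ)) := by
      rw [Fm.wk, Fm.subst_subst, up_succ hmn]; rfl
    rcases (hstep n).2 with h' | ⟨-, h'⟩
    · rw [hE, hwk] at h'
      exact hn ⟨n + 1, _, .hyp h'⟩
    · have h₁ := h' _ hE
      have h₂ := h (n + 1) (hmn.trans n.le_succ) (.var .zero)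
      rw [up_succ hmn] at h₂
      exact not_gen_bot hcon (n + 1) (Gen.mp hstep (Gen.of_derives (.hyp h₁)) h₂)

/-- The structure of terms in Henkin variables. A term in the first `n` variables and its weakenings
are different elements. -/
def termStr (T : Set Sentence) (Δ : ∀ n, List (Fm (ctx ty n))) : Str where
  D τ := Σ n, Tm (ctx ty n) τ
  app f a := ⟨max f.1 a.1, f.2.subst (up (le_max_left _ _)) ⬝ₜ a.2.subst (up (le_max_right _ _))⟩
  zero := ⟨0, .zero⟩
  succ := ⟨0, .succ⟩
  K σ τ := ⟨0, .K σ τ⟩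
  S ρ σ τ := ⟨0, .S ρ σ τ⟩
  R := ⟨0, .R⟩
  E a b := Gen T Δ (max a.1 b.1)
    (a.2.subst (up (le_max_left _ _)) =ₒ b.2.subst (up (le_max_right _ _)))

/-- Terms denote their own instances, up to weakening. -/
theorem termStr_eval {Γ : List Ty} (e : (termStr T Δ).Env Γ) {n : ℕ} (h : ∀ τ v, (e τ v).1 ≤ n)
    {τ : Ty} (t : Tm Γ τ) : ∃ h' : (Str.eval e t).1 ≤ n,
      (Str.eval e t).2.subst (up h') = t.subst fun τ v => (e τ v).2.subst (up (h τ v)) := by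
  induction t with
  | var v => exact ⟨h _ v, rfl⟩
  | zero => exact ⟨n.zero_le, rfl⟩
  | succ => exact ⟨n.zero_le, rfl⟩
  | K => exact ⟨n.zero_le, rfl⟩
  | S => exact ⟨n.zero_le, rfl⟩
  | R => exact ⟨n.zero_le, rfl⟩
  | app f a ih₁ ih₂ =>
    obtain ⟨h₁, e₁⟩ := ih₁
    obtain ⟨h₂, e₂⟩ := ih₂
    refine ⟨max_le h₁ h₂, ?_⟩
    rw [Tm.subst, ← e₁, ← e₂]
    exact congrArg₂ Tm.app (Tm.subst_up _ _ _) (Tm.subst_up _ _ _)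

/-- Truth in the term structure is provability in the generated theory. -/
theorem termStr_sat (hstep : ∀ n, IsStep E n (Δ n) (Δ (n + 1)))
    (hcon : ∀ n, ¬ Derives T (Δ n) .bot)
    (hE : ∀ (m : ℕ) (φ : Fm (ctx ty m)) (σ : Ty), ∃ (n : ℕ) (h : m ≤ n), ty n = σ ∧
      E n = φ.subst (up h)) {Γ : List Ty} (φ : Fm Γ) (e : (termStr T Δ).Env Γ) {n : ℕ}
    (h : ∀ τ v, (e τ v).1 ≤ n) :
    Str.Sat φ e ↔ Gen T Δ n (φ.subst fun τ v => (e τ v).2.subst (up (h τ v))) := by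
  induction φ generalizing n with
  | eq a b =>
    obtain ⟨h₁, e₁⟩ := termStr_eval e h a
    obtain ⟨h₂, e₂⟩ := termStr_eval e h b
    rw [Fm.subst, ← e₁, ← e₂]
    refine (gen_up hstep (max_le h₁ h₂)).symm.trans (iff_of_eq (congrArg (Gen T Δ n) ?_))
    exact congrArg₂ Fm.eq (Tm.subst_up _ _ _) (Tm.subst_up _ _ _)
  | bot => exact ⟨False.elim, not_gen_bot hcon n⟩
  | imp φ ψ ih₁ ih₂ =>
    rw [Fm.subst, gen_imp hstep hE, ← ih₁, ← ih₂]
    rfl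
  | all σ φ ih =>
    rw [Fm.subst, gen_all hstep hcon hE]
    have key (k : ℕ) (hk : n ≤ k) (x : (termStr T Δ).D σ) (hx : x.1 ≤ k) :
        Str.Sat φ (Str.cons x e) ↔ Gen T Δ k ((φ.subst
          (Sub.lift fun τ v => (e τ v).2.subst (up (h τ v)))).subst
            (Sub.cons (x.2.subst (up hx)) (up hk))) := by
      have hb : ∀ τ v, (Str.cons x e τ v).1 ≤ k := by
        intro τ v
        cases v with
        | zero => exact hx
        | succ v => exact (h τ v).trans hk
      rw [ih (Str.cons x e) hb, Fm.subst_lift_subst_cons]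
      simp only [Tm.subst_up]
      apply iff_of_eq
      congr 2
      funext τ v
      cases v <;> rfl
    constructor
    · intro hs k hk t
      have := (key k hk ⟨k, t⟩ le_rfl).1 (hs _)
      rwa [up_self, Tm.subst_var] at this
    · intro hg x
      exact (key (max n x.1) (le_max_left _ _) x (le_max_right _ _)).2 (hg _ _ _)

end Generic

/-- A structure satisfies a sentence. -/
def Str.Models (M : Str) (φ : Sentence) : Prop := Str.Sat φ (Str.nil (M := M))

/-- **Completeness**: a sentence that holds in every structure satisfying `T` is provable. -/
theorem proves_of_forall_models {T : Set Sentence} {φ : Sentence}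
    (h : ∀ M : Str, (∀ ψ ∈ T, M.Models ψ) → M.Models φ) : Proves T φ := by
  by_contra hn
  obtain ⟨ty, E, hE⟩ := exists_enumeration
  obtain ⟨Δ, h0, hcon, hstep⟩ := exists_chain E (¬ₒφ) fun hd => hn (.raa hd)
  have hs (ψ : Sentence) : (termStr T Δ).Models ψ ↔ Gen T Δ 0 ψ := by
    rw [Str.Models, termStr_sat hstep hcon hE ψ Str.nil (n := 0) (fun τ v => nomatch v)]
    apply iff_of_eq
    congr 1
    conv_rhs => rw [← Fm.subst_var ψ]
    congr 1
    funext τ v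
    nomatch v
  have hφ := (hs φ).1 <| h _ fun ψ hψ => (hs ψ).2 <| Gen.of_derives <| by
    have := Derives.ax (Γ := []) (Δ := Δ 0) hψ
    rw [Fm.inCtx, show (Sub.empty : Sub [] []) = fun _ v => .var v from
      funext fun _ => funext fun v => nomatch v] at this
    exact (Fm.subst_var ψ) ▸ this
  have hn : Gen T Δ 0 (Fm.not (Γ := []) φ) :=
    Gen.of_derives (.hyp (by rw [h0]; exact List.mem_cons_self))
  exact not_gen_bot hcon 0 (Gen.mp hstep hn hφ)

/-! ### Extensional models -/

namespace Str

section Simp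
variable {M : Str} {Γ : List Ty} (e : M.Env Γ)

@[simp] theorem sat_eq (a b : Tm Γ nat) : Sat (a =ₒ b) e ↔ M.E (eval e a) (eval e b) := Iff.rfl
@[simp] theorem sat_bot : Sat .bot e ↔ False := Iff.rfl
@[simp] theorem sat_imp (φ ψ : Fm Γ) : Sat (φ →ₒ ψ) e ↔ (Sat φ e → Sat ψ e) := Iff.rfl
@[simp] theorem sat_not (φ : Fm Γ) : Sat (¬ₒφ) e ↔ ¬ Sat φ e := Iff.rfl
@[simp] theorem sat_all {σ : Ty} (φ : Fm (σ :: Γ)) :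
    Sat (.all σ φ) e ↔ ∀ x : M.D σ, Sat φ (cons x e) := Iff.rfl
@[simp] theorem sat_and (φ ψ : Fm Γ) : Sat (φ ∧ₒ ψ) e ↔ Sat φ e ∧ Sat ψ e := by
  simp [Fm.and]
@[simp] theorem sat_or (φ ψ : Fm Γ) : Sat (φ ∨ₒ ψ) e ↔ Sat φ e ∨ Sat ψ e := by
  simp [Fm.or]; tauto
@[simp] theorem sat_ex {σ : Ty} (φ : Fm (σ :: Γ)) :
    Sat (.ex σ φ) e ↔ ∃ x : M.D σ, Sat φ (cons x e) := by
  simp [Fm.ex]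
@[simp] theorem sat_forallₒ {σ : Ty} (φ : Tm (σ :: Γ) σ → Fm (σ :: Γ)) :
    Sat (forallₒ σ φ) e ↔ ∀ x : M.D σ, Sat (φ (.var .zero)) (cons x e) := Iff.rfl
@[simp] theorem sat_existsₒ {σ : Ty} (φ : Tm (σ :: Γ) σ → Fm (σ :: Γ)) :
    Sat (existsₒ σ φ) e ↔ ∃ x : M.D σ, Sat (φ (.var .zero)) (cons x e) := sat_ex e _
@[simp] theorem eval_zero : eval e .zero = M.zero := rfl
@[simp] theorem eval_succ : eval e .succ = M.succ := rfl
@[simp] theorem eval_K (σ τ : Ty) : eval e (.K σ τ) = M.K σ τ := rfl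
@[simp] theorem eval_S (ρ σ τ : Ty) : eval e (.S ρ σ τ) = M.S ρ σ τ := rfl
@[simp] theorem eval_R : eval e .R = M.R := rfl
@[simp] theorem eval_app {σ τ : Ty} (f : Tm Γ (σ ⇒ₜ τ)) (a : Tm Γ σ) :
    eval e (f ⬝ₜ a) = M.app (eval e f) (eval e a) := rfl
@[simp] theorem eval_var_zero {σ : Ty} (x : M.D σ) : eval (cons x e) (.var .zero) = x := rfl
@[simp] theorem eval_var_succ {σ τ : Ty} (x : M.D σ) (v : Var Γ τ) :
    eval (cons x e) (.var v.succ) = eval e (.var v) := rfl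

end Simp

variable (M : Str)

/-- Extensional equality of the elements of a structure. -/
def Eqv : (τ : Ty) → M.D τ → M.D τ → Prop
  | .nat, a, b => M.E a b
  | .arr σ τ, f, g => ∀ x : M.D σ, Eqv τ (M.app f x) (M.app g x)

variable {M}

@[simp] theorem sat_eqAt {Γ : List Ty} (e : M.Env Γ) {τ : Ty} (a b : Tm Γ τ) :
    Sat (eqAt τ a b) e ↔ M.Eqv τ (eval e a) (eval e b) := by
  induction τ generalizing Γ with
  | nat => rfl
  | arr σ τ _ ih => simp [eqAt, Eqv, ih]

theorem sat_closure {Γ : List Ty} (φ : Fm Γ) : M.Models φ.closure ↔ ∀ e : M.Env Γ, Sat φ e := by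
  induction Γ with
  | nil => exact ⟨fun h e => env_nil nil e ▸ h, fun h => h _⟩
  | cons σ Γ ih =>
    rw [Fm.closure, ih]
    refine ⟨fun h e => ?_, fun h e x => h _⟩
    have := h (fun τ v => e τ v.succ) (e _ .zero)
    convert this using 1
    funext τ v
    cases v <;> rfl

/-- Equality of numbers is an equivalence relation, and extensional equality is a congruence. -/
structure IsExt (M : Str) : Prop where
  refl (a : M.D nat) : M.E a a
  eucl (a b c : M.D nat) : M.E a b → M.E a c → M.E b c
  ext {σ τ : Ty} (f : M.D (σ ⇒ₜ τ)) (x y : M.D σ) : M.Eqv σ x y → M.Eqv τ (M.app f x) (M.app f y)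

theorem IsExt.of_models (h : ∀ φ ∈ RCA₀ω, M.Models φ) : IsExt M where
  refl a := by simpa [Models] using h _ .eq_refl a
  eucl a b c := by simpa [Models] using h _ .eq_eucl a b c
  ext {σ τ} f x y := by simpa [Models] using h _ (.ext σ τ) f x y

theorem IsExt.eqv_equivalence (h : IsExt M) (τ : Ty) : Equivalence (M.Eqv τ) := by
  induction τ with
  | nat =>
    exact ⟨h.refl, fun {a b} hab => h.eucl a b a hab (h.refl a),
      fun {a b c} hab hbc => h.eucl b a c (h.eucl a b a hab (h.refl a)) hbc⟩
  | arr σ τ _ ih =>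
    exact ⟨fun f x => ih.refl _, fun hfg x => ih.symm (hfg x),
      fun hfg hgk x => ih.trans (hfg x) (hgk x)⟩

/-- Extensional equality as a setoid. -/
def IsExt.setoid (h : IsExt M) (τ : Ty) : Setoid (M.D τ) := ⟨M.Eqv τ, h.eqv_equivalence τ⟩

/-- The quotient of a structure by extensional equality. -/
def IsExt.quot (h : IsExt M) : Str where
  D τ := Quotient (h.setoid τ)
  app := Quotient.map₂ M.app fun _ g hfg a b hab =>
    (h.eqv_equivalence _).trans (hfg a) (h.ext g a b hab)
  zero := Quotient.mk _ M.zero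
  succ := Quotient.mk _ M.succ
  K σ τ := Quotient.mk _ (M.K σ τ)
  S ρ σ τ := Quotient.mk _ (M.S ρ σ τ)
  R := Quotient.mk _ M.R
  E a b := a = b

/-- The class of an element in the quotient. -/
def IsExt.cls (h : IsExt M) {τ : Ty} (a : M.D τ) : h.quot.D τ := Quotient.mk (h.setoid τ) a

theorem IsExt.cls_eq (h : IsExt M) {τ : Ty} {a b : M.D τ} : h.cls a = h.cls b ↔ M.Eqv τ a b :=
  Quotient.eq (r := h.setoid τ)

theorem IsExt.cls_surjective (h : IsExt M) {τ : Ty} (a : h.quot.D τ) : ∃ b : M.D τ, h.cls b = a :=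
  Quotient.exists_rep a

theorem IsExt.eval_quot (h : IsExt M) {Γ : List Ty} (e : M.Env Γ) {τ : Ty} (t : Tm Γ τ) :
    eval (M := h.quot) (fun τ v => h.cls (e τ v)) t = h.cls (eval e t) := by
  induction t with
  | app f a ih₁ ih₂ => rw [eval, ih₁, ih₂]; rfl
  | _ => rfl

theorem IsExt.sat_quot (h : IsExt M) {Γ : List Ty} (φ : Fm Γ) (e : M.Env Γ) :
    Sat (M := h.quot) φ (fun τ v => h.cls (e τ v)) ↔ Sat φ e := by
  induction φ with
  | eq a b =>
    rw [Sat, eval_quot, eval_quot]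
    exact h.cls_eq
  | bot => rfl
  | imp φ ψ ih₁ ih₂ => rw [Sat, Sat, ih₁, ih₂]
  | all σ φ ih =>
    have key (x : M.D σ) : (cons (M := h.quot) (h.cls x) fun τ v => h.cls (e τ v)) =
        fun τ v => h.cls (cons x e τ v) := by
      funext τ v
      cases v <;> rfl
    refine ⟨fun hs x => ?_, fun hs x => ?_⟩
    · have := hs (h.cls x)
      rwa [key, ih] at this
    · obtain ⟨x, rfl⟩ := h.cls_surjective x
      rw [key, ih]
      exact hs x

theorem IsExt.models_quot (h : IsExt M) (φ : Sentence) : h.quot.Models φ ↔ M.Models φ := by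
  rw [Models, Models, ← h.sat_quot φ nil, env_nil nil fun τ v => h.cls (nil τ v)]

end Str

/-- Models of the equational part of `RCA₀^ω` and of quantifier-free induction in which equality of
numbers is identity and objects of higher type are determined by their values. -/
structure Model extends Str where
  E_iff (a b : D nat) : E a b ↔ a = b
  ext {σ τ : Ty} {f g : D (σ ⇒ₜ τ)} : (∀ x, app f x = app g x) → f = g
  succ_ne_zero (a : D nat) : app succ a ≠ zero
  succ_inj {a b : D nat} : app succ a = app succ b → a = b
  K_app {σ τ : Ty} (x : D σ) (y : D τ) : app (app (K σ τ) x) y = x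
  S_app {ρ σ τ : Ty} (f : D (ρ ⇒ₜ σ ⇒ₜ τ)) (g : D (ρ ⇒ₜ σ)) (x : D ρ) :
    app (app (app (S ρ σ τ) f) g) x = app (app f x) (app g x)
  R_zero (y : D nat) (z : D (nat ⇒ₜ nat ⇒ₜ nat)) : app (app (app R zero) y) z = y
  R_succ (n y : D nat) (z : D (nat ⇒ₜ nat ⇒ₜ nat)) :
    app (app (app R (app succ n)) y) z = app (app z (app (app (app R n) y) z)) n
  ind {Γ : List Ty} (A : Fm (nat :: Γ)) (hA : A.IsQF) (e : toStr.Env Γ) :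
    Str.Sat A (Str.cons zero e) →
    (∀ n, Str.Sat A (Str.cons n e) → Str.Sat A (Str.cons (app succ n) e)) →
    ∀ n, Str.Sat A (Str.cons n e)

/-- The extensional quotient of a structure satisfying `RCA₀^ω`. -/
def Model.ofStr (M : Str) (hM : ∀ φ ∈ RCA₀ω, M.Models φ) : Model :=
  let h := Str.IsExt.of_models hM
  have hq (φ : Sentence) (hφ : φ ∈ RCA₀ω) : h.quot.Models φ := (h.models_quot φ).2 (hM φ hφ)
  have hE : ∀ a b, h.quot.E a b ↔ a = b := fun _ _ => Iff.rfl
  have eqv : ∀ {τ : Ty} {a b : h.quot.D τ}, h.quot.Eqv τ a b → a = b := by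
    intro τ
    induction τ with
    | nat => exact id
    | arr σ τ _ ih =>
      intro f g hfg
      obtain ⟨f, rfl⟩ := h.cls_surjective f
      obtain ⟨g, rfl⟩ := h.cls_surjective g
      exact h.cls_eq.2 fun x => h.cls_eq.1 (ih (hfg (h.cls x)))
  have eqv' : ∀ {τ : Ty} {a b : h.quot.D τ}, a = b → h.quot.Eqv τ a b := by
    intro τ
    induction τ with
    | nat => exact id
    | arr σ τ _ ih => exact fun hfg x => ih (hfg ▸ rfl)
  { h.quot with
    E_iff := fun _ _ => Iff.rfl
    ext := fun {_ _ _ _} hfg => eqv fun x => eqv' (hfg x)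
    succ_ne_zero := fun a => by simpa [Str.Models, hE] using hq _ .succ_ne_zero a
    succ_inj := fun {a b} => by simpa [Str.Models, hE] using hq _ .succ_inj a b
    K_app := fun {σ τ} x y => eqv (by simpa [Str.Models] using hq _ (.K_eq σ τ) x y)
    S_app := fun {ρ σ τ} f g x => eqv (by simpa [Str.Models] using hq _ (.S_eq ρ σ τ) f g x)
    R_zero := fun y z => by simpa [Str.Models, hE] using hq _ .R_zero y z
    R_succ := fun n y z => by simpa [Str.Models, hE] using hq _ .R_succ n y z
    ind := fun {Γ} A hA e h0 hs n => by
      have := (Str.sat_closure _).1 (hq _ (.induction A hA)) e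
      simp only [inductionAx, Fm.inst, Str.sat_imp, Str.sat_and, Str.sat_all, Str.sat_subst,
        Str.cons_eval] at this
      exact this ⟨h0, hs⟩ n }

theorem Model.models_ofStr (M : Str) (hM : ∀ φ ∈ RCA₀ω, M.Models φ) (φ : Sentence) :
    (Model.ofStr M hM).Models φ ↔ M.Models φ :=
  (Str.IsExt.of_models hM).models_quot φ

/-! ### Arithmetic in a model -/

/-- The variable `0`. -/
abbrev v0 {Γ : List Ty} {σ : Ty} : Tm (σ :: Γ) σ := .var .zero
/-- The variable `1`. -/
abbrev v1 {Γ : List Ty} {σ τ : Ty} : Tm (τ :: σ :: Γ) σ := .var (.succ .zero)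
/-- The variable `2`. -/
abbrev v2 {Γ : List Ty} {σ τ υ : Ty} : Tm (υ :: τ :: σ :: Γ) σ := .var (.succ (.succ .zero))

namespace Model
open Str

attribute [simp] Model.E_iff Model.K_app Model.S_app Model.R_zero

variable {M : Model}

variable (M) in
/-- The numbers of a model. -/
abbrev N : Type := M.D nat

@[simp] theorem app_lam {Γ : List Ty} {σ τ : Ty} (e : M.Env Γ) (t : Tm (σ :: Γ) τ) (x : M.D σ) :
    M.app (eval e (lam t)) x = eval (cons x e) t := by
  match τ, t with
  | _, .var .zero => simp [lam]
  | _, .var (.succ v) => simp [lam]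
  | _, .zero => simp [lam]
  | _, .succ => simp [lam]
  | _, .K _ _ => simp [lam]
  | _, .S _ _ _ => simp [lam]
  | _, .R => simp [lam]
  | _, .app f a => simp [lam, app_lam e f, app_lam e a]

@[simp] theorem app_lamₒ {Γ : List Ty} {σ τ : Ty} (e : M.Env Γ) (t : Tm (σ :: Γ) σ → Tm (σ :: Γ) τ)
    (x : M.D σ) : M.app (eval e (lamₒ σ t)) x = eval (cons x e) (t v0) := app_lam e _ x

theorem ext₂ {σ τ υ : Ty} {f g : M.D (σ ⇒ₜ τ ⇒ₜ υ)}
    (h : ∀ x y, M.app (M.app f x) y = M.app (M.app g x) y) : f = g :=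
  M.ext fun x => M.ext fun y => h x y

instance : Zero M.N := ⟨M.zero⟩
/-- The successor. -/
def suc (a : M.N) : M.N := M.app M.succ a
instance : One M.N := ⟨suc 0⟩
/-- The predecessor. -/
def pred (a : M.N) : M.N := eval (cons a nil) (HOArith.pred v0)
instance : Add M.N := ⟨fun a b => eval (cons b (cons a nil)) (HOArith.add v1 v0)⟩
instance : Mul M.N := ⟨fun a b => eval (cons b (cons a nil)) (HOArith.mul v1 v0)⟩
instance : _root_.Sub M.N := ⟨fun a b => eval (cons b (cons a nil)) (HOArith.monus v1 v0)⟩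
/-- Powers of `2`. -/
def p2 (a : M.N) : M.N := eval (cons a nil) (HOArith.pow2 v0)
/-- Triangular numbers. -/
def tri (a : M.N) : M.N :=
  M.app (M.app (M.app M.R a) 0) (eval nil (lamₒ nat fun u => lamₒ nat fun i =>
    HOArith.add u.wk (HOArith.suc i)))
/-- The index of the diagonal on which a coded pair lies. -/
def diag (a : M.N) : M.N :=
  M.app (M.app (M.app M.R a) 0) (eval nil (lamₒ nat fun w => lamₒ nat fun i =>
    HOArith.add w.wk (monus num1 (monus (HOArith.tri (HOArith.suc w.wk)) (HOArith.suc i)))))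

section Eval
variable {Γ : List Ty} (e : M.Env Γ) (s t : Tm Γ nat)

@[simp] theorem zero_def : M.zero = 0 := rfl
@[simp] theorem app_succ (a : M.N) : M.app M.succ a = suc a := rfl
theorem one_def : (1 : M.N) = suc 0 := rfl
@[simp] theorem eval_suc : eval e (HOArith.suc s) = suc (eval e s) := rfl
@[simp] theorem eval_num1 : eval e (num1 : Tm Γ nat) = 1 := rfl
@[simp] theorem eval_num2 : eval e (num2 : Tm Γ nat) = suc 1 := rfl
@[simp] theorem eval_pred : eval e (HOArith.pred s) = pred (eval e s) := rfl
@[simp] theorem eval_add : eval e (HOArith.add s t) = eval e s + eval e t := rfl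
@[simp] theorem eval_mul : eval e (HOArith.mul s t) = eval e s * eval e t := by
  change _ = eval (cons (eval e t) (cons (eval e s) nil)) (HOArith.mul v1 v0)
  simp only [HOArith.mul, recₒ, eval_app]
  congr 1
  apply ext₂
  simp
@[simp] theorem eval_monus : eval e (HOArith.monus s t) = eval e s - eval e t := rfl
@[simp] theorem eval_pow2 : eval e (HOArith.pow2 s) = p2 (eval e s) := by
  change _ = eval (cons (eval e s) nil) (HOArith.pow2 v0)
  simp only [HOArith.pow2, recₒ, eval_app]
  congr 1
@[simp] theorem eval_tri : eval e (HOArith.tri s) = tri (eval e s) :=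
  congrArg (M.app (M.app (M.app M.R (eval e s)) 0)) (ext₂ fun x y => by simp)
@[simp] theorem eval_diag : eval e (HOArith.diag s) = diag (eval e s) :=
  congrArg (M.app (M.app (M.app M.R (eval e s)) 0)) (ext₂ fun x y => by
    simp only [app_lamₒ, eval_add, eval_monus, eval_tri, eval_suc, eval_wk, eval_num1,
      eval_var_zero])

end Eval

section Rec
variable (a b : M.N)

@[simp] theorem app_R_zero (y : M.N) (z : M.D (nat ⇒ₜ nat ⇒ₜ nat)) :
    M.app (M.app (M.app M.R 0) y) z = y := M.R_zero y z

@[simp] theorem app_R_suc (n y : M.N) (z : M.D (nat ⇒ₜ nat ⇒ₜ nat)) :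
    M.app (M.app (M.app M.R (suc n)) y) z =
      M.app (M.app z (M.app (M.app (M.app M.R n) y) z)) n := M.R_succ n y z

@[simp] theorem pred_zero : pred (0 : M.N) = 0 := by
  rw [pred, HOArith.pred, recₒ]; simp
@[simp] theorem pred_suc : pred (suc a) = a := by
  rw [pred, HOArith.pred, recₒ]; simp
theorem add_zero' : a + 0 = a := by
  change eval (cons 0 (cons a nil)) (HOArith.add v1 v0) = a
  rw [HOArith.add, recₒ]; simp
theorem add_suc : a + suc b = suc (a + b) := by
  change eval (cons (suc b) (cons a nil)) (HOArith.add v1 v0) = _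
  rw [HOArith.add, recₒ]; simp; rfl
theorem mul_zero' : a * 0 = 0 := by
  change eval (cons 0 (cons a nil)) (HOArith.mul v1 v0) = _
  rw [HOArith.mul, recₒ]; simp
theorem mul_suc : a * suc b = a * b + a := by
  change eval (cons (suc b) (cons a nil)) (HOArith.mul v1 v0) =
    eval (cons b (cons a nil)) (HOArith.mul v1 v0) + a
  have : eval (cons b (cons a nil)) (HOArith.mul v1 v0 : Tm [nat, nat] nat) =
    M.app (M.app (M.app M.R b) 0) (eval (cons (suc b) (cons a nil))
      (lamₒ nat fun u => lamₒ nat fun _ => HOArith.add u.wk (Tm.wk (Tm.wk v1)))) := by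
    rw [HOArith.mul, recₒ]
    simp only [eval_app]
    congr 1
  rw [this, HOArith.mul, recₒ]; simp
theorem sub_zero' : a - 0 = a := by
  change eval (cons 0 (cons a nil)) (HOArith.monus v1 v0) = a
  rw [HOArith.monus, recₒ]; simp
theorem sub_suc : a - suc b = pred (a - b) := by
  change eval (cons (suc b) (cons a nil)) (HOArith.monus v1 v0) = _
  rw [HOArith.monus, recₒ]; simp; rfl
theorem p2_zero' : p2 (0 : M.N) = 1 := by
  rw [p2, HOArith.pow2, recₒ]; simp
theorem p2_suc : p2 (suc a) = p2 a + p2 a := by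
  rw [p2, HOArith.pow2, recₒ]; simp; rfl
theorem tri_zero : tri (0 : M.N) = 0 := app_R_zero _ _
theorem tri_suc : tri (suc a) = tri a + suc a := by
  rw [tri, app_R_suc, ← tri]; simp
theorem diag_zero : diag (0 : M.N) = 0 := app_R_zero _ _
theorem diag_suc : diag (suc a) = diag a + (1 - (tri (suc (diag a)) - suc a)) := by
  rw [diag, app_R_suc, ← diag]
  simp only [app_lamₒ, eval_add, eval_monus, eval_tri, eval_suc, eval_wk, eval_num1,
    eval_var_zero]

end Rec

/-- Induction for a predicate that is defined by a quantifier-free formula. -/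
theorem indFm {Γ : List Ty} (A : Fm (nat :: Γ)) (hA : A.IsQF) (e : M.Env Γ) {P : M.N → Prop}
    (hP : ∀ n, Sat A (cons n e) ↔ P n) (h0 : P 0) (hs : ∀ n, P n → P (suc n)) (n : M.N) : P n :=
  (hP n).1 (M.ind A hA e ((hP _).2 h0) (fun n hn => (hP _).2 (hs n ((hP n).1 hn))) n)

theorem suc_ne_zero (a : M.N) : suc a ≠ 0 := M.succ_ne_zero a
theorem suc_inj {a b : M.N} (h : suc a = suc b) : a = b := M.succ_inj h

theorem zero_add' (a : M.N) : 0 + a = a := by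
  refine indFm (HOArith.add .zero v0 =ₒ v0) (by simp [Fm.IsQF]) nil
    (P := fun a => 0 + a = a) (fun n => by simp) ?_ ?_ a
  · exact add_zero' 0
  · intro n h; rw [add_suc, h]

theorem suc_add (a b : M.N) : suc a + b = suc (a + b) := by
  refine indFm (HOArith.add (HOArith.suc v1) v0 =ₒ HOArith.suc (HOArith.add v1 v0))
    (by simp [Fm.IsQF]) (cons a nil)
    (P := fun b => suc a + b = suc (a + b)) (fun n => by simp) ?_ ?_ b
  · rw [add_zero', add_zero']
  · intro n h; rw [add_suc, h, add_suc]

theorem add_comm' (a b : M.N) : a + b = b + a := by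
  refine indFm (HOArith.add v1 v0 =ₒ HOArith.add v0 v1) (by simp [Fm.IsQF])
    (cons a nil) (P := fun b => a + b = b + a) (fun n => by simp) ?_ ?_ b
  · rw [add_zero', zero_add']
  · intro n h; rw [add_suc, h, suc_add]

theorem add_assoc' (a b c : M.N) : a + b + c = a + (b + c) := by
  refine indFm (HOArith.add (HOArith.add v2 v1) v0 =ₒ HOArith.add v2 (HOArith.add v1 v0))
    (by simp [Fm.IsQF]) (cons b (cons a nil))
    (P := fun c => a + b + c = a + (b + c)) (fun n => by simp) ?_ ?_ c
  · rw [add_zero', add_zero']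
  · intro n h; rw [add_suc, h, add_suc, add_suc]

instance : AddCommMonoid M.N where
  add_assoc := add_assoc'
  zero_add := zero_add'
  add_zero := add_zero'
  add_comm := add_comm'
  nsmul := nsmulRec

theorem suc_eq (a : M.N) : suc a = a + 1 := by rw [one_def, add_suc, add_zero']

theorem zero_mul' (a : M.N) : 0 * a = 0 := by
  refine indFm (HOArith.mul .zero v0 =ₒ .zero) (by simp [Fm.IsQF]) nil
    (P := fun a => 0 * a = 0) (fun n => by simp) ?_ ?_ a
  · exact mul_zero' 0
  · intro n h; rw [mul_suc, h, add_zero']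

theorem suc_mul (a b : M.N) : suc a * b = a * b + b := by
  refine indFm (HOArith.mul (HOArith.suc v1) v0 =ₒ HOArith.add (HOArith.mul v1 v0) v0)
    (by simp [Fm.IsQF]) (cons a nil)
    (P := fun b => suc a * b = a * b + b) (fun n => by simp) ?_ ?_ b
  · rw [mul_zero', mul_zero', add_zero']
  · intro n h
    rw [mul_suc, h, mul_suc, suc_eq, suc_eq]
    abel

theorem mul_comm' (a b : M.N) : a * b = b * a := by
  refine indFm (HOArith.mul v1 v0 =ₒ HOArith.mul v0 v1) (by simp [Fm.IsQF])
    (cons a nil) (P := fun b => a * b = b * a) (fun n => by simp) ?_ ?_ b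
  · rw [mul_zero', zero_mul']
  · intro n h; rw [mul_suc, h, suc_mul]

theorem mul_add' (a b c : M.N) : a * (b + c) = a * b + a * c := by
  refine indFm (HOArith.mul v2 (HOArith.add v1 v0) =ₒ HOArith.add (HOArith.mul v2 v1)
    (HOArith.mul v2 v0)) (by simp [Fm.IsQF])
    (cons b (cons a nil)) (P := fun c => a * (b + c) = a * b + a * c) (fun n => by simp) ?_ ?_ c
  · rw [mul_zero', add_zero, add_zero]
  · intro n h; rw [add_suc, mul_suc, h, mul_suc, add_assoc]

theorem mul_assoc' (a b c : M.N) : a * b * c = a * (b * c) := by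
  refine indFm (HOArith.mul (HOArith.mul v2 v1) v0 =ₒ HOArith.mul v2 (HOArith.mul v1 v0))
    (by simp [Fm.IsQF]) (cons b (cons a nil))
    (P := fun c => a * b * c = a * (b * c)) (fun n => by simp) ?_ ?_ c
  · rw [mul_zero', mul_zero', mul_zero']
  · intro n h; rw [mul_suc, h, mul_suc, mul_add']

theorem one_mul' (a : M.N) : 1 * a = a := by
  rw [one_def, suc_mul, zero_mul', zero_add]

instance : CommSemiring M.N where
  mul_assoc := mul_assoc'
  one_mul := one_mul'
  mul_one a := by rw [mul_comm', one_mul']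
  mul_comm := mul_comm'
  left_distrib := mul_add'
  right_distrib a b c := by rw [mul_comm', mul_add', mul_comm' a, mul_comm' b]
  zero_mul := zero_mul'
  mul_zero := mul_zero'

/-! ### The order of the numbers -/

theorem eq_zero_or_eq_succ (a : M.N) : a = 0 ∨ a = pred a + 1 := by
  refine indFm (v0 =ₒ .zero ∨ₒ v0 =ₒ HOArith.add (HOArith.pred v0) num1)
    (by simp [Fm.or, Fm.not, Fm.IsQF]) nil (P := fun a => a = 0 ∨ a = pred a + 1)
    (fun n => by simp) ?_ ?_ a
  · exact .inl rfl
  · intro n _; right; rw [pred_suc, suc_eq]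

theorem succ_ne_zero' (a : M.N) : a + 1 ≠ 0 := by
  rw [← suc_eq]; exact suc_ne_zero a

theorem add_cancel_right' {a b c : M.N} (h : a + c = b + c) : a = b := by
  revert h
  refine indFm (HOArith.add v1 v0 =ₒ HOArith.add v2 v0 →ₒ v1 =ₒ v2) (by simp [Fm.IsQF])
    (cons a (cons b nil)) (P := fun c => a + c = b + c → a = b) (fun n => by simp) ?_ ?_ c
  · simp
  · intro n h h'
    rw [add_suc, add_suc] at h'
    exact h (suc_inj h')

theorem eq_zero_of_add {a b : M.N} (h : a + b = 0) : b = 0 := by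
  rcases eq_zero_or_eq_succ b with h' | h'
  · exact h'
  · rw [h', ← add_assoc] at h
    exact (succ_ne_zero' _ h).elim

theorem succ_sub_succ (a b : M.N) : (a + 1) - (b + 1) = a - b := by
  simp only [← suc_eq]
  refine indFm (HOArith.monus (HOArith.suc v1) (HOArith.suc v0) =ₒ HOArith.monus v1 v0)
    (by simp [Fm.IsQF]) (cons a nil)
    (P := fun b => suc a - suc b = a - b) (fun n => by simp) ?_ ?_ b
  · rw [sub_suc, sub_zero', pred_suc, sub_zero']
  · intro n h; rw [sub_suc, h, sub_suc]

theorem add_sub_self (a c : M.N) : (a + c) - a = c := by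
  refine indFm (HOArith.monus (HOArith.add v0 v1) v0 =ₒ v1) (by simp [Fm.IsQF])
    (cons c nil) (P := fun a => (a + c) - a = c) (fun n => by simp) ?_ ?_ a
  · rw [zero_add, sub_zero']
  · intro n h; rwa [suc_eq, add_right_comm, succ_sub_succ]

theorem sub_self_add (a c : M.N) : a - (a + c) = 0 := by
  refine indFm (HOArith.monus v0 (HOArith.add v0 v1) =ₒ .zero) (by simp [Fm.IsQF])
    (cons c nil) (P := fun a => a - (a + c) = 0) (fun n => by simp) ?_ ?_ a
  · refine indFm (HOArith.monus .zero (HOArith.add .zero v0) =ₒ .zero) (by simp [Fm.IsQF])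
      nil (P := fun c => (0 : M.N) - (0 + c) = 0) (fun n => by simp) ?_ ?_ c
    · rw [add_zero, sub_zero']
    · intro n h; rw [add_suc, sub_suc, h, pred_zero]
  · intro n h; rwa [suc_eq, add_right_comm, succ_sub_succ]

theorem add_sub_or (a b : M.N) : a + (b - a) = b ∨ b + (a - b) = a := by
  refine indFm ((HOArith.add v1 (HOArith.monus v0 v1) =ₒ v0) ∨ₒ
    (HOArith.add v0 (HOArith.monus v1 v0) =ₒ v1)) (by simp [Fm.IsQF, Fm.or, Fm.not])
    (cons a nil) (P := fun b => a + (b - a) = b ∨ b + (a - b) = a) (fun n => by simp) ?_ ?_ b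
  · right; rw [zero_add, sub_zero']
  · intro n h
    rw [suc_eq]
    rcases h with h | h
    · left
      have h' : n + 1 = a + ((n - a) + 1) := by rw [← add_assoc, h]
      rw [h', add_sub_self]
    · rcases eq_zero_or_eq_succ (a - n) with h' | h'
      · left
        rw [h', add_zero] at h
        rw [h, add_sub_self]
      · right
        rw [h', add_comm (pred _), ← add_assoc] at h
        nth_rewrite 1 [← h]
        rw [add_sub_self, h]

instance : LE M.N := ⟨fun a b => a - b = 0⟩

theorem le_def {a b : M.N} : a ≤ b ↔ a - b = 0 := Iff.rfl

theorem le_iff_exists_add' {a b : M.N} : a ≤ b ↔ ∃ c, b = a + c := by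
  rw [le_def]
  constructor
  · intro h
    rcases add_sub_or a b with h' | h'
    · exact ⟨_, h'.symm⟩
    · rw [h, add_zero] at h'
      exact ⟨0, by rw [h', add_zero]⟩
  · rintro ⟨c, rfl⟩
    exact sub_self_add a c

open Classical in
noncomputable instance : LinearOrder M.N where
  le_refl a := le_iff_exists_add'.2 ⟨0, by simp⟩
  le_trans a b c hab hbc := by
    obtain ⟨x, rfl⟩ := le_iff_exists_add'.1 hab
    obtain ⟨y, rfl⟩ := le_iff_exists_add'.1 hbc
    exact le_iff_exists_add'.2 ⟨x + y, by rw [add_assoc]⟩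
  le_antisymm a b hab hba := by
    obtain ⟨x, rfl⟩ := le_iff_exists_add'.1 hab
    obtain ⟨y, h⟩ := le_iff_exists_add'.1 hba
    have h' : x + y + a = 0 + a := by rw [zero_add, add_comm, ← add_assoc, ← h]
    have h₀ := add_cancel_right' h'
    rw [add_comm] at h₀
    rw [eq_zero_of_add h₀, add_zero]
  le_total a b := by
    rcases add_sub_or a b with h | h
    · exact .inl (le_iff_exists_add'.2 ⟨_, h.symm⟩)
    · exact .inr (le_iff_exists_add'.2 ⟨_, h.symm⟩)
  toDecidableLE := Classical.decRel _

instance : IsOrderedCancelAddMonoid M.N where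
  add_le_add_left a b h c := by
    obtain ⟨x, rfl⟩ := le_iff_exists_add'.1 h
    exact le_iff_exists_add'.2 ⟨x, by abel⟩
  le_of_add_le_add_left a b c h := by
    obtain ⟨x, h⟩ := le_iff_exists_add'.1 h
    refine le_iff_exists_add'.2 ⟨x, add_cancel_right' (c := a) ?_⟩
    rw [add_comm, h]; abel

instance : CanonicallyOrderedAdd M.N where
  exists_add_of_le h := le_iff_exists_add'.1 h
  le_self_add _ b := le_iff_exists_add'.2 ⟨b, rfl⟩
  le_add_self _ b := le_iff_exists_add'.2 ⟨b, add_comm _ _⟩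

instance : Nontrivial M.N := ⟨0, 1, (suc_ne_zero 0).symm⟩

theorem lt_iff_succ_le {a b : M.N} : a < b ↔ a + 1 ≤ b := by
  constructor
  · intro h
    obtain ⟨c, rfl⟩ := exists_add_of_le h.le
    rcases eq_zero_or_eq_succ c with hc | hc
    · rw [hc, add_zero] at h
      exact (lt_irrefl _ h).elim
    · exact le_iff_exists_add'.2 ⟨pred c, by nth_rewrite 1 [hc]; abel⟩
  · intro h
    refine lt_of_le_of_ne (le_self_add.trans h) ?_
    rintro rfl
    obtain ⟨c, hc⟩ := exists_add_of_le h
    have : 0 + a = c + 1 + a := by rw [zero_add]; nth_rewrite 1 [hc]; abel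
    exact succ_ne_zero' c (add_cancel_right' this).symm

theorem lt_succ_iff' {a b : M.N} : a < b + 1 ↔ a ≤ b := by
  rw [lt_iff_succ_le]; exact add_le_add_iff_right 1

instance : IsStrictOrderedRing M.N where
  zero_le_one := le_iff_exists_add'.2 ⟨1, (zero_add 1).symm⟩
  mul_lt_mul_of_pos_left a ha b c h := by
    obtain ⟨x, rfl⟩ := exists_add_of_le (lt_iff_succ_le.1 ha)
    obtain ⟨y, rfl⟩ := exists_add_of_le (lt_iff_succ_le.1 h)
    rw [lt_iff_succ_le, le_iff_exists_add']
    exact ⟨x + y + x * y, by ring⟩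
  mul_lt_mul_of_pos_right a ha b c h := by
    obtain ⟨x, rfl⟩ := exists_add_of_le (lt_iff_succ_le.1 ha)
    obtain ⟨y, rfl⟩ := exists_add_of_le (lt_iff_succ_le.1 h)
    rw [lt_iff_succ_le, le_iff_exists_add']
    exact ⟨x + y + x * y, by ring⟩

end Model

/-! ### The ordered field of fractions of an ordered semiring -/

section Fractions
variable (N : Type) [CommSemiring N] [LinearOrder N] [IsStrictOrderedRing N]
  [CanonicallyOrderedAdd N]

/-- A formal fraction `(pos - neg) / den`. -/
structure PreFrac where
  pos : N
  neg : N
  den : N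
  den_pos : 0 < den

/-- Formal fractions are equivalent if they agree after cross-multiplication. -/
instance PreFrac.setoid : Setoid (PreFrac N) where
  r x y := x.pos * y.den + y.neg * x.den = y.pos * x.den + x.neg * y.den
  iseqv :=
    { refl := fun x => rfl
      symm := fun {x y} h => h.symm
      trans := fun {x y z} h₁ h₂ => by
        refine mul_right_cancel₀ (b := y.den) y.den_pos.ne' ?_
        linear_combination z.den * h₁ + x.den * h₂ }

/-- The ordered field of fractions of a canonically ordered semiring. -/
def Frac : Type := Quotient (PreFrac.setoid N)

variable {N}

namespace Frac

/-- The fraction `(a - b) / d`. -/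
def mk (a b d : N) (h : 0 < d) : Frac N := Quotient.mk _ ⟨a, b, d, h⟩

theorem mk_eq {a b d a' b' d' : N} {h : 0 < d} {h' : 0 < d'} :
    mk a b d h = mk a' b' d' h' ↔ a * d' + b' * d = a' * d + b * d' := Quotient.eq

theorem ind {P : Frac N → Prop} (h : ∀ a b d hd, P (mk a b d hd)) (x : Frac N) : P x :=
  Quotient.ind (fun x => h x.pos x.neg x.den x.den_pos) x

instance : Zero (Frac N) := ⟨mk 0 0 1 one_pos⟩
instance : One (Frac N) := ⟨mk 1 0 1 one_pos⟩
instance : Neg (Frac N) := ⟨Quotient.map (fun x => ⟨x.neg, x.pos, x.den, x.den_pos⟩)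
  fun x y (h : _ + _ = _ + _) => by
    change _ + _ = _ + _
    linear_combination -h⟩
instance : Add (Frac N) := ⟨Quotient.map₂ (fun x y => ⟨x.pos * y.den + y.pos * x.den,
    x.neg * y.den + y.neg * x.den, x.den * y.den, mul_pos x.den_pos y.den_pos⟩)
  fun x x' (h : _ + _ = _ + _) y y' (h' : _ + _ = _ + _) => by
    change _ + _ = _ + _
    linear_combination y.den * y'.den * h + x.den * x'.den * h'⟩
instance : Mul (Frac N) := ⟨Quotient.map₂ (fun x y => ⟨x.pos * y.pos + x.neg * y.neg,
    x.pos * y.neg + x.neg * y.pos, x.den * y.den, mul_pos x.den_pos y.den_pos⟩)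
  fun x x' (h : _ + _ = _ + _) y y' (h' : _ + _ = _ + _) => by
    change _ + _ = _ + _
    linear_combination (y.pos * y'.den) * h + (y.neg * y'.den) * h.symm +
      (x'.pos * x.den) * h' + (x'.neg * x.den) * h'.symm⟩

theorem zero_def : (0 : Frac N) = mk 0 0 1 one_pos := rfl
theorem one_def : (1 : Frac N) = mk 1 0 1 one_pos := rfl
theorem neg_mk (a b d : N) (h : 0 < d) : -mk a b d h = mk b a d h := rfl
theorem mk_add_mk (a b d a' b' d' : N) (h : 0 < d) (h' : 0 < d') :
    mk a b d h + mk a' b' d' h' = mk (a * d' + a' * d) (b * d' + b' * d) (d * d') (mul_pos h h') :=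
  rfl
theorem mk_mul_mk (a b d a' b' d' : N) (h : 0 < d) (h' : 0 < d') :
    mk a b d h * mk a' b' d' h' =
      mk (a * a' + b * b') (a * b' + b * a') (d * d') (mul_pos h h') := rfl

instance : CommRing (Frac N) where
  add_assoc := by
    refine ind fun _ _ _ _ => ind fun _ _ _ _ => ind fun _ _ _ _ => ?_
    simp only [mk_add_mk, mk_eq]; ring
  zero_add := by
    refine ind fun _ _ _ _ => ?_
    simp only [zero_def, mk_add_mk, mk_eq]; ring
  add_zero := by
    refine ind fun _ _ _ _ => ?_
    simp only [zero_def, mk_add_mk, mk_eq]; ring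
  add_comm := by
    refine ind fun _ _ _ _ => ind fun _ _ _ _ => ?_
    simp only [mk_add_mk, mk_eq]; ring
  neg_add_cancel := by
    refine ind fun _ _ _ _ => ?_
    simp only [zero_def, neg_mk, mk_add_mk, mk_eq]; ring
  mul_assoc := by
    refine ind fun _ _ _ _ => ind fun _ _ _ _ => ind fun _ _ _ _ => ?_
    simp only [mk_mul_mk, mk_eq]; ring
  mul_comm := by
    refine ind fun _ _ _ _ => ind fun _ _ _ _ => ?_
    simp only [mk_mul_mk, mk_eq]; ring
  one_mul := by
    refine ind fun _ _ _ _ => ?_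
    simp only [one_def, mk_mul_mk, mk_eq]; ring
  mul_one := by
    refine ind fun _ _ _ _ => ?_
    simp only [one_def, mk_mul_mk, mk_eq]; ring
  left_distrib := by
    refine ind fun _ _ _ _ => ind fun _ _ _ _ => ind fun _ _ _ _ => ?_
    simp only [mk_mul_mk, mk_add_mk, mk_eq]; ring
  right_distrib := by
    refine ind fun _ _ _ _ => ind fun _ _ _ _ => ind fun _ _ _ _ => ?_
    simp only [mk_mul_mk, mk_add_mk, mk_eq]; ring
  zero_mul := by
    refine ind fun _ _ _ _ => ?_
    simp only [zero_def, mk_mul_mk, mk_eq]; ring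
  mul_zero := by
    refine ind fun _ _ _ _ => ?_
    simp only [zero_def, mk_mul_mk, mk_eq]; ring
  nsmul := nsmulRec
  zsmul := zsmulRec

/-- The order is defined by adding fractions `c / d`. -/
instance : LE (Frac N) := ⟨fun x y => ∃ (c d : N) (h : 0 < d), y = x + mk c 0 d h⟩

theorem mk_le_mk {a b d a' b' d' : N} {h : 0 < d} {h' : 0 < d'} :
    mk a b d h ≤ mk a' b' d' h' ↔ a * d' + b' * d ≤ a' * d + b * d' := by
  constructor
  · rintro ⟨c, e, he, h₁⟩
    rw [mk_add_mk, mk_eq] at h₁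
    refine le_of_mul_le_mul_right (a := d * e) ?_ (mul_pos h he)
    refine le_of_le_of_eq (le_self_add (b := c * d * d * d')) ?_
    linear_combination d * h₁.symm
  · intro hle
    obtain ⟨c, hc⟩ := exists_add_of_le hle
    refine ⟨c, d * d', mul_pos h h', ?_⟩
    rw [mk_add_mk, mk_eq]
    linear_combination d * d' * hc

open Classical in
noncomputable instance : LinearOrder (Frac N) where
  le_refl x := ⟨0, 1, one_pos, (add_zero x).symm⟩
  le_trans x y z := by
    rintro ⟨c, d, h, rfl⟩ ⟨c', d', h', rfl⟩
    refine ⟨c * d' + c' * d, d * d', mul_pos h h', ?_⟩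
    rw [add_assoc, mk_add_mk]
    simp
  le_antisymm x y := by
    induction x using ind with | _ a b d hd
    induction y using ind with | _ a' b' d' hd'
    rw [mk_le_mk, mk_le_mk, mk_eq]
    exact le_antisymm
  le_total x y := by
    induction x using ind with | _ a b d hd
    induction y using ind with | _ a' b' d' hd'
    rw [mk_le_mk, mk_le_mk]
    exact le_total _ _
  toDecidableLE := Classical.decRel _

theorem mk_lt_mk {a b d a' b' d' : N} {h : 0 < d} {h' : 0 < d'} :
    mk a b d h < mk a' b' d' h' ↔ a * d' + b' * d < a' * d + b * d' := by
  rw [← not_le, mk_le_mk, not_le]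

instance : Nontrivial (Frac N) := ⟨0, 1, by
  rw [zero_def, one_def, Ne, mk_eq]; simp⟩

instance : IsOrderedAddMonoid (Frac N) where
  add_le_add_left x y h z := by
    obtain ⟨c, d, h, rfl⟩ := h
    exact ⟨c, d, h, by ring⟩

instance : ZeroLEOneClass (Frac N) := ⟨⟨1, 1, one_pos, (zero_add 1).symm⟩⟩

instance : IsStrictOrderedRing (Frac N) := by
  refine IsStrictOrderedRing.of_mul_pos fun x y => ?_
  induction x using ind with | _ a b d hd
  induction y using ind with | _ a' b' d' hd'
  simp only [zero_def, mk_mul_mk, mk_lt_mk, zero_mul, mul_one, zero_add, add_zero]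
  intro h h'
  obtain ⟨u, hu, rfl⟩ := exists_pos_add_of_lt' h
  obtain ⟨v, hv, rfl⟩ := exists_pos_add_of_lt' h'
  refine lt_of_lt_of_eq (lt_add_of_pos_right _ (mul_pos hu hv)) ?_
  ring

/-- A number as a fraction. -/
def ofN (a : N) : Frac N := mk a 0 1 one_pos

theorem exists_mul_eq_one {x : Frac N} (hx : x ≠ 0) : ∃ y, x * y = 1 := by
  have key {x : Frac N} (hx : 0 < x) : ∃ y, x * y = 1 := by
    obtain ⟨c, d, h, rfl⟩ := hx.le
    have hc : 0 < c := by
      simpa [zero_def, mk_add_mk, mk_lt_mk] using hx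
    refine ⟨mk d 0 c hc, ?_⟩
    rw [zero_add, mk_mul_mk, one_def, mk_eq]
    ring
  rcases lt_or_gt_of_ne hx with h | h
  · obtain ⟨y, hy⟩ := key (neg_pos.2 h)
    exact ⟨-y, by rw [← hy]; ring⟩
  · exact key h

open Classical in
noncomputable instance : Field (Frac N) where
  inv x := if h : x = 0 then 0 else (exists_mul_eq_one h).choose
  mul_inv_cancel x hx := by
    rw [dif_neg hx]
    exact (exists_mul_eq_one hx).choose_spec
  inv_zero := dif_pos rfl
  nnqsmul := _
  nnqsmul_def := fun _ _ => rfl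
  qsmul := _
  qsmul_def := fun _ _ => rfl

theorem ofN_zero : ofN (0 : N) = 0 := rfl
theorem ofN_one : ofN (1 : N) = 1 := rfl
theorem ofN_add (a b : N) : ofN (a + b) = ofN a + ofN b := by
  simp [ofN, mk_add_mk]
theorem ofN_mul (a b : N) : ofN (a * b) = ofN a * ofN b := by
  simp [ofN, mk_mul_mk]
theorem ofN_le {a b : N} : ofN a ≤ ofN b ↔ a ≤ b := by
  simp [ofN, mk_le_mk]
theorem ofN_lt {a b : N} : ofN a < ofN b ↔ a < b := by
  simp [ofN, mk_lt_mk]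
theorem ofN_inj {a b : N} : ofN a = ofN b ↔ a = b := by
  simp [ofN, mk_eq]
theorem ofN_nonneg (a : N) : 0 ≤ ofN a := by
  rw [← ofN_zero, ofN_le]; exact le_iff_exists_add.2 ⟨a, (zero_add a).symm⟩
theorem ofN_pos {a : N} (h : 0 < a) : 0 < ofN a := by
  rwa [← ofN_zero, ofN_lt]
theorem mk_eq_div (a b d : N) (h : 0 < d) : mk a b d h = (ofN a - ofN b) / ofN d := by
  rw [eq_div_iff (ofN_pos h).ne', sub_eq_add_neg, ofN, ofN, ofN, neg_mk, mk_mul_mk, mk_add_mk,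
    mk_eq]
  ring

end Frac
end Fractions

namespace Model
open Str
variable {M : Model}

instance : OrderedSub M.N where
  tsub_le_iff_right a b c := by
    rcases le_total a b with h | h
    · rw [le_def.1 h]
      exact ⟨fun _ => h.trans le_add_self, fun _ => zero_le⟩
    · obtain ⟨d, rfl⟩ := exists_add_of_le h
      rw [add_sub_self, add_comm c, add_le_add_iff_left]

/-! ### Definable functions and decidable predicates

A function of finitely many numbers is *definable* if an object of the model computes it. The
arguments are given by a sequence of numbers of which only finitely many are used. -/

/-- The type of functions of `k` numbers with values of type `τ`. -/
def pow : ℕ → Ty → Ty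
  | 0, τ => τ
  | k + 1, τ => pow k (nat ⇒ₜ τ)

/-- Application to the first `k` numbers of a sequence; the number `0` is the last argument. -/
def appN : (k : ℕ) → {τ : Ty} → M.D (pow k τ) → (ℕ → M.N) → M.D τ
  | 0, _, f, _ => f
  | k + 1, _, f, r => M.app (appN k f fun i => r (i + 1)) (r 0)

theorem appN_succ (k : ℕ) {τ : Ty} (f : M.D (pow k (nat ⇒ₜ τ))) (r : ℕ → M.N) :
    appN (k + 1) (τ := τ) f r = M.app (appN k f fun i => r (i + 1)) (r 0) := rfl

theorem exists_appN_const (k : ℕ) {τ : Ty} (c : M.D τ) :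
    ∃ f : M.D (pow k τ), ∀ r, appN k f r = c := by
  induction k generalizing τ with
  | zero => exact ⟨c, fun _ => rfl⟩
  | succ k ih =>
    obtain ⟨f, hf⟩ := ih (M.app (M.K _ nat) c)
    exact ⟨f, fun r => (appN_succ k f r).trans (by rw [hf, M.K_app])⟩

/-- Pointwise application; this is the role of the combinator `S`. -/
theorem exists_appN_app (k : ℕ) {σ τ : Ty} (f : M.D (pow k (σ ⇒ₜ τ))) (g : M.D (pow k σ)) :
    ∃ h : M.D (pow k τ), ∀ r, appN k h r = M.app (appN k f r) (appN k g r) := by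
  induction k generalizing σ τ with
  | zero => exact ⟨M.app f g, fun _ => rfl⟩
  | succ k ih =>
    obtain ⟨s, hs⟩ := exists_appN_const k (M.S nat σ τ)
    obtain ⟨h₁, hh₁⟩ := ih s f
    obtain ⟨h₂, hh₂⟩ := ih h₁ g
    exact ⟨h₂, fun r => (appN_succ k h₂ r).trans (by rw [hh₂, hh₁, hs, M.S_app]; rfl)⟩

/-- Functions with a dummy last argument; this is the role of the combinator `K`. -/
theorem exists_appN_succ (k : ℕ) {τ : Ty} (f : M.D (pow k τ)) :
    ∃ g : M.D (pow (k + 1) τ), ∀ r, appN (k + 1) g r = appN k f r := by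
  induction k generalizing τ with
  | zero => exact ⟨M.app (M.K _ nat) f, fun r => M.K_app _ _⟩
  | succ k ih =>
    obtain ⟨g, hg⟩ := ih f
    exact ⟨g, fun r => congrArg (fun h => M.app h (r 0)) (hg fun i => r (i + 1))⟩

theorem exists_appN_le {k l : ℕ} (h : k ≤ l) {τ : Ty} (f : M.D (pow k τ)) :
    ∃ g : M.D (pow l τ), ∀ r, appN l g r = appN k f r := by
  induction l, h using Nat.le_induction with
  | base => exact ⟨f, fun _ => rfl⟩
  | succ l _ ih =>
    obtain ⟨g, hg⟩ := ih
    obtain ⟨g', hg'⟩ := exists_appN_succ l g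
    exact ⟨g', fun r => (hg' r).trans (hg r)⟩

/-- A function of finitely many numbers is definable in the model. -/
def Rep {τ : Ty} (F : (ℕ → M.N) → M.D τ) : Prop :=
  ∃ (k : ℕ) (f : M.D (pow k τ)), ∀ r, F r = appN k f r

/-- The object of the model that computes `F`, if there is one. Otherwise, it is a constant. -/
noncomputable def lamN {τ : Ty} (F : M.N → M.D τ) : M.D (nat ⇒ₜ τ) :=
  open Classical in
  if h : ∃ f : M.D (nat ⇒ₜ τ), ∀ n, M.app f n = F n then h.choose else M.app (M.K _ _) (F 0)

namespace Rep
variable {σ τ : Ty}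

theorem const (c : M.D τ) : Rep fun _ : ℕ → M.N => c := ⟨0, c, fun _ => rfl⟩

theorem app {F : (ℕ → M.N) → M.D (σ ⇒ₜ τ)} {G : (ℕ → M.N) → M.D σ} (hF : Rep F) (hG : Rep G) :
    Rep fun r => M.app (F r) (G r) := by
  obtain ⟨k, f, hf⟩ := hF
  obtain ⟨l, g, hg⟩ := hG
  obtain ⟨f', hf'⟩ := exists_appN_le (le_max_left k l) f
  obtain ⟨g', hg'⟩ := exists_appN_le (le_max_right k l) g
  obtain ⟨h, hh⟩ := exists_appN_app _ f' g'
  exact ⟨_, h, fun r => by simp only [hh, hf', hg', hf, hg]⟩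

theorem tail {F : (ℕ → M.N) → M.D τ} (hF : Rep F) : Rep fun r => F fun i => r (i + 1) := by
  obtain ⟨k, f, hf⟩ := hF
  obtain ⟨g, hg⟩ := exists_appN_const k (M.K τ nat)
  obtain ⟨h, hh⟩ := exists_appN_app k g f
  exact ⟨k + 1, h, fun r => (hf _).trans ((appN_succ k h r).trans (by rw [hh, hg, M.K_app])).symm⟩

theorem var (i : ℕ) : Rep fun r : ℕ → M.N => r i := by
  induction i with
  | zero => exact ⟨1, eval nil (lam v0), fun r => (app_lam nil v0 (r 0)).symm⟩
  | succ i ih => exact ih.tail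

/-- Abstraction of the first argument of a definable function. -/
theorem exists_abs {F : M.N → (ℕ → M.N) → M.D τ} (hF : Rep fun r => F (r 0) fun i => r (i + 1)) :
    ∃ G : (ℕ → M.N) → M.D (nat ⇒ₜ τ), Rep G ∧ ∀ n r, M.app (G r) n = F n r := by
  obtain ⟨k, f, hf⟩ := hF
  obtain ⟨g, hg⟩ := exists_appN_succ k f
  refine ⟨fun r => appN k g r, ⟨k, g, fun r => rfl⟩, fun n r => ?_⟩
  have h := (hf fun i => Nat.casesOn i n r).trans (hg _).symm
  exact h.symm

theorem app_lamN' {F : M.N → (ℕ → M.N) → M.D τ} (hF : Rep fun r => F (r 0) fun i => r (i + 1))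
    (r : ℕ → M.N) (n : M.N) : M.app (Model.lamN fun n => F n r) n = F n r := by
  obtain ⟨G, -, hG⟩ := exists_abs hF
  have h : ∃ f : M.D (nat ⇒ₜ τ), ∀ n, M.app f n = F n r := ⟨G r, fun n => hG n r⟩
  rw [Model.lamN, dif_pos h]
  exact h.choose_spec n

theorem app_lamN {F : M.N → M.D τ} (hF : Rep fun r => F (r 0)) (n : M.N) :
    M.app (Model.lamN F) n = F n :=
  app_lamN' (F := fun n _ => F n) hF (fun _ => 0) n

theorem lamN {F : M.N → (ℕ → M.N) → M.D τ} (hF : Rep fun r => F (r 0) fun i => r (i + 1)) :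
    Rep fun r => Model.lamN fun n => F n r := by
  obtain ⟨G, hG, hG'⟩ := exists_abs hF
  convert hG using 1
  funext r
  exact M.ext fun n => (app_lamN' hF r n).trans (hG' n r).symm

/-- Substitution of definable numbers for the arguments of a definable function. -/
theorem subst {F : (ℕ → M.N) → M.D τ} (hF : Rep F) {s : (ℕ → M.N) → ℕ → M.N}
    (hs : ∀ i, Rep fun r => s r i) : Rep fun r => F (s r) := by
  obtain ⟨k, f, hf⟩ := hF
  simp only [hf]
  clear hf F
  induction k generalizing τ s with
  | zero => exact const f
  | succ k ih => exact app (ih (fun i => hs (i + 1)) f) (hs 0)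

/-- Instantiation of the first argument of a definable function. -/
theorem inst {F : M.N → (ℕ → M.N) → M.D τ} (hF : Rep fun r => F (r 0) fun i => r (i + 1))
    {A : (ℕ → M.N) → M.N} (hA : Rep A) : Rep fun r => F (A r) r :=
  hF.subst (s := fun r i => Nat.casesOn i (A r) r) fun i => by
    cases i with
    | zero => exact hA
    | succ i => exact var i

section Closure
variable {F G H : (ℕ → M.N) → M.N}

/-- Functions given by terms with one numerical variable are definable. -/
theorem term₁ (t : Tm [nat] τ) (hF : Rep F) : Rep fun r => eval (cons (F r) nil) t := by
  have := (const (eval nil (lam t))).app hF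
  simpa only [app_lam] using this

/-- Functions given by terms with two numerical variables are definable. -/
theorem term₂ (t : Tm [nat, nat] τ) (hF : Rep F) (hG : Rep G) :
    Rep fun r => eval (cons (G r) (cons (F r) nil)) t := by
  have := ((const (eval nil (lam (lam t)))).app hF).app hG
  simpa only [app_lam] using this

theorem add (hF : Rep F) (hG : Rep G) : Rep fun r => F r + G r := term₂ (HOArith.add v1 v0) hF hG
theorem mul (hF : Rep F) (hG : Rep G) : Rep fun r => F r * G r := term₂ (HOArith.mul v1 v0) hF hG
theorem sub (hF : Rep F) (hG : Rep G) : Rep fun r => F r - G r := term₂ (HOArith.monus v1 v0) hF hG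
theorem p2 (hF : Rep F) : Rep fun r => Model.p2 (F r) := term₁ (HOArith.pow2 v0) hF
theorem tri (hF : Rep F) : Rep fun r => Model.tri (F r) := by
  simpa using term₁ (HOArith.tri v0) hF
theorem diag (hF : Rep F) : Rep fun r => Model.diag (F r) := by
  simpa using term₁ (HOArith.diag v0) hF

end Closure
end Rep

/-- A predicate of finitely many numbers is decidable: it is the set of zeros of a definable
function. -/
def DecP (P : (ℕ → M.N) → Prop) : Prop :=
  ∃ F : (ℕ → M.N) → M.N, Rep F ∧ ∀ r, P r ↔ F r = 0

namespace DecP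
variable {P Q : (ℕ → M.N) → Prop} {F G : (ℕ → M.N) → M.N}

theorem congr (hP : DecP P) (h : ∀ r, Q r ↔ P r) : DecP Q := by
  obtain ⟨F, hF, hF'⟩ := hP
  exact ⟨F, hF, fun r => (h r).trans (hF' r)⟩

theorem le (hF : Rep F) (hG : Rep G) : DecP fun r => F r ≤ G r :=
  ⟨_, hF.sub hG, fun _ => le_def⟩

theorem false : DecP fun _ : ℕ → M.N => False := ⟨_, .const 1, fun _ => by simp⟩

theorem imp (hP : DecP P) (hQ : DecP Q) : DecP fun r => P r → Q r := by
  obtain ⟨F, hF, hF'⟩ := hP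
  obtain ⟨G, hG, hG'⟩ := hQ
  refine ⟨_, ((Rep.const 1).sub hF).mul hG, fun r => ?_⟩
  simp only [hF', hG', mul_eq_zero, tsub_eq_zero_iff_le]
  rw [← zero_add (1 : M.N), ← lt_iff_succ_le, pos_iff_ne_zero]
  tauto

theorem not (hP : DecP P) : DecP fun r => ¬ P r := hP.imp false
theorem or (hP : DecP P) (hQ : DecP Q) : DecP fun r => P r ∨ Q r :=
  (hP.not.imp hQ).congr fun r => by tauto
theorem and (hP : DecP P) (hQ : DecP Q) : DecP fun r => P r ∧ Q r :=
  (hP.imp hQ.not).not.congr fun r => by tauto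
theorem eq (hF : Rep F) (hG : Rep G) : DecP fun r => F r = G r :=
  ((le hF hG).and (le hG hF)).congr fun _ => le_antisymm_iff
theorem lt (hF : Rep F) (hG : Rep G) : DecP fun r => F r < G r :=
  (le hG hF).not.congr fun _ => not_le.symm

theorem subst (hP : DecP P) {s : (ℕ → M.N) → ℕ → M.N} (hs : ∀ i, Rep fun r => s r i) :
    DecP fun r => P (s r) := by
  obtain ⟨F, hF, hF'⟩ := hP
  exact ⟨_, hF.subst hs, fun r => hF' _⟩

end DecP

/-- Induction for decidable predicates: these are defined by quantifier-free formulas `f n = 0` with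
a parameter `f`. -/
theorem DecP.induct {P : M.N → Prop} (hP : DecP fun r => P (r 0)) (h0 : P 0)
    (hs : ∀ n, P n → P (n + 1)) (n : M.N) : P n := by
  obtain ⟨F, hF, hF'⟩ := hP
  have key (n : M.N) : P n ↔ M.app (lamN fun n => F fun _ => n) n = 0 := by
    rw [Rep.app_lamN (hF.subst fun _ => .var 0)]
    exact hF' fun _ => n
  refine indFm (v1 ⬝ₜ v0 =ₒ .zero) (by simp [Fm.IsQF]) (cons (lamN fun n => F fun _ => n) nil)
    (fun n => ?_) h0 (fun n hn => suc_eq n ▸ hs n hn) n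
  simp [key]

/-- The least number principle for decidable predicates. -/
theorem DecP.exists_least {P : M.N → Prop} (hP : DecP fun r => P (r 0)) {n : M.N} (hn : P n) :
    P 0 ∨ ∃ m, m < n ∧ ¬ P m ∧ P (m + 1) := by
  by_contra! h
  have : ∀ m, m ≤ n → ¬ P m := by
    refine DecP.induct (((DecP.le (.var 0) (.const n)).imp hP.not)) (fun _ => h.1) ?_
    exact fun m hm hmn hP => h.2 m (lt_iff_succ_le.2 hmn) (hm (le_self_add.trans hmn)) hP
  exact this n le_rfl hn

/-- Primitive recursion with parameters. As the recursor only defines numbers, the parameters are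
passed to its arguments. -/
theorem exists_rep_rec {B : (ℕ → M.N) → M.N} {C : M.N → M.N → (ℕ → M.N) → M.N} (hB : Rep B)
    (hC : Rep fun r => C (r 0) (r 1) fun i => r (i + 2)) :
    ∃ H : M.N → (ℕ → M.N) → M.N, (∀ r, H 0 r = B r) ∧
      (∀ n r, H (n + 1) r = C n (H n r) r) ∧ Rep fun r => H (r 0) fun i => r (i + 1) := by
  have h₁ : Rep fun r => lamN fun n => C n (r 0) fun i => r (i + 1) :=
    Rep.lamN (F := fun n r => C n (r 0) fun i => r (i + 1)) hC
  have h₂ : Rep fun r => lamN fun u => lamN fun n => C n u r :=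
    Rep.lamN (F := fun u r => lamN fun n => C n u r) h₁
  refine ⟨fun n r => M.app (M.app (M.app M.R n) (B r)) (lamN fun u => lamN fun n => C n u r),
    fun r => M.R_zero _ _, fun n r => ?_,
    (((Rep.const M.R).app (.var 0)).app hB.tail).app h₂.tail⟩
  simp only [← suc_eq, app_R_suc]
  rw [Rep.app_lamN' (F := fun u r => lamN fun n => C n u r) h₁]
  exact Rep.app_lamN' (F := fun n r => C n (r 0) fun i => r (i + 1)) hC
    (fun i => Nat.casesOn i _ r) n

/-- Decidable predicates are closed under bounded quantification, because a sum of numbers vanishes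
if and only if its terms do. -/
theorem DecP.forall_lt {P : M.N → (ℕ → M.N) → Prop} (hP : DecP fun r => P (r 0) fun i => r (i + 1))
    {A : (ℕ → M.N) → M.N} (hA : Rep A) : DecP fun r => ∀ n, n < A r → P n r := by
  obtain ⟨F, hF, hF'⟩ := hP
  have hF'' (n : M.N) (r) : P n r ↔ F (fun i => Nat.casesOn i n r) = 0 := hF' fun i =>
    Nat.casesOn i n r
  have hs (i : ℕ) : Rep fun r : ℕ → M.N => (Nat.casesOn i (r 0) fun j => r (j + 2) : M.N) := by
    cases i with
    | zero => exact .var 0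
    | succ i => exact .var (i + 2)
  obtain ⟨H, h0, hs, hH⟩ := exists_rep_rec (B := fun _ => 0)
    (C := fun n u r => u + F fun i => Nat.casesOn i n r) (.const 0) ((Rep.var 1).add (hF.subst hs))
  refine ⟨_, hH.inst hA, fun r => ?_⟩
  simp only [hF'']
  have hr (n : M.N) : (∀ i < n, F (fun j => Nat.casesOn j i r) = 0) ↔ H n r = 0 := by
    constructor
    · intro h
      suffices ∀ m, m ≤ n → H m r = 0 from this n le_rfl
      refine DecP.induct ((le (.var 0) (.const n)).imp (eq ?_ (.const 0))) (fun _ => h0 r) ?_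
      · exact hH.subst (s := fun ρ i => Nat.casesOn i (ρ 0) r) fun i => by
          cases i with
          | zero => exact .var 0
          | succ i => exact .const _
      · intro m hm hmn
        rw [hs, hm (le_self_add.trans hmn), h m (lt_iff_succ_le.2 hmn), add_zero]
    · intro h i
      revert h
      refine DecP.induct (P := fun n => H n r = 0 → i < n → F (fun j => Nat.casesOn j i r) = 0)
        ((eq ?_ (.const 0)).imp ((lt (.const i) (.var 0)).imp (eq (.const _) (.const 0)))) ?_ ?_ n
      · exact hH.subst (s := fun ρ i => Nat.casesOn i (ρ 0) r) fun i => by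
          cases i with
          | zero => exact .var 0
          | succ i => exact .const _
      · intro _ h; exact (not_lt_zero h).elim
      · intro m hm h hi
        rw [hs, add_eq_zero] at h
        rcases (lt_succ_iff'.1 hi).lt_or_eq with hi | rfl
        · exact hm h.1 hi
        · exact h.2
  exact hr (A r)

theorem DecP.exists_lt {P : M.N → (ℕ → M.N) → Prop} (hP : DecP fun r => P (r 0) fun i => r (i + 1))
    {A : (ℕ → M.N) → M.N} (hA : Rep A) : DecP fun r => ∃ n, n < A r ∧ P n r :=
  (DecP.forall_lt (P := fun n r => ¬ P n r) hP.not hA).not.congr fun r => by push Not; rfl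

open Classical in
/-- Definition by cases. -/
theorem Rep.ite {P : (ℕ → M.N) → Prop} (hP : DecP P) {F G : (ℕ → M.N) → M.N} (hF : Rep F)
    (hG : Rep G) : Rep fun r => if P r then F r else G r := by
  obtain ⟨A, hA, hA'⟩ := hP
  have := (((const 1).sub hA).mul hF).add (((const 1).sub ((const 1).sub hA)).mul hG)
  convert this using 1
  funext r
  split_ifs with h
  · rw [(hA' r).1 h]; simp
  · have h' : 1 - A r = 0 := by
      rw [tsub_eq_zero_iff_le, ← zero_add (1 : M.N), ← lt_iff_succ_le, pos_iff_ne_zero]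
      exact fun h' => h ((hA' r).2 h')
    rw [h']; simp

/-! ### Pairing -/

theorem tri_succ (a : M.N) : tri (a + 1) = tri a + (a + 1) := by
  rw [← suc_eq, tri_suc]

theorem tri_mono : Monotone (tri : M.N → M.N) := by
  have (a b : M.N) : tri a ≤ tri (a + b) := by
    refine DecP.induct (P := fun b => tri a ≤ tri (a + b))
      (.le (.const _) (.tri ((Rep.const a).add (.var 0)))) (by simp) ?_ b
    intro n hn
    rw [← add_assoc, tri_succ]
    exact hn.trans le_self_add
  intro a b h
  obtain ⟨c, rfl⟩ := exists_add_of_le h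
  exact this a c

/-- `diag s` is the index of the greatest triangular number that is at most `s`. -/
theorem diag_spec (s : M.N) : tri (diag s) ≤ s ∧ s < tri (diag s + 1) := by
  refine DecP.induct (P := fun s => tri (diag s) ≤ s ∧ s < tri (diag s + 1))
    ((DecP.le (.tri (.diag (.var 0))) (.var 0)).and
      (.lt (.var 0) (.tri ((Rep.diag (.var 0)).add (.const 1))))) ?_ ?_ s
  · rw [diag_zero, tri_zero, tri_succ, tri_zero]; simp
  · rintro n ⟨h₁, h₂⟩
    have hd := diag_suc n
    simp only [suc_eq] at hd
    rcases (lt_iff_succ_le.1 h₂).lt_or_eq with h | h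
    · have : diag (n + 1) = diag n := by
        obtain ⟨c, hc⟩ := exists_add_of_le (lt_iff_succ_le.1 h)
        rw [hd, hc, add_assoc (n + 1), add_tsub_cancel_left, add_comm 1 c,
          tsub_eq_zero_of_le le_add_self, add_zero]
      rw [this]
      exact ⟨h₁.trans le_self_add, h⟩
    · have : diag (n + 1) = diag n + 1 := by
        rw [hd, h, tsub_self, tsub_zero]
      rw [this, tri_succ (_ + 1), ← h]
      exact ⟨le_rfl, lt_add_of_pos_right _ (by positivity)⟩

/-- Cantor's pairing. -/
def pair (a b : M.N) : M.N := tri (a + b) + b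
/-- Second component of a coded pair. -/
def snd (a : M.N) : M.N := a - tri (diag a)
/-- First component of a coded pair. -/
def fst (a : M.N) : M.N := diag a - snd a

theorem diag_pair (a b : M.N) : diag (pair a b) = a + b := by
  obtain ⟨h₁, h₂⟩ := diag_spec (pair a b)
  apply le_antisymm
  · by_contra! h
    have := (tri_mono (lt_iff_succ_le.1 h)).trans h₁
    rw [tri_succ, pair, add_le_add_iff_left, ← lt_iff_succ_le] at this
    exact absurd le_add_self this.not_ge
  · by_contra! h
    have := h₂.trans_le (tri_mono (lt_iff_succ_le.1 h))
    rw [pair] at this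
    exact absurd le_self_add this.not_ge

@[simp] theorem snd_pair (a b : M.N) : snd (pair a b) = b := by
  rw [snd, diag_pair, pair, add_tsub_cancel_left]

@[simp] theorem fst_pair (a b : M.N) : fst (pair a b) = a := by
  rw [fst, diag_pair, snd_pair, add_tsub_cancel_right]

@[simp] theorem eval_pair {Γ : List Ty} (e : M.Env Γ) (s t : Tm Γ nat) :
    eval e (HOArith.pair s t) = pair (eval e s) (eval e t) := by
  simp [HOArith.pair, pair]
@[simp] theorem eval_snd {Γ : List Ty} (e : M.Env Γ) (s : Tm Γ nat) :
    eval e (HOArith.snd s) = snd (eval e s) := by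
  simp [HOArith.snd, snd]
@[simp] theorem eval_fst {Γ : List Ty} (e : M.Env Γ) (s : Tm Γ nat) :
    eval e (HOArith.fst s) = fst (eval e s) := by
  simp [HOArith.fst, fst]

namespace Rep
variable {F G : (ℕ → M.N) → M.N}
theorem pair (hF : Rep F) (hG : Rep G) : Rep fun r => Model.pair (F r) (G r) :=
  (hF.add hG).tri.add hG
theorem snd (hF : Rep F) : Rep fun r => Model.snd (F r) := hF.sub hF.diag.tri
theorem fst (hF : Rep F) : Rep fun r => Model.fst (F r) := hF.diag.sub hF.snd
end Rep

/-! ### Rational numbers of a model -/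

variable (M) in
/-- The rational numbers of a model. -/
abbrev Q : Type := Frac M.N

open Frac (ofN)

theorem succ_pos' (a : M.N) : 0 < a + 1 := lt_succ_iff'.2 zero_le

theorem pred_add_one {a : M.N} (h : 0 < a) : pred a + 1 = a :=
  ((eq_zero_or_eq_succ a).resolve_left h.ne').symm

/-- The rational number with a given code. -/
noncomputable def val (c : M.N) : M.Q :=
  Frac.mk (fst (fst c)) (snd (fst c)) (snd c + 1) (succ_pos' _)

theorem val_pair (a b : M.N) {d : M.N} (h : 0 < d) :
    val (pair (pair a b) (pred d)) = Frac.mk a b d h := by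
  simp only [val, fst_pair, snd_pair, pred_add_one h]

theorem exists_val (x : M.Q) : ∃ c, val c = x := by
  induction x using Frac.ind with | _ a b d h
  exact ⟨_, val_pair a b h⟩

/-- A rational-valued function of finitely many numbers is definable: its values have codes that are
given by a definable function. -/
def RepQ (F : (ℕ → M.N) → M.Q) : Prop := ∃ G : (ℕ → M.N) → M.N, Rep G ∧ ∀ r, F r = val (G r)

theorem Rep.val {F : (ℕ → M.N) → M.N} (hF : Rep F) : RepQ fun r => Model.val (F r) :=
  ⟨F, hF, fun _ => rfl⟩

theorem RepQ.mk {A B C : (ℕ → M.N) → M.N} (hA : Rep A) (hB : Rep B) (hC : Rep C)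
    (h : ∀ r, 0 < C r) : RepQ fun r => Frac.mk (A r) (B r) (C r) (h r) :=
  ⟨_, (hA.pair hB).pair (Rep.term₁ (HOArith.pred v0) hC), fun r => (val_pair _ _ (h r)).symm⟩

namespace RepQ
variable {F G : (ℕ → M.N) → M.Q}

theorem const (x : M.Q) : RepQ fun _ : ℕ → M.N => x := by
  obtain ⟨c, rfl⟩ := exists_val x
  exact (Rep.const c).val

theorem add (hF : RepQ F) (hG : RepQ G) : RepQ fun r => F r + G r := by
  obtain ⟨A, hA, hA'⟩ := hF
  obtain ⟨B, hB, hB'⟩ := hG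
  simp only [hA', hB', val, Frac.mk_add_mk]
  have hA₃ := hA.snd.add (.const 1)
  have hB₃ := hB.snd.add (.const 1)
  exact .mk ((hA.fst.fst.mul hB₃).add (hB.fst.fst.mul hA₃))
    ((hA.fst.snd.mul hB₃).add (hB.fst.snd.mul hA₃)) (hA₃.mul hB₃) _

theorem neg (hF : RepQ F) : RepQ fun r => -F r := by
  obtain ⟨A, hA, hA'⟩ := hF
  simp only [hA', val, Frac.neg_mk]
  exact .mk hA.fst.snd hA.fst.fst (hA.snd.add (.const 1)) _

theorem sub (hF : RepQ F) (hG : RepQ G) : RepQ fun r => F r - G r := by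
  simpa only [sub_eq_add_neg] using hF.add hG.neg

theorem mul (hF : RepQ F) (hG : RepQ G) : RepQ fun r => F r * G r := by
  obtain ⟨A, hA, hA'⟩ := hF
  obtain ⟨B, hB, hB'⟩ := hG
  simp only [hA', hB', val, Frac.mk_mul_mk]
  have hA₃ := hA.snd.add (.const 1)
  have hB₃ := hB.snd.add (.const 1)
  exact .mk ((hA.fst.fst.mul hB.fst.fst).add (hA.fst.snd.mul hB.fst.snd))
    ((hA.fst.fst.mul hB.fst.snd).add (hA.fst.snd.mul hB.fst.fst)) (hA₃.mul hB₃) _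

theorem ofN {A : (ℕ → M.N) → M.N} (hA : Rep A) : RepQ fun r => Frac.ofN (A r) :=
  .mk hA (.const 0) (.const 1) fun _ => one_pos

theorem subst (hF : RepQ F) {s : (ℕ → M.N) → ℕ → M.N} (hs : ∀ i, Rep fun r => s r i) :
    RepQ fun r => F (s r) := by
  obtain ⟨A, hA, hA'⟩ := hF
  exact ⟨_, hA.subst hs, fun r => hA' _⟩

theorem inst {F : M.N → (ℕ → M.N) → M.Q} (hF : RepQ fun r => F (r 0) fun i => r (i + 1))
    {A : (ℕ → M.N) → M.N} (hA : Rep A) : RepQ fun r => F (A r) r :=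
  hF.subst (s := fun r i => Nat.casesOn i (A r) r) fun i => by
    cases i with
    | zero => exact hA
    | succ i => exact .var i

/-- Fixing the parameters of a definable function. -/
theorem fix {F : M.N → (ℕ → M.N) → M.Q} (hF : RepQ fun r => F (r 0) fun i => r (i + 1))
    (e : ℕ → M.N) : RepQ fun r => F (r 0) e :=
  hF.subst (s := fun r i => Nat.casesOn i (r 0) e) fun i => by
    cases i with
    | zero => exact .var 0
    | succ i => exact .const _

open Classical in
theorem ite {P : (ℕ → M.N) → Prop} (hP : DecP P) (hF : RepQ F) (hG : RepQ G) :
    RepQ fun r => if P r then F r else G r := by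
  obtain ⟨A, hA, hA'⟩ := hF
  obtain ⟨B, hB, hB'⟩ := hG
  refine ⟨_, Rep.ite hP hA hB, fun r => ?_⟩
  beta_reduce
  split_ifs
  · exact hA' r
  · exact hB' r

end RepQ

theorem DecP.leQ {F G : (ℕ → M.N) → M.Q} (hF : RepQ F) (hG : RepQ G) :
    DecP fun r => F r ≤ G r := by
  obtain ⟨A, hA, hA'⟩ := hF
  obtain ⟨B, hB, hB'⟩ := hG
  simp only [hA', hB', val, Frac.mk_le_mk]
  have hA₃ := hA.snd.add (.const 1)
  have hB₃ := hB.snd.add (.const 1)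
  exact .le ((hA.fst.fst.mul hB₃).add (hB.fst.snd.mul hA₃))
    ((hB.fst.fst.mul hA₃).add (hA.fst.snd.mul hB₃))

theorem DecP.ltQ {F G : (ℕ → M.N) → M.Q} (hF : RepQ F) (hG : RepQ G) : DecP fun r => F r < G r :=
  (leQ hG hF).not.congr fun _ => not_le.symm

theorem DecP.eqQ {F G : (ℕ → M.N) → M.Q} (hF : RepQ F) (hG : RepQ G) : DecP fun r => F r = G r :=
  ((leQ hF hG).and (leQ hG hF)).congr fun _ => le_antisymm_iff

/-! ### Powers of two -/

theorem p2_zero : p2 (0 : M.N) = 1 := p2_zero'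
theorem p2_succ (a : M.N) : p2 (a + 1) = p2 a + p2 a := by rw [← suc_eq, p2_suc]
theorem p2_pos (a : M.N) : 0 < p2 a := by
  refine DecP.induct (P := fun a => 0 < p2 a) (.lt (.const 0) (.p2 (.var 0))) ?_ ?_ a
  · rw [p2_zero]; exact one_pos
  · intro n hn; rw [p2_succ]; exact add_pos hn hn
theorem p2_add (a b : M.N) : p2 (a + b) = p2 a * p2 b := by
  refine DecP.induct (P := fun b => p2 (a + b) = p2 a * p2 b)
    (.eq (.p2 ((Rep.const a).add (.var 0))) ((Rep.const _).mul (.p2 (.var 0)))) ?_ ?_ b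
  · simp [p2_zero]
  · intro n hn; rw [← add_assoc, p2_succ, hn, p2_succ, mul_add]
theorem lt_p2 (a : M.N) : a < p2 a := by
  refine DecP.induct (P := fun a => a < p2 a) (.lt (.var 0) (.p2 (.var 0))) ?_ ?_ a
  · exact p2_pos 0
  · intro n hn
    rw [p2_succ]
    exact add_lt_add_of_lt_of_le hn (by simpa using lt_iff_succ_le.1 (p2_pos n))
theorem p2_mono : Monotone (p2 : M.N → M.N) := by
  intro a b h
  obtain ⟨c, rfl⟩ := exists_add_of_le h
  rw [p2_add]
  exact le_mul_of_one_le_right zero_le (by simpa using lt_iff_succ_le.1 (p2_pos c))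

/-- The rational number `2^(-n)`. -/
noncomputable def hp (n : M.N) : M.Q := (ofN (p2 n))⁻¹

theorem hp_pos (n : M.N) : 0 < hp n := inv_pos.2 (Frac.ofN_pos (p2_pos n))
theorem hp_eq_mk (n : M.N) : hp n = Frac.mk 1 0 (p2 n) (p2_pos n) := by
  rw [Frac.mk_eq_div, Frac.ofN_one, Frac.ofN_zero, sub_zero, one_div, hp]
theorem hp_zero : hp (0 : M.N) = 1 := by rw [hp, p2_zero, Frac.ofN_one, inv_one]
theorem hp_add (a b : M.N) : hp (a + b) = hp a * hp b := by
  rw [hp, p2_add, Frac.ofN_mul, mul_inv, hp, hp]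
theorem hp_succ (n : M.N) : hp (n + 1) = hp n / 2 := by
  rw [hp, p2_succ, Frac.ofN_add, ← two_mul, mul_inv, hp]; ring
theorem hp_anti {a b : M.N} (h : a ≤ b) : hp b ≤ hp a :=
  inv_anti₀ (Frac.ofN_pos (p2_pos a)) (Frac.ofN_le.2 (p2_mono h))
theorem p2_mul_hp (n : M.N) : ofN (p2 n) * hp n = 1 :=
  mul_inv_cancel₀ (Frac.ofN_pos (p2_pos n)).ne'

theorem RepQ.hp {A : (ℕ → M.N) → M.N} (hA : Rep A) : RepQ fun r => Model.hp (A r) := by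
  simp only [hp_eq_mk]
  exact .mk (.const 1) (.const 0) hA.p2 _

/-- Archimedean property. -/
theorem exists_hp_lt {x : M.Q} (hx : 0 < x) : ∃ n, hp n < x := by
  induction x using Frac.ind with | _ a b d hd
  refine ⟨d, ?_⟩
  rw [Frac.zero_def, Frac.mk_lt_mk] at hx
  rw [hp_eq_mk, Frac.mk_lt_mk]
  simp only [zero_mul, mul_one, zero_add, one_mul, add_zero] at hx ⊢
  have h1 := lt_iff_succ_le.1 hx
  calc d + b * p2 d < p2 d + b * p2 d := by simpa using lt_p2 d
    _ = (b + 1) * p2 d := by ring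
    _ ≤ a * p2 d := by gcongr

/-! ### Sums -/

/-- Sums are defined by recursion on codes of rational numbers. -/
theorem exists_sum {F : M.N → (ℕ → M.N) → M.Q} (hF : RepQ fun r => F (r 0) fun i => r (i + 1)) :
    ∃ S : M.N → (ℕ → M.N) → M.Q, (∀ r, S 0 r = 0) ∧ (∀ n r, S (n + 1) r = S n r + F n r) ∧
      RepQ fun r => S (r 0) fun i => r (i + 1) := by
  have h₁ : RepQ fun r => Model.val (r 1) + F (r 0) fun i => r (i + 2) :=
    (Rep.var 1).val.add (hF.subst (s := fun r i => Nat.casesOn i (r 0) fun i => r (i + 2))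
      fun i => by
        cases i with
        | zero => exact .var 0
        | succ i => exact .var (i + 2))
  obtain ⟨C, hC, hC'⟩ := h₁
  obtain ⟨c, hc⟩ := exists_val (0 : M.Q)
  obtain ⟨H, h0, hs, hH⟩ := exists_rep_rec (B := fun _ => c)
    (C := fun n u r => C fun i => Nat.casesOn i n fun i => Nat.casesOn i u r) (.const c)
    (hC.subst fun i => by
      rcases i with _ | _ | i
      · exact .var 0
      · exact .var 1
      · exact .var (i + 2))
  refine ⟨fun n r => val (H n r), fun r => by beta_reduce; rw [h0, hc], fun n r => ?_, hH.val⟩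
  beta_reduce
  rw [hs, ← hC']
  rfl

open Classical in
/-- The sum of the first `n` values of a definable function; it is `0` if `f` is not definable. The
sum is taken in the model, over all numbers below the possibly nonstandard number `n`. -/
noncomputable def isum (f : M.N → M.Q) : M.N → M.Q :=
  if h : ∃ S : M.N → M.Q, (RepQ fun r => S (r 0)) ∧ S 0 = 0 ∧ ∀ n, S (n + 1) = S n + f n then
    h.choose else 0

theorem isum_spec {f : M.N → M.Q} (hf : RepQ fun r => f (r 0)) :
    (RepQ fun r => isum f (r 0)) ∧ isum f 0 = 0 ∧ ∀ n, isum f (n + 1) = isum f n + f n := by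
  have h : ∃ S : M.N → M.Q, (RepQ fun r => S (r 0)) ∧ S 0 = 0 ∧ ∀ n, S (n + 1) = S n + f n := by
    obtain ⟨S, h0, hs, hS⟩ := exists_sum (F := fun n _ => f n) hf
    exact ⟨fun n => S n fun _ => 0, hS.fix _, h0 _, fun n => hs n _⟩
  rw [isum, dif_pos h]
  exact h.choose_spec

theorem isum_zero {f : M.N → M.Q} (hf : RepQ fun r => f (r 0)) : isum f 0 = 0 := (isum_spec hf).2.1
theorem isum_succ {f : M.N → M.Q} (hf : RepQ fun r => f (r 0)) (n : M.N) :
    isum f (n + 1) = isum f n + f n := (isum_spec hf).2.2 n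

theorem isum_eq {f S : M.N → M.Q} (hf : RepQ fun r => f (r 0)) (hS : RepQ fun r => S (r 0))
    (h0 : S 0 = 0) (hs : ∀ n, S (n + 1) = S n + f n) (n : M.N) : isum f n = S n := by
  refine DecP.induct (P := fun n => isum f n = S n) (.eqQ (isum_spec hf).1 hS) ?_ ?_ n
  · rw [isum_zero hf, h0]
  · intro n hn; rw [isum_succ hf, hs, hn]

theorem RepQ.isum {F : M.N → (ℕ → M.N) → M.Q} (hF : RepQ fun r => F (r 0) fun i => r (i + 1))
    {A : (ℕ → M.N) → M.N} (hA : Rep A) : RepQ fun r => Model.isum (fun n => F n r) (A r) := by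
  obtain ⟨S, h0, hs, hS⟩ := exists_sum hF
  convert hS.inst hA using 1
  funext r
  exact isum_eq (f := fun n => F n r) (S := fun n => S n r) (hF.fix r) (hS.fix r) (h0 r)
    (fun n => hs n r) _

theorem isum_const (c : M.Q) (n : M.N) : isum (fun _ => c) n = ofN n * c := by
  refine isum_eq (S := fun n => ofN n * c) (.const c) ((RepQ.ofN (.var 0)).mul (.const c)) ?_ ?_ n
  · rw [Frac.ofN_zero, zero_mul]
  · intro n; rw [Frac.ofN_add, Frac.ofN_one]; ring

open Classical in
/-- The number of `s < n` with `P s`, for decidable `P`, as a rational number. -/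
noncomputable def count (P : M.N → Prop) (n : M.N) : M.Q := isum (fun s => if P s then 1 else 0) n

section Count
variable {P : M.N → Prop} (hP : DecP fun r => P (r 0))

theorem RepQ.count {P : M.N → (ℕ → M.N) → Prop} (hP : DecP fun r => P (r 0) fun i => r (i + 1))
    {A : (ℕ → M.N) → M.N} (hA : Rep A) : RepQ fun r => Model.count (fun n => P n r) (A r) := by
  classical
  exact RepQ.isum (F := fun n r => if P n r then 1 else 0) (.ite hP (.const 1) (.const 0)) hA

include hP

open Classical in
theorem repQ_indicator : RepQ fun r => if P (r 0) then (1 : M.Q) else 0 :=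
  .ite hP (.const 1) (.const 0)

theorem count_zero : count P 0 = 0 := isum_zero (repQ_indicator hP)

theorem count_succ_of_pos {n : M.N} (h : P n) : count P (n + 1) = count P n + 1 := by
  rw [count, isum_succ (repQ_indicator hP), if_pos h]; rfl

theorem count_succ_of_neg {n : M.N} (h : ¬ P n) : count P (n + 1) = count P n := by
  rw [count, isum_succ (repQ_indicator hP), if_neg h, add_zero]; rfl

/-- At most `b - a` of the intervals `[s, s + 1]` are contained in `[a, b]`. -/
theorem count_le_sub {a b : M.Q} (hab : a ≤ b) (h : ∀ s, P s → a ≤ ofN s ∧ ofN s + 1 ≤ b)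
    (n : M.N) : count P n ≤ b - a := by
  have hc : RepQ fun r => count P (r 0) := (isum_spec (repQ_indicator hP)).1
  -- The second clause is what makes the induction work: the intervals that have been counted lie
  -- in `[a, n]`.
  refine (DecP.induct (P := fun n => count P n ≤ b - a ∧ (count P n ≤ 0 ∨ count P n ≤ ofN n - a))
    ((DecP.leQ hc (.const _)).and ((DecP.leQ hc (.const _)).or
      (.leQ hc (.sub (.ofN (.var 0)) (.const a))))) ?_ ?_ n).1
  · rw [count_zero hP]
    exact ⟨sub_nonneg.2 hab, .inl le_rfl⟩
  · rintro n ⟨h₁, h₂⟩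
    by_cases hn : P n
    · obtain ⟨h₃, h₄⟩ := h n hn
      have h₅ : count P n ≤ ofN n - a := by
        rcases h₂ with h₂ | h₂ <;> linarith
      rw [count_succ_of_pos hP hn, Frac.ofN_add, Frac.ofN_one]
      exact ⟨by linarith, .inr (by linarith)⟩
    · rw [count_succ_of_neg hP hn, Frac.ofN_add, Frac.ofN_one]
      exact ⟨h₁, h₂.imp id fun h₂ => by linarith⟩

end Count

/-! ### The meaning of the formulas about rational and real numbers -/

/-- The value of an expression for a rational number, if the denominator is positive. -/
noncomputable def ratVal {Γ : List Ty} (e : M.Env Γ) (q : RatTm Γ) : M.Q :=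
  (ofN (eval e q.pos) - ofN (eval e q.neg)) / ofN (eval e q.den)

section RatTm
variable {Γ : List Ty} (e : M.Env Γ)

theorem val_eq_div (c : M.N) :
    val c = (ofN (fst (fst c)) - ofN (snd (fst c))) / ofN (snd c + 1) := by
  rw [val, Frac.mk_eq_div]

@[simp] theorem sat_le (s t : Tm Γ nat) : Sat (HOArith.le s t) e ↔ eval e s ≤ eval e t := by
  simp [HOArith.le, le_def]
@[simp] theorem sat_lt (s t : Tm Γ nat) : Sat (HOArith.lt s t) e ↔ eval e s < eval e t := by
  simp [HOArith.lt, lt_iff_succ_le, suc_eq]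

@[simp] theorem den_dec (c : Tm Γ nat) : 0 < eval e (dec c).den := by
  simp only [dec, eval_suc, suc_eq]; exact succ_pos' _
@[simp] theorem den_ofNat (s : Tm Γ nat) : 0 < eval e (RatTm.ofNat s).den := one_pos
@[simp] theorem den_halfPow (s : Tm Γ nat) : 0 < eval e (RatTm.halfPow s).den := p2_pos _
@[simp] theorem den_twoHalfPow (s : Tm Γ nat) : 0 < eval e (RatTm.twoHalfPow s).den := p2_pos _

variable {q r : RatTm Γ} (hq : 0 < eval e q.den) (hr : 0 < eval e r.den)

@[simp] theorem ratVal_dec (c : Tm Γ nat) : ratVal e (dec c) = val (eval e c) := by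
  rw [val_eq_div]
  simp [ratVal, dec, suc_eq]
@[simp] theorem ratVal_ofNat (s : Tm Γ nat) : ratVal e (.ofNat s) = ofN (eval e s) := by
  simp [ratVal, RatTm.ofNat, Frac.ofN_zero, Frac.ofN_one]
@[simp] theorem ratVal_halfPow (s : Tm Γ nat) : ratVal e (.halfPow s) = hp (eval e s) := by
  simp [ratVal, RatTm.halfPow, Frac.ofN_zero, Frac.ofN_one, hp]
@[simp] theorem ratVal_twoHalfPow (s : Tm Γ nat) :
    ratVal e (.twoHalfPow s) = 2 * hp (eval e s) := by
  simp only [ratVal, RatTm.twoHalfPow, eval_num2, eval_zero, zero_def, eval_pow2, suc_eq,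
    Frac.ofN_add, Frac.ofN_one, Frac.ofN_zero, hp]
  ring

include hq

theorem val_enc : val (eval e (enc q)) = ratVal e q := by
  simp only [enc, eval_pair, eval_pred, val_pair _ _ hq, Frac.mk_eq_div, ratVal]

include hr

@[simp] theorem den_add : 0 < eval e (q.add r).den := by
  simpa [RatTm.add] using mul_pos hq hr
@[simp] theorem den_sub : 0 < eval e (q.sub r).den := by
  simpa [RatTm.add, RatTm.sub, RatTm.opp] using mul_pos hq hr

@[simp] theorem ratVal_add : ratVal e (q.add r) = ratVal e q + ratVal e r := by
  have h₁ := (Frac.ofN_pos hq).ne'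
  have h₂ := (Frac.ofN_pos hr).ne'
  simp only [ratVal, RatTm.add, eval_add, eval_mul, Frac.ofN_add, Frac.ofN_mul]
  field_simp
  ring
@[simp] theorem ratVal_sub : ratVal e (q.sub r) = ratVal e q - ratVal e r := by
  rw [RatTm.sub, ratVal_add e hq (r := r.opp) hr]
  simp only [ratVal, RatTm.opp]
  ring

@[simp] theorem sat_ratLt : Sat (q.lt r) e ↔ ratVal e q < ratVal e r := by
  rw [ratVal, ratVal, ← Frac.mk_eq_div _ _ _ hq, ← Frac.mk_eq_div _ _ _ hr, Frac.mk_lt_mk]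
  simp [RatTm.lt]
@[simp] theorem sat_ratLe : Sat (q.le r) e ↔ ratVal e q ≤ ratVal e r := by
  rw [ratVal, ratVal, ← Frac.mk_eq_div _ _ _ hq, ← Frac.mk_eq_div _ _ _ hr, Frac.mk_le_mk]
  simp [RatTm.le]

end RatTm

/-- The `n`-th approximation of a real number. -/
noncomputable def ap (x : M.D one) (n : M.N) : M.Q := val (M.app x n)

/-- `x` is a real number. -/
def IsReal (x : M.D one) : Prop :=
  ∀ n i, ap x n - ap x (n + i) < hp n ∧ ap x (n + i) - ap x n < hp n

/-- Equality of real numbers. -/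
def REq (x y : M.D one) : Prop := ∀ n, ap x n - ap y n ≤ 2 * hp n ∧ ap y n - ap x n ≤ 2 * hp n

/-- Strict order of real numbers. -/
def RLt (x y : M.D one) : Prop := ∃ n, 2 * hp n < ap y n - ap x n

/-- `q < x` for a rational number `q` and a real number `x`. -/
def GtQ (q : M.Q) (x : M.D one) : Prop := ∃ n, 2 * hp n < ap x n - q

/-- `x < q` for a real number `x` and a rational number `q`. -/
def LtQ (x : M.D one) (q : M.Q) : Prop := ∃ n, 2 * hp n < q - ap x n

/-- The real number given by the code of a rational number. -/
def rat (c : M.N) : M.D one := M.app (M.K nat nat) c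

@[simp] theorem ap_rat (c n : M.N) : ap (rat c) n = val c := by rw [ap, rat, M.K_app]

/-- `x` is a real number in the unit interval. -/
def InUnit (x : M.D one) : Prop := IsReal x ∧ ¬ LtQ x 0 ∧ ¬ GtQ 1 x

/-- Addition of real numbers. -/
def radd (x y : M.D one) : M.D one := eval (cons y (cons x nil)) (realAdd v1 v0)

/-- Subtraction of real numbers. -/
def rsub (x y : M.D one) : M.D one := eval (cons y (cons x nil)) (realSub v1 v0)

/-- `|x - y| < q` for real numbers `x` and `y` and a rational number `q`. -/
def DistLt (x y : M.D one) (q : M.Q) : Prop := LtQ (rsub x y) q ∧ LtQ (rsub y x) q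

/-- `x` lies in the interval `I_y` of the functional `Ψ`. -/
def InI (Ψ : M.D (one ⇒ₜ one)) (y x : M.D one) : Prop :=
  RLt (rsub y (M.app Ψ y)) x ∧ RLt x (radd y (M.app Ψ y))

section Reals
variable {Γ : List Ty} (e : M.Env Γ)

@[simp] theorem ratVal_approx (x : Tm Γ one) (n : Tm Γ nat) :
    ratVal e (approx x n) = ap (eval e x) (eval e n) := ratVal_dec e _
@[simp] theorem den_approx (x : Tm Γ one) (n : Tm Γ nat) : 0 < eval e (approx x n).den :=
  den_dec e _

@[simp] theorem sat_isReal (x : Tm Γ one) : Sat (isReal x) e ↔ IsReal (eval e x) := by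
  simp [isReal, IsReal]
@[simp] theorem sat_realEq (x y : Tm Γ one) :
    Sat (realEq x y) e ↔ REq (eval e x) (eval e y) := by
  simp [realEq, REq]
@[simp] theorem sat_realLt (x y : Tm Γ one) :
    Sat (realLt x y) e ↔ RLt (eval e x) (eval e y) := by
  simp [realLt, RLt]

theorem ap_eval_ofRat {q : RatTm Γ} (hq : 0 < eval e q.den) (n : M.N) :
    ap (eval e (ofRat q)) n = ratVal e q := by
  rw [ap, ofRat, eval_app, eval_K, M.K_app, val_enc e hq]

theorem sat_ofRat_lt {q : RatTm Γ} (hq : 0 < eval e q.den) (x : Tm Γ one) :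
    Sat (realLt (ofRat q) x) e ↔ GtQ (ratVal e q) (eval e x) := by
  simp [RLt, GtQ, ap_eval_ofRat e hq]
theorem sat_lt_ofRat {q : RatTm Γ} (hq : 0 < eval e q.den) (x : Tm Γ one) :
    Sat (realLt x (ofRat q)) e ↔ LtQ (eval e x) (ratVal e q) := by
  simp [RLt, LtQ, ap_eval_ofRat e hq]

theorem sat_real0_lt (x : Tm Γ one) : Sat (realLt real0 x) e ↔ GtQ 0 (eval e x) := by
  rw [real0, sat_ofRat_lt e (by simp)]; simp [Frac.ofN_zero]

theorem sat_inUnit (x : Tm Γ one) : Sat (inUnit x) e ↔ InUnit (eval e x) := by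
  simp only [inUnit, InUnit, sat_and, sat_isReal, realLe, sat_not, real0, real1]
  rw [sat_ofRat_lt e (by simp), sat_lt_ofRat e (by simp)]
  simp [Frac.ofN_zero, Frac.ofN_one]

theorem eval_realSub (x y : Tm Γ one) :
    eval e (realSub x y) = rsub (eval e x) (eval e y) := by
  refine M.ext fun n => ?_
  simp only [rsub, realSub, app_lamₒ, enc, eval_pair, eval_pred, RatTm.sub, RatTm.add, RatTm.opp,
    approx, dec, eval_add, eval_mul, eval_fst, eval_snd, eval_app, eval_suc, eval_wk, eval_var_zero,
    eval_var_succ]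

theorem eval_realAdd (x y : Tm Γ one) :
    eval e (realAdd x y) = radd (eval e x) (eval e y) := by
  refine M.ext fun n => ?_
  simp only [radd, realAdd, app_lamₒ, enc, eval_pair, eval_pred, RatTm.add,
    approx, dec, eval_add, eval_mul, eval_fst, eval_snd, eval_app, eval_suc, eval_wk, eval_var_zero,
    eval_var_succ]

theorem ap_rsub (x y : M.D one) (n : M.N) : ap (rsub x y) n = ap x (n + 1) - ap y (n + 1) := by
  rw [ap, rsub, realSub, app_lamₒ, val_enc _ (by simp), ratVal_sub _ (by simp) (by simp)]
  simp [suc_eq]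

theorem ap_radd (x y : M.D one) (n : M.N) : ap (radd x y) n = ap x (n + 1) + ap y (n + 1) := by
  rw [ap, radd, realAdd, app_lamₒ, val_enc _ (by simp), ratVal_add _ (by simp) (by simp)]
  simp [suc_eq]

theorem sat_distLt (x y : Tm Γ one) {q : RatTm Γ} (hq : 0 < eval e q.den) :
    Sat (distLt x y (ofRat q)) e ↔ DistLt (eval e x) (eval e y) (ratVal e q) := by
  rw [distLt, sat_and, sat_lt_ofRat e hq, sat_lt_ofRat e hq, eval_realSub, eval_realSub, DistLt]

theorem sat_inBasic (a b : Tm Γ one) (n : Tm Γ nat) (x : Tm Γ one) :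
    Sat (inBasic a b n x) e ↔ GtQ (ap (eval e a) (eval e n)) (eval e x) ∧
      LtQ (eval e x) (ap (eval e b) (eval e n)) := by
  rw [inBasic, sat_and, sat_ofRat_lt e (by simp), sat_lt_ofRat e (by simp)]
  simp [ap]

theorem sat_inI (Ψ : Tm Γ (one ⇒ₜ one)) (y x : Tm Γ one) :
    Sat (inI Ψ y x) e ↔ InI (eval e Ψ) (eval e y) (eval e x) := by
  simp [inI, InI, eval_realSub, eval_realAdd]

/-- The recursion by which finite sums are written as terms computes these sums. -/
theorem ap_zero_rec (c : M.N) (z : M.D (nat ⇒ₜ nat ⇒ₜ nat)) (f : M.N → M.Q)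
    (hf : RepQ fun r => f (r 0)) (hc : val c = 0)
    (hz : ∀ u i, val (M.app (M.app z u) i) = val u + f i) (n : M.N) :
    val (M.app (M.app (M.app M.R n) c) z) = isum f n := by
  symm
  refine isum_eq (S := fun n => val (M.app (M.app (M.app M.R n) c) z)) hf
    (Rep.val ((((Rep.const M.R).app (.var 0)).app (.const c)).app (.const z))) ?_ (fun n => ?_) n
  · simp [hc]
  · rw [← suc_eq, app_R_suc, hz]

theorem repQ_ap (x : M.D one) {A : (ℕ → M.N) → M.N} (hA : Rep A) : RepQ fun r => ap x (A r) :=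
  ((Rep.const x).app hA).val

theorem val_sumDiff (a b : Tm Γ one) (n : Tm Γ nat) : val (eval e (sumDiff a b n)) =
    isum (fun i => ap (eval e b) i - ap (eval e a) i) (eval e n) := by
  refine ap_zero_rec _ _ _ ((repQ_ap _ (.var 0)).sub (repQ_ap _ (.var 0))) ?_ (fun u i => ?_) _
  · rw [val_enc e (by simp)]; simp [Frac.ofN_zero]
  · rw [app_lamₒ, app_lamₒ, val_enc _ (by simp), ratVal_add _ (by simp) (by simp),
      ratVal_sub _ (by simp) (by simp)]
    simp [ap]

theorem val_sumRat (a : Tm Γ one) (n : Tm Γ nat) : val (eval e (sumRat a n)) =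
    isum (fun i => ap (eval e a) i) (eval e n) := by
  refine ap_zero_rec _ _ _ (repQ_ap _ (.var 0)) ?_ (fun u i => ?_) _
  · rw [val_enc e (by simp)]; simp [Frac.ofN_zero]
  · rw [app_lamₒ, app_lamₒ, val_enc _ (by simp), ratVal_add _ (by simp) (by simp)]
    simp [ap]

end Reals

/-! ### The covering principle in a model -/

section Principle
variable (Ψ : M.D (one ⇒ₜ one))

/-- `Ψ` maps reals of the unit interval to positive reals and respects equality of reals. -/
def IsPosFun : Prop :=
  (∀ x, InUnit x → IsReal (M.app Ψ x) ∧ GtQ 0 (M.app Ψ x)) ∧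
  ∀ x y, InUnit x → InUnit y → REq x y → REq (M.app Ψ x) (M.app Ψ y)

/-- `Ψ` is continuous at `x`. -/
def ContAt (x : M.D one) : Prop :=
  ∀ k, ∃ m, ∀ y, InUnit y → DistLt x y (hp m) → DistLt (M.app Ψ x) (M.app Ψ y) (hp k)

/-- `x` lies in the union of the intervals with end points coded by `c` and `d`. -/
def InOpen (c d x : M.D one) : Prop := ∃ n, GtQ (ap c n) x ∧ LtQ x (ap d n)

/-- The points of discontinuity of `Ψ` can be covered by intervals of arbitrarily small total
length. -/
def SmallCover : Prop :=
  ∀ e, ∃ c d : M.D one, (∀ n, ap c n < ap d n) ∧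
    (∀ x, InUnit x → ContAt Ψ x ∨ InOpen c d x) ∧
    ∀ n, isum (fun i => ap d i - ap c i) n < hp e

/-- `q < |J_{y_i}|`: the set `J_{y_i}` contains finitely many disjoint intervals of total length
greater than `q`. Their number `n` may be nonstandard. -/
def LtLengthJ (y : M.D (nat ⇒ₜ one)) (i : M.N) (q : M.Q) : Prop :=
  ∃ (n : M.N) (c d : M.D one), (∀ m < n, ap c m < ap d m ∧
      (∀ l < m, ap d l ≤ ap c m ∨ ap d m ≤ ap c l) ∧
      ∀ x, IsReal x → GtQ (ap c m) x → LtQ x (ap d m) →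
        InI Ψ (M.app y i) x ∧ ∀ j < i, ¬ InI Ψ (M.app y j) x) ∧
    q < isum (fun i => ap d i - ap c i) n

/-- The conclusion of the covering principle for `Ψ` and `ε`. -/
def HasCover (ε : M.D one) : Prop :=
  ∃ (k : M.N) (y : M.D (nat ⇒ₜ one)) (q : M.D one), (∀ i ≤ k, InUnit (M.app y i)) ∧
    (∀ i ≤ k, ∀ j < i, ¬ REq (M.app y i) (M.app y j)) ∧
    (∀ i ≤ k, LtLengthJ Ψ y i (ap q i)) ∧
    ∃ n, 2 * hp n < isum (fun i => ap q i) (k + 1) - (1 - ap ε (n + 1))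

end Principle

theorem ap_real1 {Γ : List Ty} (e : M.Env Γ) (n : M.N) : ap (eval e real1) n = 1 := by
  rw [real1, ap_eval_ofRat e (by simp)]; simp [Frac.ofN_one]

theorem sat_isPosFun {Γ : List Ty} (e : M.Env Γ) (Ψ : Tm Γ (one ⇒ₜ one)) :
    Sat (isPosFun Ψ) e ↔ IsPosFun (eval e Ψ) := by
  simp only [isPosFun, IsPosFun, sat_and, sat_forallₒ, sat_imp, sat_inUnit, sat_isReal,
    sat_real0_lt, sat_realEq, eval_app, eval_wk, eval_var_zero]

theorem sat_contAt {Γ : List Ty} (e : M.Env Γ) (Ψ : Tm Γ (one ⇒ₜ one)) (x : Tm Γ one) :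
    Sat (contAt Ψ x) e ↔ ContAt (eval e Ψ) (eval e x) := by
  simp only [contAt, ContAt, sat_forallₒ, sat_existsₒ, sat_imp, sat_inUnit,
    sat_distLt _ _ _ (den_halfPow _ _), ratVal_halfPow, eval_app, eval_wk, eval_var_zero]

theorem sat_inOpen {Γ : List Ty} (e : M.Env Γ) (a b x : Tm Γ one) :
    Sat (inOpen a b x) e ↔ InOpen (eval e a) (eval e b) (eval e x) := by
  simp only [inOpen, InOpen, sat_existsₒ, sat_inBasic, eval_wk, eval_var_zero]

/-- If `Ψ` is continuous almost everywhere, coverings of the closed null set are coverings of its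
points of discontinuity. -/
theorem smallCover_of_sat {Γ : List Ty} (e : M.Env Γ) (Ψ : Tm Γ (one ⇒ₜ one))
    (h : Sat (contAE Ψ) e) : SmallCover (eval e Ψ) := by
  simp only [contAE, closedNull, inClosed, sat_existsₒ, sat_and, sat_forallₒ, sat_imp, sat_not,
    sat_isReal, sat_real0_lt, sat_inUnit, sat_inOpen, sat_contAt, eval_wk, eval_var_zero,
    sat_ratLt _ (den_dec _ _) (den_dec _ _), ratVal_dec, eval_app,
    sat_ofRat_lt _ (den_dec _ _), val_sumDiff] at h
  obtain ⟨a, b, -, hnull, hcont⟩ := h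
  intro k
  obtain ⟨c₀, hc₀⟩ := exists_val (hp k)
  have hreal : IsReal (rat c₀) := fun n i => by
    simp only [ap_rat, sub_self]
    exact ⟨hp_pos n, hp_pos n⟩
  have hpos : GtQ 0 (rat c₀) := by
    obtain ⟨m, hm⟩ := exists_hp_lt (half_pos (hp_pos k))
    refine ⟨m, ?_⟩
    rw [ap_rat, hc₀]
    linarith
  obtain ⟨c, d, hcd, hcov, hsum⟩ := hnull (rat c₀) hreal hpos
  refine ⟨c, d, hcd, fun x hx => ?_, fun n => ?_⟩
  · by_cases hE : InOpen a b x
    · exact .inl (hcont x hx fun h => h.2 hE)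
    · exact .inr (hcov x ⟨hx.1, hE⟩)
  · obtain ⟨m, hm⟩ := hsum n
    rw [ap_rat, hc₀] at hm
    have := hp_pos m
    linarith

theorem sat_ltLengthJ {Γ : List Ty} (e : M.Env Γ) (Ψ : Tm Γ (one ⇒ₜ one)) (y : Tm Γ (nat ⇒ₜ one))
    (i q : Tm Γ nat) : Sat (ltLengthJ Ψ y i q) e ↔
      LtLengthJ (eval e Ψ) (eval e y) (eval e i) (val (eval e q)) := by
  simp only [ltLengthJ, LtLengthJ, inJ, sat_existsₒ, sat_and, sat_forallₒ, sat_imp, sat_not, sat_or,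
    sat_lt, sat_inI, sat_inBasic, sat_isReal, sat_ratLt _ (den_dec _ _) (den_dec _ _),
    sat_ratLe _ (den_dec _ _) (den_dec _ _), ratVal_dec, val_sumDiff, eval_wk, eval_var_zero,
    eval_app, ap, and_imp]

theorem sat_ltSumLengthJ {Γ : List Ty} (e : M.Env Γ) (Ψ : Tm Γ (one ⇒ₜ one))
    (y : Tm Γ (nat ⇒ₜ one)) (k : Tm Γ nat) (r : Tm Γ one) : Sat (ltSumLengthJ Ψ y k r) e ↔
      ∃ q : M.D one, (∀ i ≤ eval e k, LtLengthJ (eval e Ψ) (eval e y) i (ap q i)) ∧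
        LtQ (eval e r) (isum (fun i => ap q i) (eval e k + 1)) := by
  simp only [ltSumLengthJ, sat_existsₒ, sat_and, sat_forallₒ, sat_imp, sat_le, sat_ltLengthJ,
    sat_lt_ofRat _ (den_dec _ _), ratVal_dec, val_sumRat, eval_wk, eval_var_zero, eval_app,
    eval_suc, suc_eq, ap]

/-- The formal covering principle follows from its semantic counterpart. -/
theorem models_WHBUae (h : ∀ (Ψ : M.D (one ⇒ₜ one)) (ε : M.D one), IsPosFun Ψ → SmallCover Ψ →
    IsReal ε → GtQ 0 ε → HasCover Ψ ε) : M.Models WHBUae := by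
  rw [Models, WHBUae]
  refine (sat_forallₒ _ _).2 fun Ψ hΨ hcont => (sat_forallₒ _ _).2 fun ε hε hε0 => ?_
  have hΨ' := (sat_isPosFun _ _).1 hΨ
  have hcont' := smallCover_of_sat _ _ hcont
  have hε' := (sat_isReal _ _).1 hε
  have hε0' := (sat_real0_lt _ _).1 hε0
  simp only [eval_var_zero] at hΨ' hcont' hε' hε0'
  obtain ⟨k, y, q, h₁, h₂, h₃, n, hn⟩ := h Ψ ε hΨ' hcont' hε' hε0'
  refine (sat_existsₒ _ _).2 ⟨k, (sat_existsₒ _ _).2 ⟨y, ?_⟩⟩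
  simp only [sat_and, sat_forallₒ, sat_imp, sat_not, sat_inUnit, sat_realEq, sat_ltSumLengthJ,
    sat_le, sat_lt, eval_wk, eval_var_zero, eval_app, eval_realSub]
  refine ⟨h₁, h₂, q, h₃, n, ?_⟩
  rwa [ap_rsub, ap_real1]

/-- The code of the first `k` values of `b`. -/
def initSegN (b : M.D one) (k : M.N) : M.N :=
  M.app (M.app (M.app M.R k) 0) (eval (cons b nil) (lamₒ nat fun u => lamₒ nat fun i =>
    snoc u.wk (Tm.wk (Tm.wk v0) ⬝ₜ i)))

theorem eval_initSeg {Γ : List Ty} (e : M.Env Γ) (b : Tm Γ one) (k : Tm Γ nat) :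
    eval e (initSeg b k) = initSegN (eval e b) (eval e k) :=
  congrArg (M.app (M.app (M.app M.R (eval e k)) 0)) (ext₂ fun x y => by
    simp only [app_lamₒ, snoc, eval_suc, eval_add, eval_app, eval_wk, eval_var_zero])

theorem initSegN_zero (b : M.D one) : initSegN b 0 = 0 := app_R_zero _ _
theorem initSegN_succ (b : M.D one) (k : M.N) :
    initSegN b (k + 1) = initSegN b k + initSegN b k + M.app b k + 1 := by
  rw [← suc_eq, initSegN, app_R_suc, ← initSegN]
  simp only [app_lamₒ, snoc, eval_suc, eval_add, eval_app, eval_wk, eval_var_zero, suc_eq]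

theorem Rep.initSegN (b : M.D one) {A : (ℕ → M.N) → M.N} (hA : Rep A) :
    Rep fun r => Model.initSegN b (A r) :=
  (((const M.R).app hA).app (const 0)).app (const _)

/-- Weak König's lemma in a model. -/
theorem wkl_of_models (h : M.Models WKL) (t : M.D one)
    (htree : ∀ s, M.app t (s + s + 1) = 0 ∨ M.app t (s + s + 1 + 1) = 0 → M.app t s = 0)
    (hinf : ∀ k, ∃ s, p2 k ≤ s + 1 ∧ s + 1 < p2 (k + 1) ∧ M.app t s = 0) :
    ∃ b : M.D one, (∀ i, M.app b i ≤ 1) ∧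
      ∀ k, M.app t (initSegN b k) = 0 := by
  have h' := h t
  simp only [isTree, isBinary, sat_imp, sat_existsₒ, sat_and, sat_forallₒ, sat_or, hasLength,
    sat_le, sat_lt, eval_wk, eval_var_zero, eval_app, sat_eq, M.E_iff, snoc, eval_suc, eval_add,
    eval_num1, suc_eq, eval_zero, zero_def, eval_pow2, add_zero] at h'
  obtain ⟨b, hb, hb'⟩ := h' htree fun k => by
    obtain ⟨s, h₁, h₂, h₃⟩ := hinf k
    exact ⟨s, ⟨h₁, h₂⟩, h₃⟩
  refine ⟨b, hb, fun k => ?_⟩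
  have := hb' k
  rwa [eval_initSeg] at this

/-! ### Real numbers and dyadic points of a model -/

theorem IsReal.abs_sub_lt {x : M.D one} (hx : IsReal x) {m n : M.N} (h : m ≤ n) :
    ap x m - ap x n < hp m ∧ ap x n - ap x m < hp m := by
  obtain ⟨i, rfl⟩ := exists_add_of_le h
  exact hx m i

theorem IsReal.sub_lt_add {x : M.D one} (hx : IsReal x) (m n : M.N) :
    ap x m - hp m < ap x n + hp n := by
  have h₁ := hp_pos m
  have h₂ := hp_pos n
  rcases le_total m n with h | h
  · linarith [(hx.abs_sub_lt h).1]
  · linarith [(hx.abs_sub_lt h).2]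

theorem isReal_rat (c : M.N) : IsReal (rat c) := fun n i => by
  simp only [ap_rat, sub_self]
  exact ⟨hp_pos n, hp_pos n⟩

theorem inUnit_of_ap {x : M.D one} (hx : IsReal x) (h : ∀ n, 0 ≤ ap x n ∧ ap x n ≤ 1) :
    InUnit x := by
  refine ⟨hx, ?_, ?_⟩
  · rintro ⟨n, hn⟩
    linarith [h n, hp_pos n]
  · rintro ⟨n, hn⟩
    linarith [h n, hp_pos n]

theorem exists_ap_eq {f : M.N → M.Q} (hf : RepQ fun r => f (r 0)) :
    ∃ a : M.D one, ∀ n, ap a n = f n := by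
  obtain ⟨F, hF, hF'⟩ := hf
  refine ⟨lamN fun n => F fun _ => n, fun n => ?_⟩
  rw [ap, Rep.app_lamN (hF.subst fun _ => .var 0), ← hF' fun _ => n]

/-- The dyadic rational `i / 2^q` as a real number. -/
def pt (q i : M.N) : M.D one := rat (pair (pair i 0) (pred (p2 q)))

@[simp] theorem ap_pt (q i n : M.N) : ap (pt q i) n = ofN i * hp q := by
  rw [pt, ap_rat, val_pair _ _ (p2_pos q), Frac.mk_eq_div, Frac.ofN_zero, sub_zero, hp,
    div_eq_mul_inv]

theorem Rep.pt {A B : (ℕ → M.N) → M.N} (hA : Rep A) (hB : Rep B) :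
    Rep fun r => Model.pt (A r) (B r) :=
  (const (M.K nat nat)).app ((hB.pair (const 0)).pair (term₁ (HOArith.pred v0) hA.p2))

theorem ofN_mul_hp_le_one {i q : M.N} (h : i ≤ p2 q) : ofN i * hp q ≤ 1 := by
  rw [← p2_mul_hp q]
  exact mul_le_mul_of_nonneg_right (Frac.ofN_le.2 h) (hp_pos q).le

theorem inUnit_pt {q i : M.N} (h : i ≤ p2 q) : InUnit (pt q i) := by
  refine inUnit_of_ap (isReal_rat _) fun n => ?_
  rw [ap_pt]
  exact ⟨mul_nonneg (Frac.ofN_nonneg i) (hp_pos q).le, ofN_mul_hp_le_one h⟩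

/-! ### Dyadic cells

The cell `i` of level `q` is the interval `[i / 2^q, (i + 1) / 2^q]`. -/

section Cells
variable (Ψ : M.D (one ⇒ₜ one)) (c d : M.D one)

/-- The cell `i` of level `q` is contained in `I_y` for its left end point `y`, by a margin of a
cell length and as witnessed by the `q`-th approximation of `Ψ y`, or in one of the first `q`
intervals coded by `c` and `d`. -/
def Good (q i : M.N) : Prop :=
  3 * hp q < ap (M.app Ψ (pt q i)) q ∨
    ∃ n, n < q ∧ ap c n < ofN i * hp q ∧ (ofN i + 1) * hp q < ap d n

/-- The cell `i` of level `p` is contained in the cell `j` of level `q`. -/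
def CellLe (q j p i : M.N) : Prop :=
  ofN j * hp q ≤ ofN i * hp p ∧ (ofN i + 1) * hp p ≤ (ofN j + 1) * hp q

/-- The binary sequences (given by codes) whose cells are not contained in good cells. -/
def BadTree (s : M.N) : Prop :=
  ∀ p, p < s + 1 → ∀ i, i < s + 1 → s + 1 = p2 p + i → i < p2 p →
    ∀ q, q < p + 1 → ∀ j, j < p2 q → CellLe q j p i → ¬ Good Ψ c d q j

variable {Ψ c d}

theorem DecP.cellLe {A B C D : (ℕ → M.N) → M.N} (hA : Rep A) (hB : Rep B) (hC : Rep C)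
    (hD : Rep D) : DecP fun r => CellLe (A r) (B r) (C r) (D r) :=
  (leQ (.mul (.ofN hB) (.hp hA)) (.mul (.ofN hD) (.hp hC))).and
    (leQ (.mul (.add (.ofN hD) (.const 1)) (.hp hC)) (.mul (.add (.ofN hB) (.const 1)) (.hp hA)))

theorem DecP.good (Ψ : M.D (one ⇒ₜ one)) (c d : M.D one) {A B : (ℕ → M.N) → M.N} (hA : Rep A)
    (hB : Rep B) : DecP fun r => Good Ψ c d (A r) (B r) :=
  (ltQ (.mul (.const 3) (.hp hA)) (((Rep.const Ψ).app (.pt hA hB)).app hA).val).or <|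
    .exists_lt ((ltQ (repQ_ap c (.var 0)) (.mul (.ofN hB.tail) (.hp hA.tail))).and
      (ltQ (.mul (.add (.ofN hB.tail) (.const 1)) (.hp hA.tail)) (repQ_ap d (.var 0)))) hA

theorem DecP.badTree (Ψ : M.D (one ⇒ₜ one)) (c d : M.D one) :
    DecP fun r => BadTree Ψ c d (r 0) :=
  .forall_lt (.forall_lt (.imp (.eq (.add (.var 2) (.const 1)) (.add (.p2 (.var 1)) (.var 0)))
    (.imp (.lt (.var 0) (.p2 (.var 1))) (.forall_lt (.forall_lt
      (.imp (.cellLe (.var 1) (.var 0) (.var 3) (.var 2)) (.not (.good Ψ c d (.var 1) (.var 0))))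
      (.p2 (.var 0))) (.add (.var 1) (.const 1)))))
    (.add (.var 1) (.const 1))) (.add (.var 0) (.const 1))

/-- `BadTree` is a tree, because the two halves of a cell are contained in it. -/
theorem BadTree.of_snoc {s δ : M.N} (hδ : δ ≤ 1) (h : BadTree Ψ c d (s + s + 1 + δ)) :
    BadTree Ψ c d s := by
  intro p hp' i hi hs hip q hq j hj hc
  have hss : s + s + 1 + δ + 1 = p2 (p + 1) + (i + i + δ) := by
    rw [p2_succ]
    linear_combination 2 * hs
  have hδ' : ofN δ ≤ 1 := by rwa [← Frac.ofN_one, Frac.ofN_le]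
  have hh := hp_pos p
  have h0 := Frac.ofN_nonneg δ
  refine h (p + 1) ?_ (i + i + δ) ?_ hss ?_ q (hq.trans (lt_add_of_pos_right _ one_pos)) j hj ?_
  · refine add_lt_add_of_lt_of_le (hp'.trans_le ?_) le_rfl
    calc s + 1 ≤ s + 1 + (s + δ) := le_self_add
      _ = s + s + 1 + δ := by ring
  · rw [hss]
    exact lt_add_of_pos_left _ (p2_pos _)
  · rw [p2_succ]
    have h₁ := lt_iff_succ_le.1 hip
    refine lt_iff_succ_le.2 ?_
    calc i + i + δ + 1 ≤ i + i + 1 + 1 := by gcongr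
      _ = (i + 1) + (i + 1) := by ring
      _ ≤ p2 p + p2 p := add_le_add h₁ h₁
  · simp only [CellLe, hp_succ, Frac.ofN_add] at hc ⊢
    constructor
    · nlinarith [hc.1]
    · nlinarith [hc.2]

end Cells

/-- The level and the position of a cell are determined by the code of a binary sequence. -/
theorem p2_add_inj {k l i j : M.N} (hi : i < p2 k) (hj : j < p2 l) (h : p2 k + i = p2 l + j) :
    k = l := by
  have key {k l i j : M.N} (hi : i < p2 k) (h : p2 k + i = p2 l + j) : l ≤ k := by
    by_contra! hlt
    have h₁ := p2_mono (lt_iff_succ_le.1 hlt)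
    rw [p2_succ] at h₁
    have h₂ : p2 k + i < p2 k + p2 k := add_lt_add_of_le_of_lt le_rfl hi
    rw [h] at h₂
    exact absurd (le_self_add.trans_lt h₂) h₁.not_gt
  exact le_antisymm (key hj h.symm) (key hi h)

/-- A path through the full binary tree determines a point of the unit interval. Its `k`-th
approximation is the left end point of the `k`-th cell, which has the number `i` if the first `k`
values of the path have the code `2 ^ k + i - 1`. -/
theorem exists_path {b : M.D one} (hb : ∀ i, M.app b i ≤ 1) :
    ∃ x : M.D one, InUnit x ∧
      (∀ k, ∃ i, i < p2 k ∧ initSegN b k + 1 = p2 k + i ∧ ap x k = ofN i * hp k) ∧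
      ∀ k n, ap x k ≤ ap x (k + n) ∧ ap x (k + n) + hp (k + n) ≤ ap x k + hp k := by
  have hseg : RepQ fun r => ofN (initSegN b (r 0) + 1) * hp (r 0) - 1 :=
    .sub (.mul (.ofN (.add (.initSegN b (.var 0)) (.const 1))) (.hp (.var 0))) (.const 1)
  -- The initial segment of length `k` has the code `2 ^ k + i - 1`, where `i` is the number of the
  -- `k`-th cell.
  obtain ⟨x, hx⟩ := exists_ap_eq (f := fun k => ofN (initSegN b k + 1) * hp k - 1) hseg
  have hsucc (k : M.N) : ap x (k + 1) = ap x k + ofN (M.app b k) * hp (k + 1) := by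
    rw [hx, hx, initSegN_succ, hp_succ]
    simp only [Frac.ofN_add, Frac.ofN_one]
    ring
  have hb' (k : M.N) : 0 ≤ ofN (M.app b k) ∧ ofN (M.app b k) ≤ 1 :=
    ⟨Frac.ofN_nonneg _, by rw [← Frac.ofN_one, Frac.ofN_le]; exact hb k⟩
  have hmono (k n : M.N) : ap x k ≤ ap x (k + n) ∧ ap x (k + n) + hp (k + n) ≤ ap x k + hp k := by
    refine DecP.induct (P := fun n => ap x k ≤ ap x (k + n) ∧
      ap x (k + n) + hp (k + n) ≤ ap x k + hp k) ?_ ?_ ?_ n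
    · have h := Rep.add (.const k) (.var 0)
      exact (DecP.leQ (.const _) (repQ_ap x h)).and
        (.leQ (.add (repQ_ap x h) (.hp h)) (.const _))
    · simp
    · rintro n ⟨h₁, h₂⟩
      have h := hp_pos (k + n)
      have h' := hb' (k + n)
      rw [← add_assoc, hsucc, hp_succ]
      constructor <;> nlinarith
  have h0 : ap x 0 = 0 := by
    rw [hx, initSegN_zero, hp_zero, zero_add, Frac.ofN_one]; ring
  have hbound (k : M.N) : 0 ≤ ap x k ∧ ap x k + hp k ≤ 1 := by
    have := hmono 0 k
    rwa [h0, zero_add, hp_zero, zero_add] at this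
  refine ⟨x, inUnit_of_ap (fun n i => ?_) (fun n => ⟨(hbound n).1, ?_⟩), fun k => ?_, hmono⟩
  · have h := hmono n i
    have h₁ := hp_pos n
    have h₂ := hp_pos (n + i)
    constructor <;> linarith
  · linarith [hbound n, hp_pos n]
  · obtain ⟨h₁, h₂⟩ := hbound k
    rw [hx] at h₁ h₂
    have h₃ : p2 k ≤ initSegN b k + 1 := by
      rw [← Frac.ofN_le]
      by_contra! h
      have := mul_lt_mul_of_pos_right h (hp_pos k)
      rw [p2_mul_hp] at this
      linarith
    obtain ⟨i, hi⟩ := exists_add_of_le h₃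
    refine ⟨i, ?_, hi, ?_⟩
    · rw [← Frac.ofN_lt]
      by_contra! h
      have := mul_le_mul_of_nonneg_right h (hp_pos k).le
      rw [hi, Frac.ofN_add, add_mul] at h₂
      rw [p2_mul_hp] at this h₂
      linarith [hp_pos k]
    · rw [hx, hi, Frac.ofN_add, add_mul, p2_mul_hp]
      ring

section Bar
variable {Ψ : M.D (one ⇒ₜ one)} {c d : M.D one}

/-- Around a point at which `Ψ` is continuous, the dyadic points of high level that are close to it
have large values. -/
theorem exists_good_of_contAt (hΨ : IsPosFun Ψ) {x : M.D one} (hx : InUnit x) (hc : ContAt Ψ x) :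
    ∃ k₀, ∀ k i, k₀ ≤ k → i < p2 k → ap x k = ofN i * hp k → Good Ψ c d k i := by
  obtain ⟨hreal, k, hk⟩ := hΨ.1 x hx
  obtain ⟨m, hm⟩ := hc (k + 1)
  refine ⟨k + m + 1 + 1 + 1 + 1, fun q i hq hi hxi => .inl ?_⟩
  have hy := inUnit_pt hi.le
  have hqm : hp q ≤ hp m / 2 := by
    rw [← hp_succ]
    refine hp_anti (le_trans ?_ hq)
    calc m + 1 ≤ m + 1 + (k + 1 + 1 + 1) := le_self_add
      _ = k + m + 1 + 1 + 1 + 1 := by ring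
  have hqk : hp q ≤ hp k / 16 := by
    have h : hp q ≤ hp (k + 1 + 1 + 1 + 1) := by
      refine hp_anti (le_trans ?_ hq)
      calc k + 1 + 1 + 1 + 1 ≤ k + 1 + 1 + 1 + 1 + m := le_self_add
        _ = k + m + 1 + 1 + 1 + 1 := by ring
    simp only [hp_succ] at h
    linarith
  have hdist : DistLt x (pt q i) (hp m) := by
    have h₁ := hx.1.abs_sub_lt (n := q + m + 1 + 1 + 1 + 1) (m := q) <| by
      simp only [add_assoc]
      exact le_self_add
    have h₂ : 2 * hp (q + m + 1 + 1 + 1) < hp m / 2 := by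
      have h : hp (q + m) ≤ hp m := hp_anti le_add_self
      simp only [hp_succ]
      linarith [hp_pos m]
    constructor
    · refine ⟨q + m + 1 + 1 + 1, ?_⟩
      rw [ap_rsub, ap_pt, ← hxi]
      linarith
    · refine ⟨q + m + 1 + 1 + 1, ?_⟩
      rw [ap_rsub, ap_pt, ← hxi]
      linarith
  obtain ⟨⟨n, hn⟩, -⟩ := hm _ hy hdist
  have h₁ := hreal.sub_lt_add k (n + 1)
  have h₂ := (hΨ.1 _ hy).1.sub_lt_add (n + 1) q
  rw [ap_rsub] at hn
  simp only [hp_succ] at hn h₁ h₂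
  linarith [hp_pos n, hp_pos k]

/-- A form of weak König's lemma for cells: if every point of the unit interval is a point of
continuity of `Ψ` or covered by the intervals coded by `c` and `d`, then all the cells of some level
are contained in good cells of at most that level. -/
theorem exists_good_level (hM : M.Models WKL) (hΨ : IsPosFun Ψ)
    (hcov : ∀ x, InUnit x → ContAt Ψ x ∨ InOpen c d x) :
    ∃ p, ∀ i, i < p2 p → ∃ q, q ≤ p ∧ ∃ j, j < p2 q ∧ CellLe q j p i ∧ Good Ψ c d q j := by
  classical
  by_contra! hbad
  obtain ⟨F, hF⟩ : ∃ F : M.N → M.N, Rep (fun r => F (r 0)) ∧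
      ∀ s, F s = 0 ↔ BadTree Ψ c d s :=
    ⟨fun s => if BadTree Ψ c d s then 0 else 1,
      .ite (P := fun r => BadTree Ψ c d (r 0)) (.badTree Ψ c d) (.const 0) (.const 1),
      fun s => by by_cases h : BadTree Ψ c d s <;> simp [h]⟩
  have ht (s : M.N) : M.app (lamN F) s = 0 ↔ BadTree Ψ c d s := by
    rw [Rep.app_lamN hF.1, hF.2]
  have hpath : ∃ b : M.D one, (∀ i, M.app b i ≤ 1) ∧ ∀ k, M.app (lamN F) (initSegN b k) = 0 := by
    refine wkl_of_models hM (lamN F) (fun s h => ?_) fun k => ?_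
    · rw [ht]
      simp only [ht] at h
      rcases h with h | h
      · exact .of_snoc zero_le (by rwa [add_zero])
      · exact .of_snoc le_rfl h
    · obtain ⟨i, hi, h⟩ := hbad k
      obtain ⟨s, hs⟩ : ∃ s, s + 1 = p2 k + i := by
        obtain ⟨s, hs⟩ := exists_add_of_le (lt_iff_succ_le.1 ((p2_pos k).trans_le
          (le_self_add (b := i))))
        exact ⟨s, by rw [hs]; ring⟩
      refine ⟨s, hs ▸ le_self_add, ?_, (ht s).2 ?_⟩
      · rw [hs, p2_succ]
        exact add_lt_add_of_le_of_lt le_rfl hi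
      · intro p _ i' _ hs' hi' q hq j hj hc
        obtain rfl := p2_add_inj hi hi' (hs.symm.trans hs')
        obtain rfl : i = i' := add_left_cancel (hs.symm.trans hs')
        exact h q (lt_succ_iff'.1 hq) j hj hc
  obtain ⟨b, hb, hb'⟩ := hpath
  obtain ⟨x, hx, hcell, hmono⟩ := exists_path hb
  have hng (k i : M.N) (hi : i < p2 k) (hxi : ap x k = ofN i * hp k) : ¬ Good Ψ c d k i := by
    obtain ⟨i', hi', hs, hx'⟩ := hcell k
    obtain rfl : i = i' := by
      rw [← Frac.ofN_inj]
      exact mul_right_cancel₀ (hp_pos k).ne' (hxi.symm.trans hx')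
    refine (ht _).1 (hb' k) k ?_ i ?_ hs hi k (lt_succ_iff'.2 le_rfl) i hi ⟨le_rfl, le_rfl⟩
    · rw [hs]
      exact (lt_p2 k).trans_le le_self_add
    · rw [hs]
      exact lt_add_of_pos_left _ (p2_pos k)
  rcases hcov x hx with h | ⟨n, ⟨n₁, h₁⟩, n₂, h₂⟩
  · obtain ⟨k, hk⟩ := exists_good_of_contAt (c := c) (d := d) hΨ hx h
    obtain ⟨i, hi, -, hxi⟩ := hcell k
    exact hng k i hi hxi (hk k i le_rfl hi hxi)
  · obtain ⟨i, hi, -, hxi⟩ := hcell (n + n₁ + n₂ + 1)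
    refine hng _ i hi hxi (.inr ⟨n, ?_, ?_, ?_⟩)
    · rw [lt_succ_iff', add_assoc]
      exact le_self_add
    · rw [← hxi]
      have := (hmono n₁ (n + n₂ + 1)).1
      rw [show n₁ + (n + n₂ + 1) = n + n₁ + n₂ + 1 by ring] at this
      linarith [hp_pos n₁]
    · rw [add_mul, one_mul, ← hxi]
      have := (hmono n₂ (n + n₁ + 1)).2
      rw [show n₂ + (n + n₁ + 1) = n + n₁ + n₂ + 1 by ring] at this
      linarith [hp_pos n₂]

end Bar

/-! ### Counting -/

theorem count_true (n : M.N) : count (fun _ => True) n = ofN n := by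
  have h : DecP fun _ : ℕ → M.N => True := ⟨_, .const 0, fun _ => by simp⟩
  refine isum_eq (S := ofN) (repQ_indicator (P := fun _ => True) h)
    (.ofN (.var 0)) Frac.ofN_zero (fun n => ?_) n
  rw [Frac.ofN_add, Frac.ofN_one, if_pos trivial]

theorem count_le_add {P Q R : M.N → Prop} (hP : DecP fun r => P (r 0)) (hQ : DecP fun r => Q (r 0))
    (hR : DecP fun r => R (r 0)) {n : M.N} (h : ∀ s, s < n → P s → Q s ∨ R s) :
    count P n ≤ count Q n + count R n := by
  have hc {P : M.N → Prop} (hP : DecP fun r => P (r 0)) : RepQ fun r => count P (r 0) :=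
    (isum_spec (repQ_indicator hP)).1
  have hc' {P : M.N → Prop} (hP : DecP fun r => P (r 0)) (m : M.N) :
      count P m ≤ count P (m + 1) := by
    by_cases hm : P m
    · rw [count_succ_of_pos hP hm]; linarith
    · rw [count_succ_of_neg hP hm]
  suffices ∀ m, m ≤ n → count P m ≤ count Q m + count R m from this n le_rfl
  refine DecP.induct (P := fun m => m ≤ n → count P m ≤ count Q m + count R m)
    ((DecP.le (.var 0) (.const n)).imp (.leQ (hc hP) ((hc hQ).add (hc hR)))) ?_ ?_
  · intro _
    rw [count_zero hP, count_zero hQ, count_zero hR, add_zero]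
  · intro m hm hmn
    have h₁ := hm (le_self_add.trans hmn)
    by_cases hp : P m
    · rw [count_succ_of_pos hP hp]
      rcases h m (lt_iff_succ_le.2 hmn) hp with hq | hr
      · rw [count_succ_of_pos hQ hq]
        linarith [hc' hR m]
      · rw [count_succ_of_pos hR hr]
        linarith [hc' hQ m]
    · rw [count_succ_of_neg hP hp]
      linarith [hc' hQ m, hc' hR m]

/-- Bounded search. -/
theorem exists_rep_search {R : M.N → M.N → Prop} (hR : DecP fun r => R (r 0) (r 1)) (n : M.N) :
    ∃ e : M.N → M.N, Rep (fun r => e (r 0)) ∧ ∀ m, (∃ s, s < n ∧ R m s) → R m (e m) := by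
  classical
  have hR' : DecP fun r => R (r 2) (r 0) :=
    hR.subst (s := fun r i => Nat.casesOn i (r 2) fun _ => r 0) fun i => by
      cases i with
      | zero => exact .var 2
      | succ i => exact .var 0
  obtain ⟨H, -, hs, hH⟩ := exists_rep_rec (B := fun _ => 0)
    (C := fun s u r => if R (r 0) s then s else u) (.const 0) (.ite hR' (.var 0) (.var 1))
  have hH' {A B : (ℕ → M.N) → M.N} (hA : Rep A) (hB : Rep B) :
      Rep fun r => H (A r) fun _ => B r := by
    refine hH.subst (s := fun r i => Nat.casesOn i (A r) fun _ => B r) fun i => ?_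
    cases i with
    | zero => exact hA
    | succ i => exact hB
  refine ⟨fun m => H n fun _ => m, hH' (.const n) (.var 0), fun m => ?_⟩
  have hRm {A : (ℕ → M.N) → M.N} (hA : Rep A) : DecP fun r => R m (A r) :=
    hR.subst (s := fun r i => Nat.casesOn i m fun _ => A r) fun i => by
      cases i with
      | zero => exact .const m
      | succ i => exact hA
  refine DecP.induct (P := fun n => (∃ s, s < n ∧ R m s) → R m (H n fun _ => m))
    ((DecP.exists_lt (P := fun s _ => R m s) (hRm (.var 0)) (.var 0)).imp
      (hRm (hH' (.var 0) (.const m)))) ?_ ?_ n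
  · rintro ⟨s, hs, -⟩
    exact (not_lt_zero hs).elim
  · rintro n hn ⟨s, hsn, hRs⟩
    rw [hs]
    split_ifs with h
    · exact h
    · rcases (lt_succ_iff'.1 hsn).lt_or_eq with h' | rfl
      · exact hn ⟨s, h', hRs⟩
      · exact (h hRs).elim

/-- The elements of a decidable bounded set can be enumerated without repetition. -/
theorem exists_enum {P : M.N → Prop} (hP : DecP fun r => P (r 0)) (n : M.N) :
    ∃ (l : M.N) (e : M.N → M.N), Rep (fun r => e (r 0)) ∧ ofN l = count P n ∧
      (∀ m, m < l → P (e m)) ∧ ∀ m, m < l → ∀ m', m' < m → e m' ≠ e m := by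
  classical
  obtain ⟨C, h0, hs, hC⟩ := exists_rep_rec (B := fun _ : ℕ → M.N => 0)
    (C := fun s u _ => u + if P s then 1 else 0) (.const 0)
    (.add (.var 1) (.ite hP (.const 1) (.const 0)))
  have hC' {A : (ℕ → M.N) → M.N} (hA : Rep A) : Rep fun r => C (A r) fun _ => 0 := by
    refine hC.subst (s := fun r i => Nat.casesOn i (A r) fun _ => 0) fun i => ?_
    cases i with
    | zero => exact hA
    | succ i => exact .const 0
  have hPA {A : (ℕ → M.N) → M.N} (hA : Rep A) : DecP fun r => P (A r) :=
    hP.subst (s := fun r _ => A r) fun _ => hA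
  set D : M.N → M.N := fun s => C s fun _ => 0 with hD
  have hD0 : D 0 = 0 := h0 _
  have hDs (s : M.N) : D (s + 1) = D s + if P s then 1 else 0 := hs s _
  obtain ⟨e, he, he'⟩ := exists_rep_search (R := fun m s => D s = m ∧ P s)
    ((DecP.eq (hC' (.var 1)) (.var 0)).and (hPA (.var 1))) n
  have hspec (m : M.N) (hm : m < D n) : D (e m) = m ∧ P (e m) := by
    refine he' m ?_
    rcases DecP.exists_least (P := fun s => m < D s) (.lt (.const m) (hC' (.var 0))) hm with
      h | ⟨s, hsn, h₁, h₂⟩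
    · rw [hD0] at h
      exact (not_lt_zero h).elim
    · refine ⟨s, hsn, ?_⟩
      rw [hDs] at h₂
      split_ifs at h₂ with h
      · exact ⟨le_antisymm (not_lt.1 h₁) (lt_succ_iff'.1 h₂), h⟩
      · rw [add_zero] at h₂
        exact (h₁ h₂).elim
  refine ⟨D n, e, he, ?_, fun m hm => (hspec m hm).2, fun m hm m' hm' h => ?_⟩
  · symm
    refine isum_eq (S := fun s => ofN (D s)) (repQ_indicator hP) (.ofN (hC' (.var 0))) ?_ ?_ n
    · rw [hD0, Frac.ofN_zero]
    · intro s
      rw [hDs, Frac.ofN_add]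
      split_ifs
      · rw [Frac.ofN_one]
      · rw [Frac.ofN_zero]
  · have h₁ := (hspec m' (hm'.trans hm)).1
    rw [h, (hspec m hm).1] at h₁
    exact hm'.ne h₁.symm

/-! ### Cells inside and outside of a finite sequence of intervals

The line is divided into cells `[s * h, (s + 1) * h]`. -/

section Intervals
variable (α β : M.N → M.Q) (h : M.Q)

/-- The cell `s` is contained in the interval `(α i, β i)`, with a margin `h`. -/
def CellIn (i s : M.N) : Prop := α i + h ≤ ofN s * h ∧ (ofN s + 1) * h ≤ β i - h

/-- The cell `s` is disjoint from the interval `(α i, β i)`, with a margin `h`. -/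
def CellOut (i s : M.N) : Prop := (ofN s + 1) * h ≤ α i - h ∨ β i + h ≤ ofN s * h

/-- The cell `s` is contained in the interval `(α i, β i)`, and is disjoint from the preceding
intervals. -/
def CellNew (i s : M.N) : Prop := CellIn α β h i s ∧ ∀ j, j < i → CellOut α β h j s

/-- The cell `s` is near one of the first `m` intervals. -/
def CellMeets (m s : M.N) : Prop := ∃ j, j < m ∧ ¬ CellOut α β h j s

/-- The cell `s` is near one of the end points of the interval `(α i, β i)`. -/
def CellBdry (i s : M.N) : Prop := ¬ CellIn α β h i s ∧ ¬ CellOut α β h i s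

variable {α β} (hα : RepQ fun r => α (r 0)) (hβ : RepQ fun r => β (r 0))
include hα hβ

theorem DecP.cellIn {A B : (ℕ → M.N) → M.N} (hA : Rep A) (hB : Rep B) :
    DecP fun r => CellIn α β h (A r) (B r) :=
  (leQ ((hα.subst (s := fun r _ => A r) fun _ => hA).add (.const h))
    (.mul (.ofN hB) (.const h))).and
  (leQ (.mul (.add (.ofN hB) (.const 1)) (.const h))
    ((hβ.subst (s := fun r _ => A r) fun _ => hA).sub (.const h)))

theorem DecP.cellOut {A B : (ℕ → M.N) → M.N} (hA : Rep A) (hB : Rep B) :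
    DecP fun r => CellOut α β h (A r) (B r) :=
  (leQ (.mul (.add (.ofN hB) (.const 1)) (.const h))
    ((hα.subst (s := fun r _ => A r) fun _ => hA).sub (.const h))).or
  (leQ ((hβ.subst (s := fun r _ => A r) fun _ => hA).add (.const h))
    (.mul (.ofN hB) (.const h)))

theorem DecP.cellNew {A B : (ℕ → M.N) → M.N} (hA : Rep A) (hB : Rep B) :
    DecP fun r => CellNew α β h (A r) (B r) :=
  (cellIn h hα hβ hA hB).and
    (forall_lt (P := fun j r => CellOut α β h j (B r)) (cellOut h hα hβ (.var 0) hB.tail) hA)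

theorem DecP.cellMeets {A B : (ℕ → M.N) → M.N} (hA : Rep A) (hB : Rep B) :
    DecP fun r => CellMeets α β h (A r) (B r) :=
  exists_lt (P := fun j r => ¬ CellOut α β h j (B r)) (cellOut h hα hβ (.var 0) hB.tail).not hA

theorem DecP.cellBdry {A B : (ℕ → M.N) → M.N} (hA : Rep A) (hB : Rep B) :
    DecP fun r => CellBdry α β h (A r) (B r) :=
  (cellIn h hα hβ hA hB).not.and (cellOut h hα hβ hA hB).not

/-- The cells near one of the two end points lie in an interval of length `4 * h`. -/
theorem count_cellBdry_le (hh : 0 < h) (i n : M.N) : count (CellBdry α β h i) n ≤ 8 := by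
  have hdec (x : M.Q) : DecP fun r : ℕ → M.N => x < (ofN (r 0) + 2) * h ∧ ofN (r 0) * h < x + h :=
    (DecP.ltQ (.const x) (.mul (.add (.ofN (.var 0)) (.const 2)) (.const h))).and
      (.ltQ (.mul (.ofN (.var 0)) (.const h)) (.const _))
  let near (x : M.Q) (s : M.N) : Prop := x < (ofN s + 2) * h ∧ ofN s * h < x + h
  have hnear (x : M.Q) : count (near x) n ≤ 4 := by
    refine (count_le_sub (P := near x) (a := x / h - 2) (b := x / h + 2) (hdec x) (by linarith)
      (fun s hs => ?_) n).trans_eq (by ring)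
    have h₂ : x / h < ofN s + 2 := (div_lt_iff₀ hh).2 hs.1
    have h₃ : ofN s < x / h + 1 := by
      have h₄ := (lt_div_iff₀ hh).2 hs.2
      rwa [add_div, div_self hh.ne'] at h₄
    constructor <;> linarith
  have key := count_le_add (P := CellBdry α β h i) (Q := near (α i)) (R := near (β i)) (n := n)
    (DecP.cellBdry h hα hβ (.const i) (.var 0)) (hdec (α i)) (hdec (β i)) fun s _ ⟨h₁, h₂⟩ => by
      simp only [CellIn, CellOut, not_and_or, not_or, not_le] at h₁ h₂
      rcases h₁ with h₁ | h₁
      · exact .inl ⟨by linarith [h₂.1], h₁⟩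
      · exact .inr ⟨by linarith, h₂.2⟩
  linarith [hnear (α i), hnear (β i)]

/-- A cell that is near one of the intervals is new for the first such interval, or near one of the
end points of that interval. -/
theorem count_cellMeets_le (hh : 0 < h) (n m : M.N) :
    count (CellMeets α β h m) n ≤ isum (fun i => count (CellNew α β h i) n + 8) m := by
  have hnew : RepQ fun r => count (CellNew α β h (r 0)) n + 8 :=
    (RepQ.count (P := fun s r => CellNew α β h (r 0) s)
      (DecP.cellNew h hα hβ (.var 1) (.var 0)) (.const n)).add (.const 8)
  have hmeets : RepQ fun r => count (CellMeets α β h (r 0)) n :=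
    RepQ.count (P := fun s r => CellMeets α β h (r 0) s)
      (DecP.cellMeets h hα hβ (.var 1) (.var 0)) (.const n)
  have hM (m : M.N) := DecP.cellMeets h hα hβ (.const m) (.var 0)
  refine DecP.induct (P := fun m => count (CellMeets α β h m) n ≤
    isum (fun i => count (CellNew α β h i) n + 8) m) (.leQ hmeets (isum_spec hnew).1) ?_ ?_ m
  · rw [isum_zero hnew]
    refine (count_le_sub (a := 0) (b := 0) (hM 0) le_rfl ?_ n).trans_eq (sub_zero 0)
    rintro s ⟨j, hj, -⟩
    exact (not_lt_zero hj).elim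
  · intro m hm
    have hN := DecP.cellNew h hα hβ (.const m) (.var 0)
    have hB := DecP.cellBdry h hα hβ (.const m) (.var 0)
    have h₁ := count_le_add (P := CellMeets α β h (m + 1)) (Q := CellMeets α β h m)
      (R := fun s => CellNew α β h m s ∨ CellBdry α β h m s) (n := n)
      (hM (m + 1)) (hM m) (hN.or hB) fun s _ ⟨j, hj, hjs⟩ => by
      by_cases hms : CellMeets α β h m s
      · exact .inl hms
      · simp only [CellMeets, not_exists, not_and, not_not] at hms
        obtain rfl : j = m := (lt_succ_iff'.1 hj).eq_of_not_lt fun hjm => hjs (hms j hjm)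
        by_cases hin : CellIn α β h j s
        · exact .inr (.inl ⟨hin, hms⟩)
        · exact .inr (.inr ⟨hin, hjs⟩)
    have h₂ := count_le_add (P := fun s => CellNew α β h m s ∨ CellBdry α β h m s) (n := n)
      (hN.or hB) hN hB fun s _ hs => hs
    rw [isum_succ hnew]
    linarith [count_cellBdry_le h hα hβ hh m n]

end Intervals

/-- The cell `s` is contained in one of the first `m` intervals coded by `c` and `d`. -/
def CellCovered (c d : M.D one) (h : M.Q) (m s : M.N) : Prop :=
  ∃ l, l < m ∧ ap c l ≤ ofN s * h ∧ (ofN s + 1) * h ≤ ap d l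

theorem DecP.cellCovered (c d : M.D one) (h : M.Q) {A B : (ℕ → M.N) → M.N} (hA : Rep A)
    (hB : Rep B) : DecP fun r => CellCovered c d h (A r) (B r) :=
  exists_lt (P := fun l r => ap c l ≤ ofN (B r) * h ∧ (ofN (B r) + 1) * h ≤ ap d l)
    ((leQ (repQ_ap c (.var 0)) (.mul (.ofN hB.tail) (.const h))).and
      (leQ (.mul (.add (.ofN hB.tail) (.const 1)) (.const h)) (repQ_ap d (.var 0)))) hA

theorem count_cellCovered_le {c d : M.D one} (hcd : ∀ n, ap c n < ap d n) {h : M.Q} (hh : 0 < h)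
    (n m : M.N) : count (CellCovered c d h m) n * h ≤ isum (fun i => ap d i - ap c i) m := by
  have hsum : RepQ fun r => ap d (r 0) - ap c (r 0) := (repQ_ap d (.var 0)).sub (repQ_ap c (.var 0))
  have hcount : RepQ fun r => count (CellCovered c d h (r 0)) n :=
    RepQ.count (P := fun s r => CellCovered c d h (r 0) s)
      (DecP.cellCovered c d h (.var 1) (.var 0)) (.const n)
  have hM (m : M.N) := DecP.cellCovered c d h (.const m) (.var 0)
  refine DecP.induct (P := fun m => count (CellCovered c d h m) n * h ≤
    isum (fun i => ap d i - ap c i) m) (.leQ (hcount.mul (.const h)) (isum_spec hsum).1) ?_ ?_ m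
  · rw [isum_zero hsum]
    refine mul_nonpos_of_nonpos_of_nonneg ?_ hh.le
    refine (count_le_sub (a := 0) (b := 0) (hM 0) le_rfl ?_ n).trans_eq (sub_zero 0)
    rintro s ⟨j, hj, -⟩
    exact (not_lt_zero hj).elim
  · intro m hm
    have hin : DecP fun r : ℕ → M.N => ap c m ≤ ofN (r 0) * h ∧ (ofN (r 0) + 1) * h ≤ ap d m :=
      (DecP.leQ (.const _) (.mul (.ofN (.var 0)) (.const h))).and
        (.leQ (.mul (.add (.ofN (.var 0)) (.const 1)) (.const h)) (.const _))
    have h₁ := count_le_add (P := CellCovered c d h (m + 1)) (Q := CellCovered c d h m)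
      (R := fun s => ap c m ≤ ofN s * h ∧ (ofN s + 1) * h ≤ ap d m) (n := n)
      (hM (m + 1)) (hM m) hin fun s _ ⟨l, hl, hls⟩ => by
      rcases (lt_succ_iff'.1 hl).lt_or_eq with hl | rfl
      · exact .inl ⟨l, hl, hls⟩
      · exact .inr hls
    have h₂ := count_le_sub (P := fun s => ap c m ≤ ofN s * h ∧ (ofN s + 1) * h ≤ ap d m)
      (a := ap c m / h) (b := ap d m / h) hin
      (div_le_div_of_nonneg_right (hcd m).le hh.le)
      (fun s hs => ⟨(div_le_iff₀ hh).2 hs.1, (le_div_iff₀ hh).2 hs.2⟩) n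
    rw [← sub_div, le_div_iff₀ hh] at h₂
    rw [isum_succ hsum]
    nlinarith

/-! ### The covering -/

section Cover
variable {Ψ : M.D (one ⇒ₜ one)} {c d : M.D one}

/-- If `(a, b)` lies in the interval around `y` that is given by an approximation of `Ψ y`, with a
margin for the error of this approximation, it lies in `I_y`. -/
theorem inI_of_le {y x : M.D one} {Y a b : M.Q} {n : M.N} (hΨ : IsReal (M.app Ψ y))
    (hy : ∀ n, ap y n = Y) (hx : IsReal x) (ha : GtQ a x) (hb : LtQ x b)
    (hYa : Y - ap (M.app Ψ y) n + hp n ≤ a) (hYb : b ≤ Y + ap (M.app Ψ y) n - hp n) :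
    InI Ψ y x := by
  obtain ⟨k, hk⟩ := ha
  obtain ⟨l, hl⟩ := hb
  constructor
  · refine ⟨k + 1 + 1, ?_⟩
    have h₁ := hx.sub_lt_add k (k + 1 + 1)
    have h₂ := hΨ.sub_lt_add n (k + 1 + 1 + 1)
    rw [ap_rsub, hy]
    simp only [hp_succ] at h₁ h₂ ⊢
    linarith [hp_pos k]
  · refine ⟨l + 1 + 1, ?_⟩
    have h₁ := hx.sub_lt_add (l + 1 + 1) l
    have h₂ := hΨ.sub_lt_add n (l + 1 + 1 + 1)
    rw [ap_radd, hy]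
    simp only [hp_succ] at h₁ h₂ ⊢
    linarith [hp_pos l]

/-- If `(a, b)` avoids the interval around `y` that is given by an approximation of `Ψ y`, with a
margin for the error of this approximation, it avoids `I_y`. -/
theorem not_inI_of_le {y x : M.D one} {Y a b : M.Q} {n : M.N} (hΨ : IsReal (M.app Ψ y))
    (hy : ∀ n, ap y n = Y) (hx : IsReal x) (ha : GtQ a x) (hb : LtQ x b)
    (h : b ≤ Y - ap (M.app Ψ y) n - hp n ∨ Y + ap (M.app Ψ y) n + hp n ≤ a) :
    ¬ InI Ψ y x := by
  obtain ⟨k, hk⟩ := ha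
  obtain ⟨l, hl⟩ := hb
  rintro ⟨⟨m, hm⟩, ⟨m', hm'⟩⟩
  rw [ap_rsub, hy] at hm
  rw [ap_radd, hy] at hm'
  rcases h with h | h
  · have h₁ := hx.sub_lt_add m l
    have h₂ := hΨ.sub_lt_add (m + 1) n
    rw [hp_succ] at h₂
    linarith [hp_pos m, hp_pos l]
  · have h₁ := hx.sub_lt_add k m'
    have h₂ := hΨ.sub_lt_add (m' + 1) n
    rw [hp_succ] at h₂
    linarith [hp_pos m', hp_pos k]

/-- Every cell of level `p + t` lies in a cell of level `p`. -/
theorem exists_cellLe {p t s : M.N} (hs : s < p2 (p + t)) :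
    ∃ i, i < p2 p ∧ CellLe p i (p + t) s := by
  rw [p2_add] at hs
  rcases DecP.exists_least (P := fun i => s < i * p2 t)
    (.lt (.const s) (.mul (.var 0) (.const _))) hs with h | ⟨i, hi, h₁, h₂⟩
  · rw [zero_mul] at h
    exact (not_lt_zero h).elim
  · refine ⟨i, hi, ?_⟩
    have h₃ := Frac.ofN_le.2 (not_lt.1 h₁)
    have h₄ := Frac.ofN_le.2 (lt_iff_succ_le.1 h₂)
    simp only [Frac.ofN_add, Frac.ofN_mul, Frac.ofN_one] at h₃ h₄
    have ht := p2_mul_hp t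
    have h₅ := mul_le_mul_of_nonneg_right h₃ (hp_pos (p + t)).le
    have h₆ := mul_le_mul_of_nonneg_right h₄ (hp_pos (p + t)).le
    rw [CellLe]
    constructor
    · calc ofN i * hp p = ofN i * ofN (p2 t) * hp (p + t) := by
            rw [hp_add]; linear_combination (-(ofN i * hp p)) * ht
        _ ≤ _ := h₅
    · calc _ ≤ (ofN i + 1) * ofN (p2 t) * hp (p + t) := h₆
        _ = (ofN i + 1) * hp p := by
            rw [hp_add]; linear_combination ((ofN i + 1) * hp p) * ht

/-- If all cells of level `p` are contained in good cells, then every finer cell is near one of the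
intervals of the dyadic points of level `p`, or covered by the intervals coded by `c` and `d`. -/
theorem meets_or_covered (hΨ : IsPosFun Ψ) {p t : M.N}
    (hp' : ∀ i, i < p2 p → ∃ q, q ≤ p ∧ ∃ j, j < p2 q ∧ CellLe q j p i ∧ Good Ψ c d q j)
    {s : M.N} (hs : s < p2 (p + t)) :
    CellMeets (fun i => ofN i * hp p - ap (M.app Ψ (pt p i)) (p + t))
      (fun i => ofN i * hp p + ap (M.app Ψ (pt p i)) (p + t)) (hp (p + t)) (p2 p + 1) s ∨
    CellCovered c d (hp (p + t)) p s := by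
  obtain ⟨i, hi, hsi⟩ := exists_cellLe hs
  obtain ⟨q, hq, j, hj, hij, hgood⟩ := hp' i hi
  have h₁ := hij.1.trans hsi.1
  have h₂ := hsi.2.trans hij.2
  rcases hgood with hgood | ⟨n, hn, hc, hd⟩
  -- The left end point of a good cell of level `q` is also a dyadic point of level `p = q + r`, up
  -- to equality of reals, which `Ψ` respects.
  · obtain ⟨r, rfl⟩ := exists_add_of_le hq
    have hjr : j * p2 r ≤ p2 (q + r) := by
      rw [p2_add]
      exact mul_le_mul_left hj.le _
    have hpt (n : M.N) : ap (pt (q + r) (j * p2 r)) n = ap (pt q j) n := by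
      rw [ap_pt, ap_pt, Frac.ofN_mul, hp_add]
      linear_combination (ofN j * hp q) * p2_mul_hp r
    have hunit := inUnit_pt hj.le
    have hΨeq := hΨ.2 _ _ hunit (inUnit_pt hjr) fun n => by
      rw [hpt, sub_self]
      have := hp_pos n
      constructor <;> linarith
    have h₃ := (hΨeq (q + r + t)).1
    have h₄ := ((hΨ.1 _ hunit).1.abs_sub_lt (m := q) (n := q + r + t)
      (by rw [add_assoc]; exact le_self_add)).1
    have h₅ := hpt 0
    rw [ap_pt, ap_pt] at h₅
    have h₆ := hp_pos (q + r + t)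
    have h₇ : hp (q + r + t) ≤ hp q := hp_anti (by rw [add_assoc]; exact le_self_add)
    refine .inl ⟨j * p2 r, lt_succ_iff'.2 hjr, ?_⟩
    simp only [CellOut, not_or, not_le, h₅]
    rw [add_mul, one_mul] at h₂ ⊢
    constructor <;> linarith
  · exact .inr ⟨n, hn.trans_le hq, hc.le.trans h₁, h₂.trans hd.le⟩

/-- The length of `J_{y_i}` is at least the total length of the cells that are new for `i`. -/
theorem ltLengthJ_of_lt_count (hΨ : IsPosFun Ψ) {p t : M.N} {y : M.D (nat ⇒ₜ one)}
    (hy : ∀ i, M.app y i = pt p i) {i : M.N} (hi : i ≤ p2 p) {n : M.N} {q : M.Q}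
    (hq : q < count (CellNew (fun i => ofN i * hp p - ap (M.app Ψ (pt p i)) t)
      (fun i => ofN i * hp p + ap (M.app Ψ (pt p i)) t) (hp t) i) n * hp t) :
    LtLengthJ Ψ y i q := by
  have hap : RepQ fun r => ap (M.app Ψ (pt p (r 0))) t :=
    (((Rep.const Ψ).app (.pt (.const p) (.var 0))).app (.const t)).val
  have hi' : RepQ fun r : ℕ → M.N => ofN (r 0) * hp p := .mul (.ofN (.var 0)) (.const _)
  obtain ⟨l, e, he, hl, hP, hinj⟩ := exists_enum (P := CellNew
    (fun i => ofN i * hp p - ap (M.app Ψ (pt p i)) t)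
    (fun i => ofN i * hp p + ap (M.app Ψ (pt p i)) t) (hp t) i)
    (DecP.cellNew (hp t) (hi'.sub hap) (hi'.add hap) (.const i) (.var 0)) n
  obtain ⟨a, ha⟩ := exists_ap_eq (f := fun m => ofN (e m) * hp t) (.mul (.ofN he) (.const _))
  obtain ⟨b, hb⟩ := exists_ap_eq (f := fun m => (ofN (e m) + 1) * hp t)
    (.mul (.add (.ofN he) (.const 1)) (.const _))
  have hreal {i : M.N} (hi : i ≤ p2 p) := (hΨ.1 _ (inUnit_pt hi)).1
  refine ⟨l, a, b, fun m hm => ⟨?_, fun m' hm' => ?_, fun x hx h₁ h₂ => ⟨?_, fun j hj => ?_⟩⟩, ?_⟩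
  · rw [ha, hb]
    linarith [hp_pos t]
  · have key {u v : M.N} (huv : u < v) : (ofN u + 1) * hp t ≤ ofN v * hp t := by
      refine mul_le_mul_of_nonneg_right ?_ (hp_pos t).le
      rw [← Frac.ofN_one, ← Frac.ofN_add, Frac.ofN_le]
      exact lt_iff_succ_le.1 huv
    simp only [ha, hb]
    exact (lt_or_gt_of_ne (hinj m hm m' hm')).imp key key
  · rw [ha] at h₁
    rw [hb] at h₂
    obtain ⟨h₃, h₄⟩ := (hP m hm).1
    rw [hy]
    exact inI_of_le (hreal hi) (ap_pt p i) hx h₁ h₂ h₃ h₄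
  · rw [ha] at h₁
    rw [hb] at h₂
    rw [hy]
    exact not_inI_of_le (hreal (hj.le.trans hi)) (ap_pt p j) hx h₁ h₂ ((hP m hm).2 j hj)
  · have hsub : (fun i => ap b i - ap a i) = fun _ => hp t := by
      funext m
      rw [ha, hb]
      ring
    rwa [hsub, isum_const, hl]

theorem not_rEq_pt {p i j : M.N} (h : j < i) : ¬ REq (pt p i) (pt p j) := fun hr => by
  have h₁ := (hr (p + 1 + 1)).1
  have h₂ := Frac.ofN_le.2 (lt_iff_succ_le.1 h)
  rw [Frac.ofN_add, Frac.ofN_one] at h₂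
  rw [ap_pt, ap_pt, hp_succ, hp_succ] at h₁
  nlinarith [hp_pos p]

/-- The covering principle in a model: the dyadic points of a level as in `exists_good_level` are as
required. -/
theorem hasCover (hM : M.Models WKL) (hΨ : IsPosFun Ψ) (hsmall : SmallCover Ψ) {ε : M.D one}
    (hε : IsReal ε) (hpos : GtQ 0 ε) : HasCover Ψ ε := by
  obtain ⟨k, hk⟩ := hpos
  obtain ⟨c, d, hcd, hcov, hsum⟩ := hsmall (k + 1 + 1 + 1)
  obtain ⟨p, hgood⟩ := exists_good_level hM hΨ hcov
  -- The cells of level `p + t` are so fine that the boundary cells of the `2 ^ p + 1` intervals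
  -- have total length below `2 ^ (-(k + 3))`.
  set t : M.N := k + 1 + 1 + 1 + 1 + 1 + 1 + 1 + 1 with ht
  set h : M.Q := hp (p + t) with hh
  set α : M.N → M.Q := fun i => ofN i * hp p - ap (M.app Ψ (pt p i)) (p + t) with hα
  set β : M.N → M.Q := fun i => ofN i * hp p + ap (M.app Ψ (pt p i)) (p + t) with hβ
  have hap : RepQ fun r => ap (M.app Ψ (pt p (r 0))) (p + t) :=
    (((Rep.const Ψ).app (.pt (.const p) (.var 0))).app (.const _)).val
  have hi' : RepQ fun r : ℕ → M.N => ofN (r 0) * hp p := .mul (.ofN (.var 0)) (.const _)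
  have hα' : RepQ fun r => α (r 0) := hi'.sub hap
  have hβ' : RepQ fun r => β (r 0) := hi'.add hap
  have hh0 : 0 < h := hp_pos _
  have hnew : RepQ fun r => count (CellNew α β h (r 0)) (p2 (p + t)) :=
    RepQ.count (P := fun s r => CellNew α β h (r 0) s)
      (DecP.cellNew h hα' hβ' (.var 1) (.var 0)) (.const _)
  -- The lower bound for the length of `J_{y_i}` has to be strict, so one cell is given away.
  obtain ⟨q, hq⟩ := exists_ap_eq
    (f := fun i => count (CellNew α β h i) (p2 (p + t)) * h - h)
    ((hnew.mul (.const h)).sub (.const h))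
  have hy (i : M.N) : M.app (lamN fun i => pt p i) i = pt p i :=
    Rep.app_lamN (F := fun i => pt p i) (.pt (.const p) (.var 0)) i
  refine ⟨p2 p, lamN fun i => pt p i, q, fun i hi => ?_, fun i _ j hj => ?_, fun i hi => ?_,
    k + 1 + 1 + 1, ?_⟩
  · rw [hy]
    exact inUnit_pt hi
  · rw [hy, hy]
    exact not_rEq_pt hj
  · refine ltLengthJ_of_lt_count hΨ hy hi (t := p + t) (n := p2 (p + t)) ?_
    rw [hq]
    linarith
  · have hsumq (m : M.N) : isum (fun i => ap q i) m =
        isum (fun i => count (CellNew α β h i) (p2 (p + t)) + 8) m * h - ofN m * (9 * h) := by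
      have hnew8 := hnew.add (.const 8)
      -- Nine cells are lost for each point: eight near the end points and the one given away.
      refine isum_eq (S := fun m => isum (fun i => count (CellNew α β h i) (p2 (p + t)) + 8) m * h -
        ofN m * (9 * h)) (repQ_ap q (.var 0))
        (((isum_spec hnew8).1.mul (.const h)).sub (.mul (.ofN (.var 0)) (.const _))) ?_ ?_ m
      · rw [isum_zero hnew8, Frac.ofN_zero]
        ring
      · intro n
        rw [isum_succ hnew8, hq, Frac.ofN_add, Frac.ofN_one]
        ring
    have h₁ := count_le_add (n := p2 (p + t)) (P := fun _ => True) ⟨_, .const 0, fun _ => by simp⟩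
      (DecP.cellMeets h hα' hβ' (.const (p2 p + 1)) (.var 0))
      (DecP.cellCovered c d h (.const p) (.var 0)) fun s hs _ => meets_or_covered hΨ hgood hs
    rw [count_true] at h₁
    have h₂ := count_cellMeets_le h hα' hβ' hh0 (p2 (p + t)) (p2 p + 1)
    have h₃ := count_cellCovered_le hcd hh0 (p2 (p + t)) p
    have h₄ := hsum p
    have h₅ : 1 ≤ isum (fun i => count (CellNew α β h i) (p2 (p + t)) + 8) (p2 p + 1) * h +
        isum (fun i => ap d i - ap c i) p := by
      rw [← p2_mul_hp (p + t)]
      nlinarith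
    have h₆ : ofN (p2 p + 1) * (9 * h) ≤ 18 * hp t := by
      have h₇ : 1 ≤ ofN (p2 p) := by
        rw [← Frac.ofN_one, Frac.ofN_le]
        simpa using lt_iff_succ_le.1 (p2_pos p)
      have h₈ : ofN (p2 p) * h = hp t := by
        rw [hh, hp_add, ← mul_assoc, p2_mul_hp, one_mul]
      rw [Frac.ofN_add, Frac.ofN_one]
      nlinarith
    have h₇ := hε.sub_lt_add k (k + 1 + 1 + 1 + 1)
    rw [hsumq]
    simp only [ht, hp_succ] at h₄ h₆ h₇ ⊢
    linarith [hp_pos k]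

end Cover

end Model

end HOArith

theorem mainTheorem4 :
    HOArith.Proves (HOArith.RCA₀ω ∪ {HOArith.WKL}) HOArith.WHBUae := by
  open HOArith in
  refine proves_of_forall_models fun M hM => ?_
  have hM' : ∀ φ ∈ RCA₀ω, M.Models φ := fun φ hφ => hM φ (.inl hφ)
  have hWKL : (Model.ofStr M hM').Models WKL :=
    (Model.models_ofStr M hM' WKL).2 (hM WKL (.inr rfl))
  exact (Model.models_ofStr M hM' WHBUae).1 <| Model.models_WHBUae fun Ψ ε hΨ hsmall hε hpos =>
    Model.hasCover hWKL hΨ hsmall hε hpos
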